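/- **Setting.** There are $n\ge 1$ workers, the vertices of a connected undirected graph $G$. Worker $i$ needs $h_i>0$ seconds to compute one stochastic gradient. Along every edge $\{i,j\}$, $b_{ij}=b_{ji}>0$ coordinates per second can be sent in each direction, in both directions at once. Everything else takes no time. *Heterogeneous problems.* $f=\frac1n\sum_{i=1}^n f_i$ with $f_i:\mathbb R^d\to\mathbb R$ differentiable, $\|\nabla f(x)-\nabla f(y)\|\le L\|x-y\|$ for all $x,y$, and $f(0)-\inf f\le\Delta$. Worker $i$ has a stochastic gradient $\nabla f_i(x;\xi)$ with $\mathbb E_\xi\nabla f_i(x;\xi)=\nabla f_i(x)$ and $\mathbb E_\xi\|\nabla f_i(x;\xi)-\nabla f_i(x)\|^2\le\sigma^2$ for all $x$. *Homogeneous problems:* in addition all workers have the same function, the same stochastic gradient and the same distribution of $\xi$. All samples are independent. *Algorithms.* We consider distributed zero-respecting algorithms. Worker $i$ keeps a set $I_i$ of vectors, initially empty. Repeatedly, it chooses from its local information a point $x$ with $\mathrm{supp}(x)\subseteq\bigcup_{y\in I_i}\mathrm{supp}(y)$, computes a stochastic gradient at $x$ in $h_i$ seconds, adds it to $I_i$,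 and then optionally waits. In parallel it launches messages: for message $k$ it chooses from its local information a vector $s$ with $\mathrm{supp}(s)\subseteq\bigcup_{y\in I_i}\mathrm{supp}(y)$ and sends the entries $(\nu_j,\,c_j s_{\nu_j})$, $1\le j\le p_i^k$, where $p_i^k\ge1$, to another worker, which adds $\sum_j c_j s_{\nu_j}e_{\nu_j}$ to its set when the message has completely arrived. Messages can be routed through $G$ in any way (split, interleaved, buffered) that respects the bandwidths and in which no worker other than the sender forwards more of a message than it has received. The indices $\nu_j$, coefficients $c_j$, destinations, launch times and routing are predefined or random (drawn with the seed of the algorithm), but do not depend on the problem or on the local information. The algorithm may depend on all parameters, and on the problem only through its stochastic gradients. *Optimal time.* For an algorithm $A$ and a problem, let $G_t$ be the set of all points $y$ such that $\mathrm{supp}(y)\subseteq\bigcup_{v\in I_i}\mathrm{supp}(v)$ for some worker $i$ at time $t$. The time that $A$ needs is the infimum of the $t\ge0$ with $\mathbb E\inf_{y\in G_t}\|\nabla f(y)\|^2\le\varepsilon$. The optimal time complexity of a class of problems is the infimum over all algorithms of the supremum of this time over the problems in the class. *Leon SGD* (for equal computation times, started at $x^0=0$): let $B$ be the least integer $B\ge1$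 with $B\ge\max\{\lceil\sigma^2/\varepsilon\rceil,n\}/n$. In iteration $k$ every worker computes $B$ stochastic gradients at $x^k$, the average over all workers is made available to all workers (AllReduce), and $$x^{k+1}=x^k-\frac{1}{2L}\cdot\frac1n\sum_{i=1}^n\frac1B\sum_{j=1}^{B}\nabla f_i(x^k;\xi^k_{ij}).$$ **Corollary (sparse graphs).** There are universal constants $q\in\mathbb N$ and $c_1,c_3>0$ such that for every $p\in\mathbb N$ and $c_0>0$ there are constants $c,C>0$, depending only on $p$ and $c_0$, with the following property. Assume that $L,\Delta,\varepsilon>0$ and $\sigma\ge0$, that $h_i=h$ for all $i$, that every node of $G$ has degree at most $p$, that all edges have the same bandwidth $b>0$, and that $$\frac{\sigma^2}{\varepsilon}\ge c_0\frac{d}{bh},\qquad \frac{L\Delta}{\varepsilon}\ge c_1\log^{10}(n+1),\qquad d\ge\frac{c_3L\Delta}{\log^3(n+1)\,\varepsilon}.$$ Let $$R=\frac{dL\Delta}{b\varepsilon}+\frac{h\sigma^2L\Delta}{n\varepsilon^2}+\frac{hL\Delta}{\varepsilon}.$$ Then both in the homogeneous and in the heterogeneous setting the optimal time complexity lies between $\frac{c}{\log^{q}(n+1)}R$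 and $C\log^{q}(n+1)\,R$, that is, it is $\tilde\Theta(R)$. It is achieved by Leon SGD: Leon SGD can be implemented as an algorithm of the above kind so that, for every homogeneous or heterogeneous problem, there is $K\ge1$ such that all workers have $x^0,\dots,x^{K-1}$ by time $C\log^{q}(n+1)\,R$ and $\frac1K\sum_{k=0}^{K-1}\mathbb E\|\nabla f(x^k)\|^2\le\varepsilon$, so that an iterate chosen uniformly at random is an $\varepsilon$-stationary point. -/

import Mathlib

open MeasureTheory
open scoped ENNReal NNReal

/-- Coordinate vectors of dimension `d`, with the Euclidean norm. -/
abbrev Vec (d : ℕ) := EuclideanSpace ℝ (Fin d)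

/-! ### The computation and communication environment -/

/-- `n` workers; worker `i` needs `time i` seconds per stochastic gradient. The communication graph
is connected, every edge is bidirectional, and `bw u v` coordinates per second can be sent from `u`
to `v` (and, at the same time, from `v` to `u`) along the edge `{u, v}`. -/
structure Network (n : ℕ) where
  graph : SimpleGraph (Fin n)
  connected : graph.Connected
  bw : Fin n → Fin n → ℝ
  bw_pos : ∀ u v, graph.Adj u v → 0 < bw u v
  bw_symm : ∀ u v, bw u v = bw v u
  time : Fin n → ℝ
  time_pos : ∀ i, 0 < time i

open Classical in
/-- Capacity of the directed link from `u` to `v`; zero if there is no link. -/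
noncomputable def Network.cap {n : ℕ} (N : Network n) (u v : Fin n) : ℝ :=
  if N.graph.Adj u v then N.bw u v else 0

/-! ### Optimization problems -/

/-- Worker `i` holds the function `fn i` and can draw stochastic gradients `oracle i x ξ` with
`ξ ∼ law i`. -/
structure Problem (n d : ℕ) where
  Ξ : Type
  [measurableSpace : MeasurableSpace Ξ]
  law : Fin n → Measure Ξ
  [isProbability : ∀ i, IsProbabilityMeasure (law i)]
  fn : Fin n → Vec d → ℝ
  oracle : Fin n → Vec d → Ξ → Vec d
  measurable_oracle : ∀ i, Measurable (Function.uncurry (oracle i))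

attribute [instance] Problem.measurableSpace Problem.isProbability

namespace Problem

variable {n d : ℕ}

/-- The objective `f = (1/n) ∑ fᵢ`. -/
noncomputable def objective (P : Problem n d) (x : Vec d) : ℝ :=
  (1 / (n : ℝ)) * ∑ i, P.fn i x

/-- Heterogeneous setting: `f` is `L`-smooth with `f(0) - inf f ≤ Δ`, and every worker has unbiased
stochastic gradients of its own function with variance at most `σ²`. -/
structure Heterogeneous (P : Problem n d) (L Δ σ : ℝ) : Prop where
  differentiable : Differentiable ℝ P.objective
  smooth : ∀ x y, ‖gradient P.objective x - gradient P.objective y‖ ≤ L * ‖x - y‖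
  gap : ∀ x, P.objective 0 - P.objective x ≤ Δ
  differentiable_fn : ∀ i, Differentiable ℝ (P.fn i)
  integrable : ∀ i x, Integrable (P.oracle i x) (P.law i)
  unbiased : ∀ i x, ∫ ξ, P.oracle i x ξ ∂(P.law i) = gradient (P.fn i) x
  variance : ∀ i x, ∫⁻ ξ, ENNReal.ofReal (‖P.oracle i x ξ - gradient (P.fn i) x‖ ^ 2) ∂(P.law i)
    ≤ ENNReal.ofReal (σ ^ 2)

/-- Homogeneous setting: all workers share one function, one oracle and one distribution
(so that the objective is the common function). -/
structure Homogeneous (P : Problem n d) (L Δ σ : ℝ) : Prop extends P.Heterogeneous L Δ σ where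
  same_fn : ∀ i j, P.fn i = P.fn j
  same_oracle : ∀ i j, P.oracle i = P.oracle j
  same_law : ∀ i j, P.law i = P.law j

end Problem

/-- The two settings of distributed optimization. -/
inductive Setting where
  | homogeneous
  | heterogeneous

/-- The problems over which the worst case is taken in the given setting. -/
def problemClass {n d : ℕ} (L Δ σ : ℝ) : Setting → Set (Problem n d)
  | .homogeneous => {P | P.Homogeneous L Δ σ}
  | .heterogeneous => {P | P.Heterogeneous L Δ σ}

/-! ### Distributed zero-respecting algorithms -/

/-- What a worker knows at some moment: the clock, the number of stochastic gradients it has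
computed, these gradients (in order), and the vectors received from the other workers (`j k` is the
`k`-th message of worker `j`). Vectors that are not yet available are recorded as `0`. -/
abbrev View (n d : ℕ) := ℝ × ℕ × (ℕ → Vec d) × (Fin n → ℕ → Vec d)

/-- The union of the supports of all vectors in the local information. -/
def View.support {n d : ℕ} (V : View n d) : Set (Fin d) :=
  {c | (∃ m, V.2.2.1 m c ≠ 0) ∨ ∃ j k, V.2.2.2 j k c ≠ 0}

/-- Communication plan with seed space `Z`: predefined or random, but not a function of the local
information (only the transmitted values depend on it).
Message `k` of worker `i` is launched at time `launch i k`, consists of the `size i k` entries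
`(ν, c * s ν)` of a vector `s`, where `ν` runs through `index i k` and `c` through `coef i k`,
and is routed to the worker `dest i k`: `flow i k z u v t` is the (real) number of coordinates of
this message that have crossed the link from `u` to `v` up to time `t`. Messages can be split,
interleaved and buffered arbitrarily; the only restrictions are the capacities of the links and that
no worker other than the source forwards more than it has received. -/
structure Plan {n : ℕ} (N : Network n) (d : ℕ) (Z : Type) [MeasurableSpace Z] where
  launch : Fin n → ℕ → Z → ℝ≥0
  dest : Fin n → ℕ → Z → Fin n
  size : Fin n → ℕ → ℕ
  size_pos : ∀ i k, 1 ≤ size i k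
  index : (i : Fin n) → (k : ℕ) → Z → Fin (size i k) → Fin d
  coef : (i : Fin n) → (k : ℕ) → Z → Fin (size i k) → ℝ
  flow : Fin n → ℕ → Z → Fin n → Fin n → ℝ → ℝ
  flow_mono : ∀ i k z u v, Monotone (flow i k z u v)
  flow_launch : ∀ i k z u v (t : ℝ), t ≤ launch i k z → flow i k z u v t = 0
  flow_dest : ∀ i k z v t, flow i k z (dest i k z) v t = 0
  flow_relay : ∀ i k z w t, w ≠ i → ∑ v, flow i k z w v t ≤ ∑ u, flow i k z u w t
  flow_cap : ∀ (M : Finset (Fin n × ℕ)) z u v s t, s ≤ t →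
    ∑ m ∈ M, (flow m.1 m.2 z u v t - flow m.1 m.2 z u v s) ≤ N.cap u v * (t - s)
  measurable_launch : ∀ i k, Measurable (launch i k)
  measurable_dest : ∀ i k, Measurable (dest i k)
  measurable_index : ∀ i k, Measurable (index i k)
  measurable_coef : ∀ i k, Measurable (coef i k)
  measurable_flow : ∀ i k u v t, Measurable fun z => flow i k z u v t

namespace Plan

variable {n d : ℕ} {N : Network n} {Z : Type} [MeasurableSpace Z]

/-- Message `k` of worker `i` has completely arrived at worker `j` by time `t`. -/
def Delivered (C : Plan N d Z) (z : Z) (i : Fin n) (k : ℕ) (j : Fin n) (t : ℝ) : Prop :=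
  C.dest i k z = j ∧ (C.size i k : ℝ) ≤ ∑ u, C.flow i k z u j t

/-- The vector that the receiver assembles from message `k` of worker `i` when the sparsifier is
applied to `s`. -/
noncomputable def decode (C : Plan N d Z) (z : Z) (i : Fin n) (k : ℕ) (s : Vec d) : Vec d :=
  ∑ l, EuclideanSpace.single (C.index i k z l) (C.coef i k z l * s (C.index i k z l))

end Plan

/-- A (randomized) distributed zero-respecting algorithm. From its current local information, worker
`i` chooses the point of its `m`-th stochastic gradient (`query`), the time for which it idles after
that gradient has been computed (`wait`), and the vector to which the `k`-th sparsifier is applied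
when its `k`-th message is launched (`send`). Points and vectors are supported in the union of the
supports of the local information. -/
structure Algorithm {n : ℕ} (N : Network n) (d : ℕ) where
  Z : Type
  [measurableSpace : MeasurableSpace Z]
  seed : Measure Z
  [isProbability : IsProbabilityMeasure seed]
  plan : Plan N d Z
  query : Fin n → ℕ → Z → View n d → Vec d
  wait : Fin n → ℕ → Z → View n d → ℝ≥0
  send : Fin n → ℕ → Z → View n d → Vec d
  measurable_query : ∀ i m, Measurable (Function.uncurry (query i m))
  measurable_wait : ∀ i m, Measurable (Function.uncurry (wait i m))
  measurable_send : ∀ i k, Measurable (Function.uncurry (send i k))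
  query_support : ∀ i m z V c, query i m z V c ≠ 0 → c ∈ View.support V
  send_support : ∀ i k z V c, send i k z V c ≠ 0 → c ∈ View.support V

attribute [instance] Algorithm.measurableSpace Algorithm.isProbability

/-! ### Execution of the protocol -/

/-- Record of an execution: starting times and points of the gradient computations, and the vectors
to which the sparsifiers are applied. -/
@[ext] structure Run (n d : ℕ) where
  start : Fin n → ℕ → ℝ
  point : Fin n → ℕ → Vec d
  sent : Fin n → ℕ → Vec d

namespace Algorithm

variable {n d : ℕ} {N : Network n}

/-- Outcomes: the seed of the algorithm, and the sample used in the `m`-th gradient computation of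
worker `i`, for all `(i, m)`. -/
abbrev Outcome (A : Algorithm N d) (P : Problem n d) := A.Z × (Fin n × ℕ → P.Ξ)

/-- All samples are independent of each other and of the seed. -/
noncomputable def prob (A : Algorithm N d) (P : Problem n d) : Measure (A.Outcome P) :=
  A.seed.prod (Measure.infinitePi fun p : Fin n × ℕ => P.law p.1)

open Classical in
/-- Local information of worker `i` at time `t`. -/
noncomputable def view (A : Algorithm N d) (P : Problem n d) (ω : A.Outcome P) (r : Run n d)
    (i : Fin n) (t : ℝ) : View n d :=
  (t, {m | r.start i m + N.time i ≤ t}.ncard,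
    fun m => if r.start i m + N.time i ≤ t then P.oracle i (r.point i m) (ω.2 (i, m)) else 0,
    fun j k => if A.plan.Delivered ω.1 j k i t then A.plan.decode ω.1 j k (r.sent j k) else 0)

/-- `r` is the execution of the protocol: worker `i` alternates between choosing a point, computing
a stochastic gradient there for `N.time i` seconds, and idling; in parallel it launches its
messages. -/
structure IsRun (A : Algorithm N d) (P : Problem n d) (ω : A.Outcome P) (r : Run n d) : Prop where
  start_zero : ∀ i, r.start i 0 = 0
  start_succ : ∀ i m, r.start i (m + 1) = r.start i m + N.time i +
    A.wait i m ω.1 (A.view P ω r i (r.start i m + N.time i))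
  point_eq : ∀ i m, r.point i m = A.query i m ω.1 (A.view P ω r i (r.start i m))
  sent_eq : ∀ i k, r.sent i k = A.send i k ω.1 (A.view P ω r i (A.plan.launch i k ω.1))

/-- One round of evaluating the equations of `IsRun`. -/
noncomputable def step (A : Algorithm N d) (P : Problem n d) (ω : A.Outcome P) (r : Run n d) :
    Run n d :=
  let s : Fin n → ℕ → ℝ := fun i m => Nat.casesOn m 0 fun m => r.start i m + N.time i +
    A.wait i m ω.1 (A.view P ω r i (r.start i m + N.time i))
  { start := s
    point := fun i m => A.query i m ω.1 (A.view P ω r i (s i m))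
    sent := fun i k => A.send i k ω.1 (A.view P ω r i (A.plan.launch i k ω.1)) }

/-- The records `r` and `r'` coincide up to time `T`. -/
def Agree (A : Algorithm N d) (z : A.Z) (T : ℝ) (r r' : Run n d) : Prop :=
  (∀ i m, (r.start i m ≤ T ∨ r'.start i m ≤ T) →
    r.start i m = r'.start i m ∧ r.point i m = r'.point i m) ∧
  ∀ i k, (A.plan.launch i k z : ℝ) ≤ T → r.sent i k = r'.sent i k

theorem Agree.mono {A : Algorithm N d} {z : A.Z} {T T' : ℝ} {r r' : Run n d}
    (h : A.Agree z T' r r') (hT : T ≤ T') : A.Agree z T r r' :=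
  ⟨fun i m hm => h.1 i m (hm.imp (le_trans · hT) (le_trans · hT)),
    fun i k hk => h.2 i k (hk.trans hT)⟩

/-- Computations and transmissions take a time that is bounded away from zero. -/
theorem exists_lag (A : Algorithm N d) : ∃ δ : ℝ, 0 < δ ∧ (∀ i, δ ≤ N.time i) ∧
    ∀ z i k j t, A.plan.Delivered z i k j t → (A.plan.launch i k z : ℝ) + δ ≤ t := by
  obtain ⟨δ₁, hδ₁, h₁⟩ : ∃ δ : ℝ, 0 < δ ∧ ∀ i, δ ≤ N.time i := by
    rcases isEmpty_or_nonempty (Fin n) with hn | hn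
    · exact ⟨1, one_pos, fun i => hn.elim i⟩
    · obtain ⟨i, hi⟩ := Finite.exists_min N.time
      exact ⟨_, N.time_pos i, hi⟩
  set W : ℝ := ∑ u, ∑ v, |N.cap u v| + 1 with hW
  have hWpos : 0 < W := by positivity
  refine ⟨min δ₁ (1 / W), by positivity, fun i => (min_le_left _ _).trans (h₁ i), ?_⟩
  rintro z i k j t ⟨-, ht⟩
  have h1 : (1 : ℝ) ≤ A.plan.size i k := by exact_mod_cast A.plan.size_pos i k
  rcases le_total t (A.plan.launch i k z) with hl | hl
  · simp only [A.plan.flow_launch i k z _ _ t hl, Finset.sum_const_zero] at ht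
    linarith
  · have hf : ∀ u, A.plan.flow i k z u j t ≤ |N.cap u j| * (t - A.plan.launch i k z) := by
      intro u
      have := A.plan.flow_cap {(i, k)} z u j _ _ hl
      rw [Finset.sum_singleton, A.plan.flow_launch i k z u j _ le_rfl, sub_zero] at this
      exact this.trans (mul_le_mul_of_nonneg_right (le_abs_self _) (by linarith))
    have h2 : (1 : ℝ) ≤ W * (t - A.plan.launch i k z) := by
      refine (h1.trans ht).trans ((Finset.sum_le_sum fun u _ => hf u).trans ?_)
      rw [← Finset.sum_mul]
      refine mul_le_mul_of_nonneg_right ?_ (by linarith)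
      have : ∑ u, |N.cap u j| ≤ ∑ u, ∑ v, |N.cap u v| :=
        Finset.sum_le_sum fun u _ => Finset.single_le_sum (f := fun v => |N.cap u v|)
          (fun v _ => abs_nonneg _) (Finset.mem_univ j)
      linarith
    have h3 : 1 / W ≤ t - A.plan.launch i k z := by
      rw [div_le_iff₀ hWpos]; linarith
    linarith [min_le_right δ₁ (1 / W)]

theorem view_congr {A : Algorithm N d} {P : Problem n d} {ω : A.Outcome P} {δ T t : ℝ}
    (h₁ : ∀ i, δ ≤ N.time i)
    (h₂ : ∀ z i k j t, A.plan.Delivered z i k j t → (A.plan.launch i k z : ℝ) + δ ≤ t)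
    {r r' : Run n d} (h : A.Agree ω.1 T r r') (ht : t ≤ T + δ) (i : Fin n) :
    A.view P ω r i t = A.view P ω r' i t := by
  have key : ∀ m, (r.start i m + N.time i ≤ t ↔ r'.start i m + N.time i ≤ t) := by
    intro m
    constructor
    · intro hm
      have := h₁ i
      rwa [← (h.1 i m (Or.inl (by linarith))).1]
    · intro hm
      have := h₁ i
      rwa [(h.1 i m (Or.inr (by linarith))).1]
  unfold view
  refine Prod.ext rfl (Prod.ext ?_ (Prod.ext ?_ ?_))
  · simp only [key]
  · funext m
    by_cases hm : r.start i m + N.time i ≤ t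
    · have := h₁ i
      simp only [if_pos hm, if_pos ((key m).1 hm), (h.1 i m (Or.inl (by linarith))).2]
    · simp only [if_neg hm, if_neg (fun hc => hm ((key m).2 hc))]
  · funext j k
    by_cases hd : A.plan.Delivered ω.1 j k i t
    · have := h₂ _ _ _ _ _ hd
      simp only [if_pos hd, h.2 j k (by linarith)]
    · simp only [if_neg hd]

theorem step_agree {A : Algorithm N d} {P : Problem n d} {ω : A.Outcome P} {δ T : ℝ}
    (h₁ : ∀ i, δ ≤ N.time i)
    (h₂ : ∀ z i k j t, A.plan.Delivered z i k j t → (A.plan.launch i k z : ℝ) + δ ≤ t)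
    {r r' : Run n d} (h : A.Agree ω.1 T r r') :
    A.Agree ω.1 (T + δ) (A.step P ω r) (A.step P ω r') := by
  have hs : ∀ i m, ((A.step P ω r).start i m ≤ T + δ ∨ (A.step P ω r').start i m ≤ T + δ) →
      (A.step P ω r).start i m = (A.step P ω r').start i m := by
    intro i m hm
    cases m with
    | zero => rfl
    | succ m =>
      have hti := h₁ i
      have hw : ∀ r : Run n d, (A.step P ω r).start i (m + 1) = r.start i m + N.time i +
        A.wait i m ω.1 (A.view P ω r i (r.start i m + N.time i)) := fun _ => rfl
      rw [hw, hw] at hm ⊢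
      have hnn := fun V => (A.wait i m ω.1 V).coe_nonneg
      have hr : r.start i m + N.time i ≤ T + δ ∨ r'.start i m + N.time i ≤ T + δ := by
        rcases hm with hm | hm
        · left; linarith [hnn (A.view P ω r i (r.start i m + N.time i))]
        · right; linarith [hnn (A.view P ω r' i (r'.start i m + N.time i))]
      have he := (h.1 i m (hr.imp (fun _ => by linarith) (fun _ => by linarith))).1
      have ht : r'.start i m + N.time i ≤ T + δ := by
        rcases hr with hr | hr
        · rwa [← he]
        · exact hr
      rw [he, view_congr h₁ h₂ h ht i]
  refine ⟨fun i m hm => ⟨hs i m hm, ?_⟩, fun i k hk => ?_⟩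
  · have he := hs i m hm
    have ht : (A.step P ω r').start i m ≤ T + δ := by
      rcases hm with hm | hm
      · rwa [← he]
      · exact hm
    change A.query i m ω.1 (A.view P ω r i ((A.step P ω r).start i m)) =
      A.query i m ω.1 (A.view P ω r' i ((A.step P ω r').start i m))
    rw [he, view_congr h₁ h₂ h ht i]
  · change A.send i k ω.1 _ = A.send i k ω.1 _
    rw [view_congr h₁ h₂ h hk i]

theorem isRun_iff {A : Algorithm N d} {P : Problem n d} {ω : A.Outcome P} {r : Run n d} :
    A.IsRun P ω r ↔ A.step P ω r = r := by
  constructor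
  · intro h
    have hs : (A.step P ω r).start = r.start := by
      funext i m
      cases m with
      | zero => exact (h.start_zero i).symm
      | succ m => exact (h.start_succ i m).symm
    refine Run.ext hs ?_ ?_
    · funext i m
      change A.query i m ω.1 (A.view P ω r i ((A.step P ω r).start i m)) = _
      rw [hs, h.point_eq i m]
    · funext i k
      exact (h.sent_eq i k).symm
  · intro h
    have hs : (A.step P ω r).start = r.start := by rw [h]
    refine ⟨fun i => ?_, fun i m => ?_, fun i m => ?_, fun i k => ?_⟩
    · conv_lhs => rw [← h]
      rfl
    · conv_lhs => rw [← h]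
      rfl
    · conv_lhs => rw [← h]
      change A.query i m ω.1 (A.view P ω r i ((A.step P ω r).start i m)) = _
      rw [hs]
    · conv_lhs => rw [← h]
      rfl

/-- Every outcome determines exactly one execution. -/
theorem existsUnique_run (A : Algorithm N d) (P : Problem n d) (ω : A.Outcome P) :
    ∃! r : Run n d, A.IsRun P ω r := by
  obtain ⟨δ, hδ, h₁, h₂⟩ := A.exists_lag
  have hbase : ∀ r r' : Run n d, (∀ i m, 0 ≤ r.start i m) → (∀ i m, 0 ≤ r'.start i m) →
      A.Agree ω.1 (-δ) r r' := by
    intro r r' hr hr'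
    refine ⟨fun i m hm => ?_, fun i k hk => ?_⟩
    · exfalso
      rcases hm with hm | hm
      · linarith [hr i m]
      · linarith [hr' i m]
    · exfalso
      linarith [(A.plan.launch i k ω.1).coe_nonneg]
  have hnonneg : ∀ r : Run n d, (∀ i m, 0 ≤ r.start i m) →
      ∀ i m, 0 ≤ (A.step P ω r).start i m := by
    intro r hr i m
    cases m with
    | zero => exact le_rfl
    | succ m =>
      change (0 : ℝ) ≤ r.start i m + N.time i + _
      have := hr i m
      have := N.time_pos i
      positivity
  let R : ℕ → Run n d := fun k => (A.step P ω)^[k] ⟨fun _ _ => 0, fun _ _ => 0, fun _ _ => 0⟩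
  have hRs : ∀ k, R (k + 1) = A.step P ω (R k) := fun k => Function.iterate_succ_apply' _ _ _
  have hR0 : ∀ k i m, 0 ≤ (R k).start i m := by
    intro k
    induction k with
    | zero => intro i m; exact le_rfl
    | succ k ih => rw [hRs]; exact hnonneg _ ih
  have hRR : ∀ k l : ℕ, A.Agree ω.1 ((k : ℝ) * δ - δ) (R k) (R (k + l)) := by
    intro k
    induction k with
    | zero => intro l; simpa using hbase _ _ (hR0 0) (hR0 (0 + l))
    | succ k ih =>
      intro l
      have := step_agree (P := P) h₁ h₂ (ih l)
      rw [show k + 1 + l = k + l + 1 by omega, hRs, hRs]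
      exact this.mono (by push_cast; linarith)
  have hbig : ∀ T : ℝ, ∃ k : ℕ, T ≤ (k : ℝ) * δ - δ := by
    intro T
    obtain ⟨k, hk⟩ := exists_nat_ge ((T + δ) / δ)
    refine ⟨k, ?_⟩
    rw [div_le_iff₀ hδ] at hk
    linarith
  have hRR' : ∀ T : ℝ, ∃ k, ∀ l, k ≤ l → A.Agree ω.1 T (R k) (R l) := by
    intro T
    obtain ⟨k, hk⟩ := hbig T
    refine ⟨k, fun l hl => ?_⟩
    obtain ⟨e, rfl⟩ := Nat.exists_eq_add_of_le hl
    exact (hRR k e).mono hk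
  have hconv : ∀ i m, ∃ (k : ℕ) (θ : ℝ), ∀ l, k ≤ l → (R l).start i m = θ := by
    intro i m
    induction m with
    | zero =>
      refine ⟨1, 0, fun l hl => ?_⟩
      obtain ⟨e, rfl⟩ := Nat.exists_eq_add_of_le' hl
      rw [hRs]; rfl
    | succ m ih =>
      obtain ⟨k, θ, hk⟩ := ih
      obtain ⟨k', hk'⟩ := hRR' (θ + N.time i)
      refine ⟨max k k' + 1, θ + N.time i +
        A.wait i m ω.1 (A.view P ω (R k') i (θ + N.time i)), fun l hl => ?_⟩
      obtain ⟨e, rfl⟩ := Nat.exists_eq_add_of_le' (show 1 ≤ l by omega)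
      rw [hRs]
      change (R e).start i m + N.time i +
        A.wait i m ω.1 (A.view P ω (R e) i ((R e).start i m + N.time i)) = _
      rw [hk e (by omega), view_congr h₁ h₂ (hk' e (by omega)) (by linarith) i]
  have hconv2 : ∀ i m, ∃ (k : ℕ) (x : Vec d), ∀ l, k ≤ l → (R l).point i m = x := by
    intro i m
    obtain ⟨k, θ, hk⟩ := hconv i m
    obtain ⟨k', hk'⟩ := hRR' θ
    refine ⟨max k k', (R k').point i m, fun l hl => ?_⟩
    exact ((hk' l (by omega)).1 i m (Or.inr (hk l (by omega)).le)).2.symm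
  have hconv3 : ∀ i m, ∃ (k : ℕ) (x : Vec d), ∀ l, k ≤ l → (R l).sent i m = x := by
    intro i m
    obtain ⟨k', hk'⟩ := hRR' (A.plan.launch i m ω.1)
    exact ⟨k', (R k').sent i m, fun l hl => ((hk' l hl).2 i m le_rfl).symm⟩
  choose k₁ θ hθ using hconv
  choose k₂ x hx using hconv2
  choose k₃ y hy using hconv3
  let r : Run n d := ⟨θ, x, y⟩
  have hlim : ∀ T : ℝ, ∃ k, ∀ l, k ≤ l → A.Agree ω.1 T (R l) r := by
    intro T
    obtain ⟨k, hk⟩ := hRR' T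
    refine ⟨k, fun l hl => ⟨fun i m hm => ?_, fun i m hm => ?_⟩⟩
    · let e := max l (max (k₁ i m) (k₂ i m))
      have e1 : (R e).start i m = θ i m := hθ i m e (by omega)
      have e2 : (R e).point i m = x i m := hx i m e (by omega)
      have hke := (hk e (by omega)).1 i m
      have hkl := (hk l hl).1 i m
      change (R l).start i m = θ i m ∧ (R l).point i m = x i m
      rcases hm with hm | hm
      · have a := hkl (Or.inr hm)
        have b := hke (Or.inl (a.1.trans_le hm))
        rw [← e1, ← e2, ← a.1, ← a.2]
        exact b
      · have b := hke (Or.inr (e1.trans_le hm))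
        have a := hkl (Or.inl (b.1.trans_le (e1.trans_le hm)))
        rw [← e1, ← e2, ← a.1, ← a.2]
        exact b
    · let e := max l (k₃ i m)
      have e1 : (R e).sent i m = y i m := hy i m e (by omega)
      change (R l).sent i m = y i m
      rw [← e1, ← (hk l hl).2 i m hm, (hk e (by omega)).2 i m hm]
  have hstep : A.step P ω r = r := by
    have hag : ∀ T : ℝ, A.Agree ω.1 T (A.step P ω r) r := by
      intro T
      obtain ⟨k, hk⟩ := hlim T
      have a := (step_agree (P := P) h₁ h₂ (hk k le_rfl)).mono (show T ≤ T + δ by linarith)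
      rw [← hRs] at a
      have b := hk (k + 1) (by omega)
      refine ⟨fun i m hm => ?_, fun i m hm => ?_⟩
      · rcases hm with hm | hm
        · have a' := a.1 i m (Or.inr hm)
          have b' := b.1 i m (Or.inl (a'.1.trans_le hm))
          exact ⟨a'.1.symm.trans b'.1, a'.2.symm.trans b'.2⟩
        · have b' := b.1 i m (Or.inr hm)
          have a' := a.1 i m (Or.inl (b'.1.trans_le hm))
          exact ⟨a'.1.symm.trans b'.1, a'.2.symm.trans b'.2⟩
      · exact (a.2 i m hm).symm.trans (b.2 i m hm)
    refine Run.ext ?_ ?_ ?_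
    · funext i m
      exact ((hag (r.start i m)).1 i m (Or.inr le_rfl)).1
    · funext i m
      exact ((hag (r.start i m)).1 i m (Or.inr le_rfl)).2
    · funext i m
      exact (hag (A.plan.launch i m ω.1)).2 i m le_rfl
  refine ⟨r, isRun_iff.2 hstep, fun r' hr' => ?_⟩
  have hstart : ∀ s : Run n d, A.IsRun P ω s → ∀ i m, 0 ≤ s.start i m := by
    intro s hs i m
    induction m with
    | zero => exact (hs.start_zero i).ge
    | succ m ih =>
      rw [hs.start_succ]
      have := N.time_pos i
      positivity
  have hag : ∀ k : ℕ, A.Agree ω.1 ((k : ℝ) * δ - δ) r' r := by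
    intro k
    induction k with
    | zero => simpa using hbase _ _ (hstart r' hr') (hstart r (isRun_iff.2 hstep))
    | succ k ih =>
      have := step_agree (P := P) h₁ h₂ ih
      rw [isRun_iff.1 hr', hstep] at this
      exact this.mono (by push_cast; linarith)
  have hag' : ∀ T : ℝ, A.Agree ω.1 T r' r := fun T => (hag _).mono (hbig T).choose_spec
  refine Run.ext ?_ ?_ ?_
  · funext i m
    exact ((hag' (r.start i m)).1 i m (Or.inr le_rfl)).1
  · funext i m
    exact ((hag' (r.start i m)).1 i m (Or.inr le_rfl)).2
  · funext i m
    exact (hag' (A.plan.launch i m ω.1)).2 i m le_rfl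

/-- The execution of `A` on the problem `P`. -/
noncomputable def run (A : Algorithm N d) (P : Problem n d) (ω : A.Outcome P) : Run n d :=
  (A.existsUnique_run P ω).choose

/-! ### Time complexity -/

/-- All points that can be constructed up to time `t` by some worker from its local information. -/
def reachable (A : Algorithm N d) (P : Problem n d) (ω : A.Outcome P) (t : ℝ) : Set (Vec d) :=
  {y | ∃ i, ∀ c, y c ≠ 0 → c ∈ View.support (A.view P ω (A.run P ω) i t)}

/-- The expectation of `inf ‖∇f(y)‖²` over all points `y` that can be constructed up to time `t`. -/
noncomputable def expectedBest (A : Algorithm N d) (P : Problem n d) (t : ℝ) : ℝ≥0∞ :=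
  ∫⁻ ω, ⨅ y ∈ A.reachable P ω t, ENNReal.ofReal (‖gradient P.objective y‖ ^ 2) ∂(A.prob P)

/-- The time that `A` needs to find an `ε`-stationary point of `P`. -/
noncomputable def timeTo (A : Algorithm N d) (P : Problem n d) (ε : ℝ) : ℝ≥0∞ :=
  ⨅ (t : ℝ≥0) (_ : A.expectedBest P t ≤ ENNReal.ofReal ε), (t : ℝ≥0∞)

end Algorithm

/-- The optimal time complexity of finding an `ε`-stationary point for the problems in `Q`: the best
worst-case time of an algorithm. -/
noncomputable def optimalTime {n : ℕ} (N : Network n) {d : ℕ} (Q : Set (Problem n d)) (ε : ℝ) :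
    ℝ≥0∞ :=
  ⨅ A : Algorithm N d, ⨆ P ∈ Q, A.timeTo P ε

/-! ### Leon SGD -/

/-- The local batch size in Leon SGD for workers with equal computation times. The local batch sizes
then grow simultaneously, and the workers stop as soon as
`((1/n) ∑ 1/Bᵢ)⁻¹ ≥ max {⌈σ²/ε⌉, n} / n`. -/
noncomputable def leonBatch (n : ℕ) (σ ε : ℝ) : ℕ :=
  sInf {B : ℕ | 1 ≤ B ∧ max (⌈σ ^ 2 / ε⌉₊ : ℝ) n / n ≤ ((1 / (n : ℝ)) * ∑ _i : Fin n, 1 / (B : ℝ))⁻¹}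

/-- The iterates of Leon SGD with starting point `0` and step size `1 / (2 L)`; in iteration `k` the
samples number `k B, …, k B + B - 1` of every worker are used. -/
noncomputable def leonIterate {n d : ℕ} (P : Problem n d) (L : ℝ) (B : ℕ)
    (ξ : Fin n × ℕ → P.Ξ) : ℕ → Vec d
  | 0 => 0
  | k + 1 => leonIterate P L B ξ k - ((1 / (2 * L)) / n) • ∑ i, (1 / (B : ℝ)) •
      ∑ j ∈ Finset.range B, P.oracle i (leonIterate P L B ξ k) (ξ (i, k * B + j))

namespace Algorithm

variable {n d : ℕ} {N : Network n}

/-- `A` is an implementation of Leon SGD: whatever the problem is, in iteration `k` every worker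
computes exactly `B` stochastic gradients at the common iterate `x^k` (which therefore has been
made available to all workers by some AllReduce procedure). -/
def IsLeonSGD (A : Algorithm N d) (L σ ε : ℝ) : Prop :=
  ∀ (P : Problem n d) (ω : A.Outcome P) (i : Fin n) (k j : ℕ), j < leonBatch n σ ε →
    (A.run P ω).point i (k * leonBatch n σ ε + j) = leonIterate P L (leonBatch n σ ε) ω.2 k

/-- By time `T`, the implementation `A` of Leon SGD with batch size `B` has made the iterates
`x^0, …, x^(K-1)` available to all workers, for some `K ≥ 1` such that a uniformly random one of
them is `ε`-stationary: `(1/K) ∑ E‖∇f(x^k)‖² ≤ ε`. -/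
def LeonFindsBy (A : Algorithm N d) (P : Problem n d) (L : ℝ) (B : ℕ) (ε T : ℝ) : Prop :=
  ∃ K : ℕ, 0 < K ∧ (∀ (ω : A.Outcome P) (i : Fin n) (k : ℕ), k < K →
      (A.run P ω).start i (k * B) ≤ T) ∧
    (∑ k ∈ Finset.range K, ∫⁻ ω, ENNReal.ofReal
      (‖gradient P.objective (leonIterate P L B ω.2 k)‖ ^ 2) ∂(A.prob P)) / K ≤ ENNReal.ofReal ε

end Algorithm

/-- `d L Δ / (b ε) + h σ² L Δ / (n ε²) + h L Δ / ε`. -/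
noncomputable def sparseRate (n d : ℕ) (h b L Δ σ ε : ℝ) : ℝ :=
  d * L * Δ / (b * ε) + h * σ ^ 2 * L * Δ / (n * ε ^ 2) + h * L * Δ / ε

/-!
Throughout, `X = L * Δ / ε`, and up to constants and powers of `log (n + 1)` the rate is the number
`X` of iterations times `d / b + h * σ ^ 2 / (n * ε) + h`.

*Lower bound.* The hard objective `hardFn` lives on `M * K` of the `d` coordinates, which form a chain
of `M ≈ X / log ^ 4 (n + 1)` blocks of `K = ⌈log (n + 1)⌉` coordinates. Every coordinate enters through
a ramp, which rewards an increase, and the ramps of a block are multiplied by a gate which is closed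
as long as some coordinate of the previous block vanishes (`gate_succ_eq_zero`). Hence a
zero-respecting method can learn about a block only after somebody knows the whole previous block,
and as long as some coordinate vanishes the gradient is large (`exists_chainPartial_le`). The
stochastic gradients multiply the contribution of the ramps of the current block by independent
normalized Bernoulli variables with mean `q ≈ ε * K / σ ^ 2`, so that each coordinate is revealed with
probability `q` only. The problem is homogeneous (`homogeneous_hardProblem`), thus it serves for both
settings.

Consider a window of length `w` after the completion of block `m`. A worker that knows block `m + 1`
at its end has obtained each of the `K` coordinates from a message or from one of its own `w / h`
stochastic gradients (`received_or_drawn`). At most `p * b * w` coordinates arrive in messages that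
are launched and delivered in the window, and the indices of the entries are fixed in advance, so for
randomly permuted positions a given coordinate is among them with probability at most
`p * b * w / (d - M * K)` (`card_perm_mem_le`); it is drawn with probability at most `(w / h) * q`. To make
the conditioning on the past legitimate, the beginning of the window is defined by the execution for a
truncated oracle that does not involve the later blocks (`truncProblem`, `hitTime`) and coincides with
the true one up to that moment. If the two probabilities add up to at most `exp (-4)`, then a worker
obtains all `K ≥ log (n + 1)` coordinates with probability at most `exp (-4 * K)`
(`sum_measure_partial_le`), which survives a union bound over the `n` workers. Alternatively, `w` can be
so short that all workers together are unlikely to draw a single given coordinate. In both cases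
at least half of the `M - 1` windows are likely to be needed in full (`ofReal_le_optimalTime`). The lengths
`d / (b * log (n + 1))`, `h * σ ^ 2 / (n * ε * log (n + 1))` and `h`, up to constants, give the three terms
of the rate (`ofReal_sparseRate_le_optimalTime`); the assumption on `σ ^ 2 / ε` makes the draws harmless
in the first case.

*Upper bound.* The batch size makes the variance of the averaged gradient at most `ε`, so the usual
descent argument shows that `4 * X` iterations of Leon SGD suffice
(`sum_lintegral_gradient_leonIterate_le`). One iteration costs the time for a batch, about
`h * σ ^ 2 / (n * ε) + h`, and an AllReduce. In a connected graph there is a closed walk that visits all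
vertices and uses every link at most once in each direction (`SimpleGraph.Connected.exists_tour`).
Ordering the workers by chosen visits of this walk, messages between pairs of workers with disjoint rank
intervals and the same orientation can be routed along disjoint parts of the walk
(`SimpleGraph.Connected.exists_routes`). Sums over dyadic blocks of ranks are therefore merged in pairs
in `⌊log₂ n⌋ + 1` rounds of `d / b` seconds, and the new iterate is spread back in as many rounds
(`Routing.Link`, `Routing.plan`, `Routing.iterate_view`). Neither the diameter nor the number of workers
enters otherwise. Finally, the best iterate is at least as good as a random one
(`Algorithm.timeTo_le_of_leonFindsBy`), so Leon SGD also bounds the optimal time.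
-/

/-! ### One-dimensional building blocks -/

/-- The square of the positive part: a `C¹` function with Lipschitz derivative, from which all
one-dimensional building blocks are composed. -/
noncomputable def posSq (x : ℝ) : ℝ := max x 0 ^ 2

theorem hasDerivAt_posSq (x : ℝ) : HasDerivAt posSq (2 * max x 0) x := by
  rcases lt_trichotomy x 0 with hx | rfl | hx
  · rw [max_eq_right hx.le, mul_zero]
    refine (hasDerivAt_const x (0 : ℝ)).congr_of_eventuallyEq ?_
    filter_upwards [gt_mem_nhds hx] with y hy
    simp [posSq, max_eq_right hy.le]
  · have : HasFDerivAt posSq (0 : ℝ →L[ℝ] ℝ) 0 := by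
      refine Asymptotics.IsBigO.hasFDerivAt (n := 2) ?_ (by norm_num)
      refine Asymptotics.IsBigO.of_bound 1 (Filter.Eventually.of_forall fun y => ?_)
      have h1 : |max y 0| ≤ |y| := by simpa using abs_max_sub_max_le_abs y 0 0
      simp only [posSq, Real.norm_eq_abs, abs_pow, sub_zero, one_mul, abs_abs]
      gcongr
    have h := this.hasDerivAt
    simpa using h
  · rw [max_eq_left hx.le]
    have h := hasDerivAt_pow 2 x
    simp only [Nat.cast_ofNat, Nat.add_one_sub_one, pow_one] at h
    refine h.congr_of_eventuallyEq ?_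
    filter_upwards [lt_mem_nhds hx] with y hy
    simp [posSq, max_eq_left (le_of_lt hy)]

theorem hasDerivAt_posSq_sub (a x : ℝ) :
    HasDerivAt (fun x => posSq (x - a)) (2 * max (x - a) 0) x := by
  simpa using (hasDerivAt_posSq (x - a)).comp_sub_const x a

theorem abs_posPart_sub_le (a x y : ℝ) : |max (x - a) 0 - max (y - a) 0| ≤ |x - y| := by
  simpa using abs_max_sub_max_le_abs (x - a) (y - a) 0

/-- A step from `0` (for `x ≤ 0`) to `1` (for `x ≥ 1`). -/
noncomputable def smoothStep (x : ℝ) : ℝ :=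
  2 * posSq (x - 0) - 4 * posSq (x - 1 / 2) + 2 * posSq (x - 1)

/-- The derivative of `smoothStep`, a hat function on `[0, 1]`. -/
noncomputable def smoothStepDeriv (x : ℝ) : ℝ :=
  4 * max (x - 0) 0 - 8 * max (x - 1 / 2) 0 + 4 * max (x - 1) 0

/-- An increasing function from `0` (for `x ≤ -1`) to `2` (for `x ≥ 2`), of slope `1` on
`[0, 1]`. -/
noncomputable def ramp (x : ℝ) : ℝ :=
  (posSq (x - (-1)) - posSq (x - 0) - posSq (x - 1) + posSq (x - 2)) / 2

/-- The derivative of `ramp`, a trapezoid on `[-1, 2]`. -/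
noncomputable def rampDeriv (x : ℝ) : ℝ :=
  max (x - (-1)) 0 - max (x - 0) 0 - max (x - 1) 0 + max (x - 2) 0

/-- A penalty for negative arguments: zero for `x ≥ 0` and of slope `-1` for `x ≤ -1`. It makes up
for the vanishing slope of `ramp` at negative arguments. -/
noncomputable def wall (x : ℝ) : ℝ :=
  (posSq (x - (-1)) - posSq (x - 0)) / 2 - x - 1 / 2

/-- The derivative of `wall`. -/
noncomputable def wallDeriv (x : ℝ) : ℝ := max (x - (-1)) 0 - max (x - 0) 0 - 1

theorem hasDerivAt_smoothStep (x : ℝ) : HasDerivAt smoothStep (smoothStepDeriv x) x := by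
  have h := (((hasDerivAt_posSq_sub 0 x).const_mul 2).sub
    ((hasDerivAt_posSq_sub (1 / 2) x).const_mul 4)).add ((hasDerivAt_posSq_sub 1 x).const_mul 2)
  refine h.congr_deriv ?_
  simp only [smoothStepDeriv]; ring

theorem hasDerivAt_ramp (x : ℝ) : HasDerivAt ramp (rampDeriv x) x := by
  have h := ((((hasDerivAt_posSq_sub (-1) x).sub (hasDerivAt_posSq_sub 0 x)).sub
    (hasDerivAt_posSq_sub 1 x)).add (hasDerivAt_posSq_sub 2 x)).div_const 2
  refine h.congr_deriv ?_
  simp only [rampDeriv]; ring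

theorem hasDerivAt_wall (x : ℝ) : HasDerivAt wall (wallDeriv x) x := by
  have h := ((((hasDerivAt_posSq_sub (-1) x).sub (hasDerivAt_posSq_sub 0 x)).div_const 2).sub
    (hasDerivAt_id x)).sub_const (1 / 2)
  refine h.congr_deriv ?_
  simp only [wallDeriv]; ring

theorem smoothStep_eq_zero {x : ℝ} (hx : x ≤ 0) : smoothStep x = 0 := by
  simp [smoothStep, posSq,
    max_eq_right (show x - 1 / 2 ≤ 0 by linarith), max_eq_right (show x - 1 ≤ 0 by linarith),
    max_eq_right hx, -one_div]

theorem smoothStep_eq_one {x : ℝ} (hx : 1 ≤ x) : smoothStep x = 1 := by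
  simp only [smoothStep, posSq, max_eq_left (show 0 ≤ x - 0 by linarith),
    max_eq_left (show 0 ≤ x - 1 / 2 by linarith), max_eq_left (show 0 ≤ x - 1 by linarith)]
  ring

theorem smoothStepDeriv_mem (x : ℝ) : 0 ≤ smoothStepDeriv x ∧ smoothStepDeriv x ≤ 2 := by
  unfold smoothStepDeriv
  rcases max_cases (x - 0) 0 with h | h <;> rcases max_cases (x - 1 / 2) 0 with h' | h' <;>
    rcases max_cases (x - 1) 0 with h'' | h'' <;> constructor <;> linarith [h.1, h'.1, h''.1]

theorem smoothStepDeriv_eq_zero {x : ℝ} (hx : x ≤ 0) : smoothStepDeriv x = 0 := by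
  simp [smoothStepDeriv, max_eq_right (show x - 1 / 2 ≤ 0 by linarith),
    max_eq_right (show x - 1 ≤ 0 by linarith), max_eq_right hx, -one_div]

theorem monotone_smoothStep : Monotone smoothStep :=
  monotone_of_hasDerivAt_nonneg hasDerivAt_smoothStep fun x => (smoothStepDeriv_mem x).1

theorem smoothStep_mem (x : ℝ) : 0 ≤ smoothStep x ∧ smoothStep x ≤ 1 := by
  constructor
  · rcases le_total x 0 with h | h
    · exact (smoothStep_eq_zero h).ge
    · exact (smoothStep_eq_zero le_rfl).ge.trans (monotone_smoothStep h)
  · rcases le_total x 1 with h | h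
    · exact (monotone_smoothStep h).trans (smoothStep_eq_one le_rfl).le
    · exact (smoothStep_eq_one h).le

theorem rampDeriv_mem (x : ℝ) : 0 ≤ rampDeriv x ∧ rampDeriv x ≤ 1 := by
  unfold rampDeriv
  rcases max_cases (x - 0) 0 with h | h <;> rcases max_cases (x - (-1)) 0 with h' | h' <;>
    rcases max_cases (x - 1) 0 with h'' | h'' <;> rcases max_cases (x - 2) 0 with h3 | h3 <;>
    constructor <;> linarith [h.1, h'.1, h''.1, h3.1]

theorem ramp_mem (x : ℝ) : 0 ≤ ramp x ∧ ramp x ≤ 2 := by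
  have hm : Monotone ramp :=
    monotone_of_hasDerivAt_nonneg hasDerivAt_ramp fun x => (rampDeriv_mem x).1
  have h0 : ∀ x ≤ (-1 : ℝ), ramp x = 0 := fun x hx => by
    simp only [ramp, posSq, max_eq_right (show x - 0 ≤ 0 by linarith),
      max_eq_right (show x - (-1) ≤ 0 by linarith), max_eq_right (show x - 1 ≤ 0 by linarith),
      max_eq_right (show x - 2 ≤ 0 by linarith)]
    ring
  have h2 : ∀ x ≥ (2 : ℝ), ramp x = 2 := fun x hx => by
    simp only [ramp, posSq, max_eq_left (show 0 ≤ x - 0 by linarith),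
      max_eq_left (show 0 ≤ x - (-1) by linarith), max_eq_left (show 0 ≤ x - 1 by linarith),
      max_eq_left (show 0 ≤ x - 2 by linarith)]
    ring
  constructor
  · rcases le_total x (-1) with h | h
    · exact (h0 x h).ge
    · exact (h0 _ le_rfl).ge.trans (hm h)
  · rcases le_total x 2 with h | h
    · exact (hm h).trans (h2 _ le_rfl).le
    · exact (h2 x h).le

theorem wallDeriv_eq_zero {x : ℝ} (hx : 0 ≤ x) : wallDeriv x = 0 := by
  simp only [wallDeriv, max_eq_left (show 0 ≤ x - 0 by linarith),
    max_eq_left (show 0 ≤ x - (-1) by linarith)]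
  ring

theorem wallDeriv_le_zero (x : ℝ) : wallDeriv x ≤ 0 := by
  unfold wallDeriv
  rcases max_cases (x - 0) 0 with h | h <;> rcases max_cases (x - (-1)) 0 with h' | h' <;>
    linarith [h.1, h'.1]

theorem wall_eq_zero {x : ℝ} (hx : 0 ≤ x) : wall x = 0 := by
  simp only [wall, posSq, max_eq_left (show 0 ≤ x - 0 by linarith),
    max_eq_left (show 0 ≤ x - (-1) by linarith)]
  ring

theorem wall_nonneg (x : ℝ) : 0 ≤ wall x := by
  rcases le_total 0 x with h | h
  · exact (wall_eq_zero h).ge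
  · exact (wall_eq_zero le_rfl).ge.trans
      (antitone_of_hasDerivAt_nonpos hasDerivAt_wall wallDeriv_le_zero h)

/-- Below `1` the ramp and the wall together have slope at least `1` in absolute value. -/
theorem wallDeriv_sub_rampDeriv_le {x : ℝ} (hx : x < 1) : wallDeriv x - rampDeriv x ≤ -1 := by
  unfold rampDeriv wallDeriv
  rw [max_eq_right (show x - 1 ≤ 0 by linarith), max_eq_right (show x - 2 ≤ 0 by linarith)]
  rcases max_cases (x - 0) 0 with h | h <;> rcases max_cases (x - (-1)) 0 with h' | h' <;>
    linarith [h.1, h'.1]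

theorem abs_sub_le_of_hasDerivAt {g g' : ℝ → ℝ} {C : ℝ} (h : ∀ x, HasDerivAt g (g' x) x)
    (hC : ∀ x, |g' x| ≤ C) (x y : ℝ) : |g x - g y| ≤ C * |x - y| := by
  have := convex_univ.norm_image_sub_le_of_norm_hasDerivWithin_le (f := g) (f' := g') (C := C)
    (x := y) (y := x) (fun x _ => (h x).hasDerivWithinAt) (fun x _ => hC x) trivial trivial
  simpa using this

theorem abs_smoothStep_sub_le (x y : ℝ) : |smoothStep x - smoothStep y| ≤ 2 * |x - y| :=
  abs_sub_le_of_hasDerivAt hasDerivAt_smoothStep (fun x => by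
    rw [abs_of_nonneg (smoothStepDeriv_mem x).1]; exact (smoothStepDeriv_mem x).2) x y

theorem abs_ramp_sub_le (x y : ℝ) : |ramp x - ramp y| ≤ |x - y| := by
  simpa using abs_sub_le_of_hasDerivAt hasDerivAt_ramp (C := 1) (fun x => by
    rw [abs_of_nonneg (rampDeriv_mem x).1]; exact (rampDeriv_mem x).2) x y

theorem abs_smoothStepDeriv_sub_le (x y : ℝ) :
    |smoothStepDeriv x - smoothStepDeriv y| ≤ 16 * |x - y| := by
  have h0 := abs_le.1 (abs_posPart_sub_le 0 x y)
  have h1 := abs_le.1 (abs_posPart_sub_le (1 / 2) x y)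
  have h2 := abs_le.1 (abs_posPart_sub_le 1 x y)
  unfold smoothStepDeriv
  rw [abs_le]
  constructor <;> linarith [h0.1, h0.2, h1.1, h1.2, h2.1, h2.2]

theorem abs_rampDeriv_sub_le (x y : ℝ) : |rampDeriv x - rampDeriv y| ≤ 4 * |x - y| := by
  have h0 := abs_le.1 (abs_posPart_sub_le 0 x y)
  have h1 := abs_le.1 (abs_posPart_sub_le (-1) x y)
  have h2 := abs_le.1 (abs_posPart_sub_le 1 x y)
  have h3 := abs_le.1 (abs_posPart_sub_le 2 x y)
  unfold rampDeriv
  rw [abs_le]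
  constructor <;> linarith [h0.1, h0.2, h1.1, h1.2, h2.1, h2.2, h3.1, h3.2]

theorem abs_wallDeriv_sub_le (x y : ℝ) : |wallDeriv x - wallDeriv y| ≤ 2 * |x - y| := by
  have h0 := abs_le.1 (abs_posPart_sub_le 0 x y)
  have h1 := abs_le.1 (abs_posPart_sub_le (-1) x y)
  unfold wallDeriv
  rw [abs_le]
  constructor <;> linarith [h0.1, h0.2, h1.1, h1.2]

/-! ### The chain of blocks -/

/-- The argument of the gate that is opened by block `m`: it is positive only if no coordinate of
the block is `≤ 0`, and equal to `1` if all of them are at least `1`. -/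
noncomputable def gateArg {K : ℕ} (y : ℕ → Fin K → ℝ) (m : ℕ) : ℝ :=
  ∑ l, smoothStep (y m l) - (K - 1)

/-- The gate in front of block `m`, a smooth conjunction over all coordinates of the previous
block. -/
noncomputable def gate {K : ℕ} (y : ℕ → Fin K → ℝ) : ℕ → ℝ
  | 0 => 1
  | m + 1 => smoothStep (gateArg y m)

/-- Sum of the ramps of the block after `m`, among `M` blocks. -/
noncomputable def nextRamp {K : ℕ} (M : ℕ) (y : ℕ → Fin K → ℝ) (m : ℕ) : ℝ :=
  if m + 1 < M then ∑ l, ramp (y (m + 1) l) else 0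

/-- The chain function of `M` blocks of `K` coordinates. -/
noncomputable def chainValue {K : ℕ} (M : ℕ) (y : ℕ → Fin K → ℝ) : ℝ :=
  ∑ m ∈ Finset.range M, (∑ l, wall (y m l) - gate y m * ∑ l, ramp (y m l))

/-- The partial derivative of `chainValue` in coordinate `l` of block `m`. -/
noncomputable def chainPartial {K : ℕ} (M : ℕ) (y : ℕ → Fin K → ℝ) (m : ℕ) (l : Fin K) : ℝ :=
  wallDeriv (y m l) - gate y m * rampDeriv (y m l) -
    smoothStepDeriv (gateArg y m) * smoothStepDeriv (y m l) * nextRamp M y m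

section Chain

variable {K M : ℕ} (y y' : ℕ → Fin K → ℝ)

theorem gate_mem (m : ℕ) : 0 ≤ gate y m ∧ gate y m ≤ 1 := by
  cases m with
  | zero => simp [gate]
  | succ m => exact smoothStep_mem _

theorem nextRamp_mem (m : ℕ) : 0 ≤ nextRamp M y m ∧ nextRamp M y m ≤ 2 * K := by
  unfold nextRamp
  split_ifs
  · refine ⟨Finset.sum_nonneg fun l _ => (ramp_mem _).1,
      (Finset.sum_le_sum fun l _ => (ramp_mem _).2).trans ?_⟩
    simp [mul_comm]
  · simp

theorem gateArg_nonpos {m : ℕ} {l : Fin K} (h : y m l ≤ 0) : gateArg y m ≤ 0 := by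
  unfold gateArg
  rw [← Finset.add_sum_erase _ _ (Finset.mem_univ l), smoothStep_eq_zero h]
  have := Finset.sum_le_card_nsmul (Finset.univ.erase l) (fun l => smoothStep (y m l)) 1
    fun l _ => (smoothStep_mem _).2
  have hK : 1 ≤ K := l.pos
  simp only [Finset.card_erase_of_mem (Finset.mem_univ l), Finset.card_univ, Fintype.card_fin,
    nsmul_eq_mul, mul_one, Nat.cast_sub hK] at this
  push_cast at this
  linarith

theorem gate_succ_eq_zero {m : ℕ} {l : Fin K} (h : y m l ≤ 0) : gate y (m + 1) = 0 :=
  smoothStep_eq_zero (gateArg_nonpos y h)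

theorem gate_succ_eq_one {m : ℕ} (h : ∀ l, 1 ≤ y m l) : gate y (m + 1) = 1 := by
  refine smoothStep_eq_one ?_
  simp [gateArg, smoothStep_eq_one (h _)]

theorem chainValue_lower : -(2 * K * M : ℝ) ≤ chainValue M y := by
  have : ∀ m ∈ Finset.range M, (-(2 * K : ℝ)) ≤ ∑ l, wall (y m l) - gate y m * ∑ l, ramp (y m l) := by
    intro m _
    have h1 : 0 ≤ ∑ l, wall (y m l) := Finset.sum_nonneg fun l _ => wall_nonneg _
    have h2 : ∑ l, ramp (y m l) ≤ 2 * K :=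
      (Finset.sum_le_sum fun l _ => (ramp_mem _).2).trans (by simp [mul_comm])
    have h3 : 0 ≤ ∑ l, ramp (y m l) := Finset.sum_nonneg fun l _ => (ramp_mem _).1
    have h4 := gate_mem y m
    nlinarith [mul_le_mul h4.2 h2 h3 zero_le_one]
  have := Finset.card_nsmul_le_sum _ _ _ this
  simp only [Finset.card_range, nsmul_eq_mul] at this
  unfold chainValue
  linarith

theorem chainValue_zero_le : chainValue M (fun _ _ => 0 : ℕ → Fin K → ℝ) ≤ 0 := by
  refine Finset.sum_nonpos fun m _ => ?_
  simp only [wall_eq_zero le_rfl, Finset.sum_const_zero, zero_sub, neg_nonpos]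
  exact mul_nonneg (gate_mem _ _).1 (Finset.sum_nonneg fun l _ => (ramp_mem _).1)

/-- As long as some coordinate is below `1`, some partial derivative is at most `-1`: take the first
block with such a coordinate, whose gate is open. -/
theorem exists_chainPartial_le {m : ℕ} (hm : m < M) {l : Fin K} (h : y m l < 1) :
    ∃ m' < M, ∃ l', chainPartial M y m' l' ≤ -1 := by
  classical
  have hex : ∃ m, ∃ l, y m l < 1 := ⟨m, l, h⟩
  obtain ⟨l', hl'⟩ := Nat.find_spec hex
  refine ⟨Nat.find hex, (Nat.find_min' hex ⟨l, h⟩).trans_lt hm, l', ?_⟩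
  have hg : gate y (Nat.find hex) = 1 := by
    cases hk : Nat.find hex with
    | zero => rfl
    | succ k =>
      have := Nat.find_min hex (m := k) (by omega)
      push Not at this
      exact gate_succ_eq_one y this
  have h3 : 0 ≤ smoothStepDeriv (gateArg y (Nat.find hex)) *
      smoothStepDeriv (y (Nat.find hex) l') * nextRamp M y (Nat.find hex) :=
    mul_nonneg (mul_nonneg (smoothStepDeriv_mem _).1 (smoothStepDeriv_mem _).1) (nextRamp_mem _ _).1
  unfold chainPartial
  rw [hg]
  linarith [wallDeriv_sub_rampDeriv_le hl']

/-- At a vanishing coordinate only the ramp contributes to the partial derivative. -/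
theorem chainPartial_of_eq_zero {m : ℕ} {l : Fin K} (h : y m l = 0) :
    chainPartial M y m l = - (gate y m * rampDeriv 0) := by
  simp [chainPartial, h, wallDeriv_eq_zero le_rfl, smoothStepDeriv_eq_zero le_rfl]

/-- The `ℓ¹` distance of two points in block `m`. -/
noncomputable def blockDist {K : ℕ} (y y' : ℕ → Fin K → ℝ) (m : ℕ) : ℝ := ∑ l, |y m l - y' m l|

theorem blockDist_nonneg (m : ℕ) : 0 ≤ blockDist y y' m := Finset.sum_nonneg fun _ _ => abs_nonneg _

theorem abs_le_blockDist (m : ℕ) (l : Fin K) : |y m l - y' m l| ≤ blockDist y y' m :=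
  Finset.single_le_sum (f := fun l => |y m l - y' m l|) (fun _ _ => abs_nonneg _) (Finset.mem_univ l)

theorem abs_sum_sub_sum_le {g : ℝ → ℝ} {C : ℝ} (hg : ∀ a b, |g a - g b| ≤ C * |a - b|) (m : ℕ) :
    |∑ l, g (y m l) - ∑ l, g (y' m l)| ≤ C * blockDist y y' m := by
  rw [← Finset.sum_sub_distrib, blockDist, Finset.mul_sum]
  exact (Finset.abs_sum_le_sum_abs _ _).trans (Finset.sum_le_sum fun l _ => hg _ _)

theorem abs_gateArg_sub_le (m : ℕ) : |gateArg y m - gateArg y' m| ≤ 2 * blockDist y y' m := by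
  unfold gateArg
  rw [sub_sub_sub_cancel_right]
  exact abs_sum_sub_sum_le y y' abs_smoothStep_sub_le m

theorem abs_gate_sub_le (m : ℕ) : |gate y m - gate y' m| ≤ 4 * blockDist y y' (m - 1) := by
  cases m with
  | zero => simpa [gate] using blockDist_nonneg y y' 0
  | succ m =>
    have h1 := abs_smoothStep_sub_le (gateArg y m) (gateArg y' m)
    have h2 := abs_gateArg_sub_le y y' m
    simp only [gate, Nat.add_sub_cancel]
    linarith

theorem abs_nextRamp_sub_le (m : ℕ) :
    |nextRamp M y m - nextRamp M y' m| ≤ blockDist y y' (m + 1) := by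
  unfold nextRamp
  split_ifs
  · simpa using abs_sum_sub_sum_le (C := 1) y y' (by simpa using abs_ramp_sub_le) (m + 1)
  · simpa using blockDist_nonneg y y' (m + 1)

theorem abs_mul_sub_mul_le {a a' b b' A B : ℝ} (ha : |a| ≤ A) (hb : |b'| ≤ B) :
    |a * b - a' * b'| ≤ A * |b - b'| + |a - a'| * B := by
  have : a * b - a' * b' = a * (b - b') + (a - a') * b' := by ring
  rw [this]
  refine (abs_add_le _ _).trans ?_
  rw [abs_mul, abs_mul]
  gcongr

/-- A partial derivative involves only the coordinate itself, the gate of its block and the gate of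
the next block, so it changes by at most the distances in three consecutive blocks. -/
theorem abs_chainPartial_sub_le (m : ℕ) (l : Fin K) :
    |chainPartial M y m l - chainPartial M y' m l| ≤
      200 * K * (blockDist y y' (m - 1) + blockDist y y' m + blockDist y y' (m + 1)) := by
  have hK : (1 : ℝ) ≤ K := by exact_mod_cast l.pos
  have hl := abs_le_blockDist y y' m l
  have h0 := blockDist_nonneg y y' (m - 1)
  have h1 := blockDist_nonneg y y' m
  have h2 := blockDist_nonneg y y' (m + 1)
  have e1 : |wallDeriv (y m l) - wallDeriv (y' m l)| ≤ 2 * blockDist y y' m :=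
    (abs_wallDeriv_sub_le _ _).trans (by linarith)
  have e2 : |gate y m * rampDeriv (y m l) - gate y' m * rampDeriv (y' m l)| ≤
      4 * blockDist y y' m + 4 * blockDist y y' (m - 1) := by
    have hg := gate_mem y m
    have hr := rampDeriv_mem (y' m l)
    refine (abs_mul_sub_mul_le (A := 1) (B := 1) (by rw [abs_of_nonneg hg.1]; exact hg.2)
      (by rw [abs_of_nonneg hr.1]; exact hr.2)).trans ?_
    have := abs_rampDeriv_sub_le (y m l) (y' m l)
    have := abs_gate_sub_le y y' m
    linarith
  have e3 : |smoothStepDeriv (gateArg y m) * smoothStepDeriv (y m l) -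
      smoothStepDeriv (gateArg y' m) * smoothStepDeriv (y' m l)| ≤ 96 * blockDist y y' m := by
    have ha := smoothStepDeriv_mem (gateArg y m)
    have hb := smoothStepDeriv_mem (y' m l)
    refine (abs_mul_sub_mul_le (A := 2) (B := 2) (by rw [abs_of_nonneg ha.1]; exact ha.2)
      (by rw [abs_of_nonneg hb.1]; exact hb.2)).trans ?_
    have := abs_smoothStepDeriv_sub_le (y m l) (y' m l)
    have := abs_smoothStepDeriv_sub_le (gateArg y m) (gateArg y' m)
    have := abs_gateArg_sub_le y y' m
    linarith
  have e4 : |smoothStepDeriv (gateArg y m) * smoothStepDeriv (y m l) * nextRamp M y m -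
      smoothStepDeriv (gateArg y' m) * smoothStepDeriv (y' m l) * nextRamp M y' m| ≤
      4 * blockDist y y' (m + 1) + 192 * K * blockDist y y' m := by
    have ha := smoothStepDeriv_mem (gateArg y m)
    have hb := smoothStepDeriv_mem (y m l)
    have hn := nextRamp_mem (M := M) y' m
    refine (abs_mul_sub_mul_le (A := 4) (B := 2 * K) ?_
      (by rw [abs_of_nonneg hn.1]; exact hn.2)).trans ?_
    · rw [abs_of_nonneg (mul_nonneg ha.1 hb.1)]
      nlinarith
    · have := abs_nextRamp_sub_le (M := M) y y' m
      have := mul_le_mul_of_nonneg_right e3 (show (0 : ℝ) ≤ 2 * K by positivity)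
      linarith
  have hsplit : chainPartial M y m l - chainPartial M y' m l =
      (wallDeriv (y m l) - wallDeriv (y' m l)) -
      (gate y m * rampDeriv (y m l) - gate y' m * rampDeriv (y' m l)) -
      (smoothStepDeriv (gateArg y m) * smoothStepDeriv (y m l) * nextRamp M y m -
      smoothStepDeriv (gateArg y' m) * smoothStepDeriv (y' m l) * nextRamp M y' m) := by
    unfold chainPartial; ring
  rw [hsplit]
  refine (abs_sub _ _).trans ?_
  have := abs_sub (wallDeriv (y m l) - wallDeriv (y' m l))
    (gate y m * rampDeriv (y m l) - gate y' m * rampDeriv (y' m l))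
  have hK0 := mul_le_mul_of_nonneg_right hK h0
  have hK1 := mul_le_mul_of_nonneg_right hK h1
  have hK2 := mul_le_mul_of_nonneg_right hK h2
  linarith

/-- The partial derivatives of the chain function are jointly Lipschitz. -/
theorem sum_sq_chainPartial_sub_le (hy : ∀ l, y M l = y' M l) :
    ∑ m ∈ Finset.range M, ∑ l, (chainPartial M y m l - chainPartial M y' m l) ^ 2 ≤
      (800 * K ^ 2) ^ 2 * ∑ m ∈ Finset.range M, ∑ l, (y m l - y' m l) ^ 2 := by
  set e : ℕ → ℝ := fun m => ∑ l, (y m l - y' m l) ^ 2 with he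
  have he0 : ∀ m, 0 ≤ e m := fun m => Finset.sum_nonneg fun _ _ => sq_nonneg _
  have hbd : ∀ m, blockDist y y' m ^ 2 ≤ K * e m := by
    intro m
    have := sq_sum_le_card_mul_sum_sq (s := (Finset.univ : Finset (Fin K)))
      (f := fun l => |y m l - y' m l|)
    simpa [blockDist, he] using this
  have hterm : ∀ m, ∑ l, (chainPartial M y m l - chainPartial M y' m l) ^ 2 ≤
      120000 * (K : ℝ) ^ 4 * (e (m - 1) + e m + e (m + 1)) := by
    intro m
    have h1 : ∀ l, (chainPartial M y m l - chainPartial M y' m l) ^ 2 ≤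
        120000 * (K : ℝ) ^ 3 * (e (m - 1) + e m + e (m + 1)) := by
      intro l
      have h := abs_chainPartial_sub_le (M := M) y y' m l
      set a := blockDist y y' (m - 1)
      set b := blockDist y y' m
      set c := blockDist y y' (m + 1)
      rw [← sq_abs]
      calc |chainPartial M y m l - chainPartial M y' m l| ^ 2 ≤ (200 * K * (a + b + c)) ^ 2 := by
            gcongr
        _ ≤ 120000 * K ^ 2 * (a ^ 2 + b ^ 2 + c ^ 2) := by
            have : (a + b + c) ^ 2 ≤ 3 * (a ^ 2 + b ^ 2 + c ^ 2) := by
              nlinarith [sq_nonneg (a - b), sq_nonneg (b - c), sq_nonneg (a - c)]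
            have := mul_le_mul_of_nonneg_left this (show (0 : ℝ) ≤ 40000 * K ^ 2 by positivity)
            linarith
        _ ≤ 120000 * K ^ 2 * (K * e (m - 1) + K * e m + K * e (m + 1)) := by
            gcongr <;> exact hbd _
        _ = _ := by ring
    refine (Finset.sum_le_sum fun l _ => h1 l).trans ?_
    simp only [Finset.sum_const, Finset.card_univ, Fintype.card_fin, nsmul_eq_mul]
    exact le_of_eq (by ring)
  refine (Finset.sum_le_sum fun m _ => hterm m).trans ?_
  rw [← Finset.mul_sum, Finset.sum_add_distrib, Finset.sum_add_distrib]
  rcases Nat.eq_zero_or_pos M with rfl | hM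
  · simp
  have hs1 : ∑ m ∈ Finset.range M, e (m - 1) ≤ 2 * ∑ m ∈ Finset.range M, e m := by
    obtain ⟨N, rfl⟩ : ∃ N, M = N + 1 := ⟨M - 1, by omega⟩
    rw [Finset.sum_range_succ']
    simp only [Nat.add_sub_cancel, Nat.zero_sub]
    have h1 := Finset.single_le_sum (f := e) (fun m _ => he0 m)
      (Finset.mem_range.2 (Nat.succ_pos N))
    have h2 : ∑ m ∈ Finset.range N, e m ≤ ∑ m ∈ Finset.range (N + 1), e m :=
      Finset.sum_le_sum_of_subset_of_nonneg (by simp) fun m _ _ => he0 m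
    linarith
  have hs2 : ∑ m ∈ Finset.range M, e (m + 1) ≤ ∑ m ∈ Finset.range M, e m := by
    have h1 := Finset.sum_range_succ' e M
    have h2 := Finset.sum_range_succ e M
    have h3 : e M = 0 := by simp [he, hy]
    linarith [he0 0]
  have hS : 0 ≤ ∑ m ∈ Finset.range M, e m := Finset.sum_nonneg fun m _ => he0 m
  have hc : 0 ≤ (K : ℝ) ^ 4 * ∑ m ∈ Finset.range M, e m := by positivity
  have := mul_le_mul_of_nonneg_left (add_le_add (add_le_add_left hs1 (∑ m ∈ Finset.range M, e m)) hs2)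
    (show (0 : ℝ) ≤ 120000 * K ^ 4 by positivity)
  nlinarith
end Chain

/-! ### The hard objective on `Vec d` -/

/-- The vector with entry `a i` in coordinate `c i`, and zeros elsewhere. -/
noncomputable def scatter {ι : Type} [Fintype ι] {d : ℕ} (c : ι ↪ Fin d) (a : ι → ℝ) : Vec d :=
  ∑ i, EuclideanSpace.single (c i) (a i)

section Scatter

variable {ι : Type} [Fintype ι] {d : ℕ} (c : ι ↪ Fin d)

theorem scatter_apply (a : ι → ℝ) (i : ι) : scatter c a (c i) = a i := by
  classical
  simp only [scatter, WithLp.ofLp_sum, Finset.sum_apply, PiLp.single_apply, c.injective.eq_iff]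
  simp

theorem inner_scatter (a : ι → ℝ) (x : Vec d) : inner ℝ (scatter c a) x = ∑ i, a i * x (c i) := by
  simp only [scatter, sum_inner, EuclideanSpace.inner_single_left, conj_trivial]

theorem norm_scatter_sq (a : ι → ℝ) : ‖scatter c a‖ ^ 2 = ∑ i, a i ^ 2 := by
  rw [← real_inner_self_eq_norm_sq, inner_scatter]
  simp only [scatter_apply, sq]

theorem scatter_sub (a b : ι → ℝ) : scatter c a - scatter c b = scatter c (fun i => a i - b i) := by
  rw [scatter, scatter, scatter, ← Finset.sum_sub_distrib]
  refine Finset.sum_congr rfl fun i _ => ?_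
  ext j
  by_cases h : j = c i <;> simp [h]

theorem sum_sq_comp_le (x : Vec d) : ∑ i, x (c i) ^ 2 ≤ ‖x‖ ^ 2 := by
  classical
  rw [EuclideanSpace.norm_sq_eq, ← Finset.sum_map Finset.univ c (fun j => x j ^ 2)]
  simp only [Real.norm_eq_abs, sq_abs]
  exact Finset.sum_le_sum_of_subset_of_nonneg (Finset.subset_univ _) fun _ _ _ => sq_nonneg _

theorem measurable_scatter {α : Type*} [MeasurableSpace α] {a : α → ι → ℝ}
    (ha : ∀ i, Measurable fun t => a t i) : Measurable fun t => scatter c (a t) := by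
  unfold scatter
  refine Finset.measurable_sum _ fun i _ => ?_
  have h : (fun t => (EuclideanSpace.single (c i) (a t i) : Vec d)) =
      fun t => a t i • (EuclideanSpace.single (c i) 1 : Vec d) := by
    funext t
    ext j
    by_cases h : j = c i <;> simp [h]
  rw [h]
  exact (ha i).smul_const _

end Scatter

section HardFunction

variable {M K d : ℕ} (c : Fin M × Fin K ↪ Fin d) (A s : ℝ)

/-- Coordinate `l` of block `m`, in units of `s`; zero beyond the last block. -/
noncomputable def blockCoord (m : ℕ) (l : Fin K) : Vec d →L[ℝ] ℝ :=
  if h : m < M then s⁻¹ • EuclideanSpace.proj (c (⟨m, h⟩, l)) else 0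

/-- All block coordinates of a vector. -/
noncomputable def blockCoords (x : Vec d) : ℕ → Fin K → ℝ := fun m l => blockCoord c s m l x

theorem blockCoords_apply (x : Vec d) (i : Fin M × Fin K) :
    blockCoords c s x i.1 i.2 = s⁻¹ * x (c i) := by
  simp [blockCoords, blockCoord]

theorem blockCoords_last (x : Vec d) (l : Fin K) : blockCoords c s x M l = 0 := by
  simp [blockCoords, blockCoord]

/-- The hard objective, with scales `A` for the values and `s` for the arguments. -/
noncomputable def hardFn (x : Vec d) : ℝ := A * chainValue M (blockCoords c s x)

/-- The gradient of `hardFn`. -/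
noncomputable def hardGrad (x : Vec d) : Vec d :=
  scatter c fun i => A / s * chainPartial M (blockCoords c s x) i.1 i.2

theorem hasFDerivAt_gateArg (x : Vec d) (m : ℕ) :
    HasFDerivAt (fun x => gateArg (blockCoords c s x) m)
      (∑ l, smoothStepDeriv (blockCoords c s x m l) • blockCoord c s m l) x := by
  refine HasFDerivAt.sub_const _ (HasFDerivAt.fun_sum fun l _ => ?_)
  exact (hasDerivAt_smoothStep _).comp_hasFDerivAt x (blockCoord c s m l).hasFDerivAt

theorem hasFDerivAt_sum_comp {g g' : ℝ → ℝ} (hg : ∀ t, HasDerivAt g (g' t) t) (x : Vec d) (m : ℕ) :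
    HasFDerivAt (fun x => ∑ l, g (blockCoords c s x m l))
      (∑ l, g' (blockCoords c s x m l) • blockCoord c s m l) x := by
  refine HasFDerivAt.fun_sum fun l _ => ?_
  exact (hg _).comp_hasFDerivAt x (blockCoord c s m l).hasFDerivAt

/-- The derivative of `gate`. -/
noncomputable def gateFDeriv (x : Vec d) : ℕ → (Vec d →L[ℝ] ℝ)
  | 0 => 0
  | m + 1 => smoothStepDeriv (gateArg (blockCoords c s x) m) •
      ∑ l, smoothStepDeriv (blockCoords c s x m l) • blockCoord c s m l

theorem hasFDerivAt_gate (x : Vec d) (m : ℕ) :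
    HasFDerivAt (fun x => gate (blockCoords c s x) m) (gateFDeriv c s x m) x := by
  cases m with
  | zero => exact hasFDerivAt_const (1 : ℝ) x
  | succ m => exact (hasDerivAt_smoothStep _).comp_hasFDerivAt x (hasFDerivAt_gateArg c s x m)

theorem hasFDerivAt_chainValue (x : Vec d) :
    HasFDerivAt (fun x => chainValue M (blockCoords c s x))
      (∑ m ∈ Finset.range M, ∑ l, chainPartial M (blockCoords c s x) m l • blockCoord c s m l) x := by
  have h : HasFDerivAt (fun x => chainValue M (blockCoords c s x))
      (∑ m ∈ Finset.range M, (∑ l, wallDeriv (blockCoords c s x m l) • blockCoord c s m l -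
        (gate (blockCoords c s x) m • ∑ l, rampDeriv (blockCoords c s x m l) • blockCoord c s m l +
          (∑ l, ramp (blockCoords c s x m l)) • gateFDeriv c s x m))) x :=
    HasFDerivAt.fun_sum fun m _ => (hasFDerivAt_sum_comp c s hasDerivAt_wall x m).sub
      ((hasFDerivAt_gate c s x m).mul (hasFDerivAt_sum_comp c s hasDerivAt_ramp x m))
  convert h using 1
  set y := blockCoords c s x with hy
  have key : ∑ m ∈ Finset.range M, ∑ l, (smoothStepDeriv (gateArg y m) * smoothStepDeriv (y m l) *
      nextRamp M y m) • blockCoord c s m l =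
      ∑ m ∈ Finset.range M, (∑ l, ramp (y m l)) • gateFDeriv c s x m := by
    rcases Nat.eq_zero_or_pos M with rfl | hM
    · simp
    obtain ⟨N, rfl⟩ : ∃ N, M = N + 1 := ⟨M - 1, by omega⟩
    rw [Finset.sum_range_succ, Finset.sum_range_succ']
    simp only [gateFDeriv, smul_zero, add_zero]
    rw [Finset.sum_eq_zero (s := Finset.univ) (fun l _ => by simp [nextRamp]), add_zero]
    refine Finset.sum_congr rfl fun m hm => ?_
    rw [Finset.smul_sum, Finset.smul_sum]
    refine Finset.sum_congr rfl fun l _ => ?_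
    rw [smul_smul, smul_smul, nextRamp, if_pos (by simpa using hm)]
    congr 1
    ring
  rw [Finset.sum_sub_distrib, Finset.sum_add_distrib, ← key, ← Finset.sum_add_distrib,
    ← Finset.sum_sub_distrib]
  refine Finset.sum_congr rfl fun m _ => ?_
  rw [Finset.smul_sum, ← Finset.sum_add_distrib, ← Finset.sum_sub_distrib]
  refine Finset.sum_congr rfl fun l _ => ?_
  ext v
  simp only [chainPartial, smul_apply, sub_apply, add_apply, smul_eq_mul]
  ring

theorem sum_blocks {E : Type*} [AddCommMonoid E] (g : ℕ → Fin K → E) :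
    ∑ i : Fin M × Fin K, g i.1 i.2 = ∑ m ∈ Finset.range M, ∑ l, g m l := by
  rw [Fintype.sum_prod_type, Finset.sum_range]

theorem hasGradientAt_hardFn (x : Vec d) : HasGradientAt (hardFn c A s) (hardGrad c A s x) x := by
  rw [hasGradientAt_iff_hasFDerivAt]
  have h := (hasFDerivAt_chainValue c s x).const_mul A
  refine h.congr_fderiv ?_
  ext v
  rw [InnerProductSpace.toDual_apply_apply, hardGrad, inner_scatter]
  simp only [smul_apply, sum_apply, smul_eq_mul]
  rw [← sum_blocks (fun m l => chainPartial M (blockCoords c s x) m l * blockCoord c s m l v),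
    Finset.mul_sum]
  refine Finset.sum_congr rfl fun i _ => ?_
  have : blockCoord c s i.1 i.2 v = s⁻¹ * v (c i) := blockCoords_apply c s v i
  rw [this]
  ring

theorem hardGrad_lipschitz (hs : 0 < s) (hA : 0 ≤ A) (x x' : Vec d) :
    ‖hardGrad c A s x - hardGrad c A s x'‖ ≤ 800 * K ^ 2 * A / s ^ 2 * ‖x - x'‖ := by
  refine le_of_sq_le_sq ?_ (by positivity)
  rw [hardGrad, hardGrad, scatter_sub, norm_scatter_sq]
  have h1 := sum_sq_chainPartial_sub_le (M := M) (blockCoords c s x) (blockCoords c s x')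
    (fun l => by rw [blockCoords_last, blockCoords_last])
  rw [← sum_blocks (fun m l => (chainPartial M (blockCoords c s x) m l -
    chainPartial M (blockCoords c s x') m l) ^ 2), ← sum_blocks (fun m l =>
    (blockCoords c s x m l - blockCoords c s x' m l) ^ 2)] at h1
  have h2 : ∑ i : Fin M × Fin K, (blockCoords c s x i.1 i.2 - blockCoords c s x' i.1 i.2) ^ 2 ≤
      s⁻¹ ^ 2 * ‖x - x'‖ ^ 2 := by
    have := mul_le_mul_of_nonneg_left (sum_sq_comp_le c (x - x')) (sq_nonneg s⁻¹)
    rw [Finset.mul_sum] at this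
    refine le_trans (le_of_eq (Finset.sum_congr rfl fun i _ => ?_)) this
    rw [blockCoords_apply, blockCoords_apply]
    simp only [PiLp.sub_apply]
    ring
  calc ∑ i : Fin M × Fin K, (A / s * chainPartial M (blockCoords c s x) i.1 i.2 -
        A / s * chainPartial M (blockCoords c s x') i.1 i.2) ^ 2
      = (A / s) ^ 2 * ∑ i : Fin M × Fin K, (chainPartial M (blockCoords c s x) i.1 i.2 -
        chainPartial M (blockCoords c s x') i.1 i.2) ^ 2 := by
        rw [Finset.mul_sum]; exact Finset.sum_congr rfl fun i _ => by ring
    _ ≤ (A / s) ^ 2 * ((800 * K ^ 2) ^ 2 * (s⁻¹ ^ 2 * ‖x - x'‖ ^ 2)) := by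
        gcongr
        exact h1.trans (by gcongr)
    _ = (800 * K ^ 2 * A / s ^ 2 * ‖x - x'‖) ^ 2 := by
        field_simp

theorem hardFn_gap (hA : 0 ≤ A) (x : Vec d) : hardFn c A s 0 - hardFn c A s x ≤ A * (2 * K * M) := by
  have h0 : blockCoords c s 0 = fun _ _ => 0 := by
    funext m l; simp [blockCoords]
  have h1 := chainValue_lower (M := M) (blockCoords c s x)
  have h2 := chainValue_zero_le (M := M) (K := K)
  rw [hardFn, hardFn, h0, ← mul_sub]
  exact mul_le_mul_of_nonneg_left (by linarith) hA

theorem le_norm_hardGrad (x : Vec d) {i : Fin M × Fin K}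
    (hi : x (c i) = 0) : (A / s) ^ 2 ≤ ‖hardGrad c A s x‖ ^ 2 := by
  obtain ⟨m', hm', l', h⟩ := exists_chainPartial_le (M := M) (blockCoords c s x) i.1.2 (l := i.2)
    (by rw [blockCoords_apply, hi, mul_zero]; exact one_pos)
  rw [hardGrad, norm_scatter_sq]
  have hle := Finset.single_le_sum (f := fun i : Fin M × Fin K =>
    (A / s * chainPartial M (blockCoords c s x) i.1 i.2) ^ 2) (fun _ _ => sq_nonneg _)
    (Finset.mem_univ (⟨m', hm'⟩, l'))
  refine le_trans ?_ hle
  simp only [mul_pow]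
  have h1 : 1 ≤ chainPartial M (blockCoords c s x) m' l' ^ 2 := by nlinarith
  nlinarith [sq_nonneg (A / s)]

/-! ### The stochastic gradients of the hard objective -/

/-- Block `m` is not before the frontier: all gates behind it are closed. -/
def AtFrontier {K : ℕ} (M : ℕ) (y : ℕ → Fin K → ℝ) (m : ℕ) : Prop :=
  ∀ k, m < k → k ≤ M → gate y k = 0

open Classical in
/-- The contribution of the ramps that is revealed at random. -/
noncomputable def frontierPart {K : ℕ} (M : ℕ) (y : ℕ → Fin K → ℝ) (m : ℕ) (l : Fin K) : ℝ :=
  if AtFrontier M y m then gate y m * rampDeriv (y m l) else 0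

/-- A Bernoulli variable with mean `q`, divided by its mean, and centered. -/
noncomputable def coin (q : ℝ) (b : Bool) : ℝ := (if b then 1 / q else 0) - 1

/-- The partial derivatives in which the contributions of the ramps at the frontier are multiplied
by normalized Bernoulli variables. -/
noncomputable def noisyPartial {M K : ℕ} (q : ℝ) (y : ℕ → Fin K → ℝ) (ξ : Fin M × Fin K → Bool)
    (i : Fin M × Fin K) : ℝ :=
  chainPartial M y i.1 i.2 - frontierPart M y i.1 i.2 * coin q (ξ i)

/-- Stochastic gradient of the hard objective. -/
noncomputable def hardOracle (q : ℝ) (x : Vec d) (ξ : Fin M × Fin K → Bool) : Vec d :=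
  scatter c fun i => A / s * noisyPartial q (blockCoords c s x) ξ i

/-- The Bernoulli distribution with parameter `q`. -/
noncomputable def coinLaw (q : ℝ) : Measure Bool :=
  ENNReal.ofReal q • Measure.dirac true + ENNReal.ofReal (1 - q) • Measure.dirac false

theorem coinLaw_true (q : ℝ) : coinLaw q {true} = ENNReal.ofReal q := by
  simp [coinLaw]

theorem isProbabilityMeasure_coinLaw {q : ℝ} (h0 : 0 < q) (h1 : q ≤ 1) :
    IsProbabilityMeasure (coinLaw q) := by
  constructor
  simp only [coinLaw, Measure.coe_add, Measure.coe_smul, Pi.add_apply, Pi.smul_apply, measure_univ,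
    smul_eq_mul, mul_one]
  rw [← ENNReal.ofReal_add h0.le (by linarith)]
  simp

theorem integral_coinLaw {q : ℝ} (h0 : 0 < q) (h1 : q ≤ 1) (f : Bool → ℝ) :
    ∫ b, f b ∂(coinLaw q) = q * f true + (1 - q) * f false := by
  rw [coinLaw, integral_add_measure, integral_smul_measure, integral_smul_measure, integral_dirac,
    integral_dirac, ENNReal.toReal_ofReal h0.le, ENNReal.toReal_ofReal (by linarith)]
  · rfl
  · exact Integrable.smul_measure .of_finite ENNReal.ofReal_ne_top
  · exact Integrable.smul_measure .of_finite ENNReal.ofReal_ne_top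

/-- The law of the Bernoulli variables of one stochastic gradient. -/
noncomputable def coinsLaw (M K : ℕ) (q : ℝ) : Measure (Fin M × Fin K → Bool) :=
  Measure.infinitePi fun _ => coinLaw q

theorem isProbabilityMeasure_coinsLaw {q : ℝ} (h0 : 0 < q) (h1 : q ≤ 1) :
    IsProbabilityMeasure (coinsLaw M K q) := by
  have := isProbabilityMeasure_coinLaw h0 h1
  unfold coinsLaw; infer_instance

theorem integral_coinsLaw {q : ℝ} (h0 : 0 < q) (h1 : q ≤ 1) (f : Bool → ℝ) (i : Fin M × Fin K) :
    ∫ ξ, f (ξ i) ∂(coinsLaw M K q) = q * f true + (1 - q) * f false := by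
  have := isProbabilityMeasure_coinLaw h0 h1
  rw [← integral_coinLaw h0 h1 f]
  have hmp := measurePreserving_eval_infinitePi (fun _ : Fin M × Fin K => coinLaw q) i
  rw [← hmp.map_eq, integral_map hmp.measurable.aemeasurable
    (measurable_of_finite f).aestronglyMeasurable]
  rfl

theorem integral_coin {q : ℝ} (h0 : 0 < q) (h1 : q ≤ 1) (i : Fin M × Fin K) :
    ∫ ξ, coin q (ξ i) ∂(coinsLaw M K q) = 0 := by
  rw [integral_coinsLaw h0 h1]
  simp only [coin, reduceIte, Bool.false_eq_true]
  field_simp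
  ring

theorem integral_coin_sq {q : ℝ} (h0 : 0 < q) (h1 : q ≤ 1) (i : Fin M × Fin K) :
    ∫ ξ, coin q (ξ i) ^ 2 ∂(coinsLaw M K q) = 1 / q - 1 := by
  rw [integral_coinsLaw h0 h1 fun b => coin q b ^ 2]
  simp only [coin, reduceIte, Bool.false_eq_true]
  field_simp
  ring

theorem hardOracle_sub_hardGrad (q : ℝ) (x : Vec d) (ξ : Fin M × Fin K → Bool) :
    hardOracle c A s q x ξ - hardGrad c A s x = scatter c fun i =>
      -(A / s * frontierPart M (blockCoords c s x) i.1 i.2) * coin q (ξ i) := by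
  rw [hardOracle, hardGrad, scatter_sub]
  congr 1
  funext i
  simp only [noisyPartial]
  ring

theorem integral_scatter {Ω : Type*} [MeasurableSpace Ω] {μ : Measure Ω}
    {ι : Type} [Fintype ι] (c : ι ↪ Fin d) (a : Ω → ι → ℝ) (ha : ∀ i, Integrable (fun t => a t i) μ) :
    ∫ t, scatter c (a t) ∂μ = scatter c fun i => ∫ t, a t i ∂μ := by
  have h : ∀ a : ι → ℝ, scatter c a = ∑ i, a i • (EuclideanSpace.single (c i) 1 : Vec d) := by
    intro a
    refine Finset.sum_congr rfl fun i _ => ?_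
    ext j
    by_cases h : j = c i <;> simp [h]
  simp only [h]
  rw [integral_finsetSum _ fun i _ => (ha i).smul_const _]
  exact Finset.sum_congr rfl fun i _ => integral_smul_const _ _

/-- Only one block is at the frontier and has an open gate, so the noise affects at most `K`
coordinates. -/
theorem sum_frontierPart_sq_le (y : ℕ → Fin K → ℝ) :
    ∑ i : Fin M × Fin K, frontierPart M y i.1 i.2 ^ 2 ≤ K := by
  classical
  by_cases h : ∃ m : Fin M, AtFrontier M y m ∧ gate y m ≠ 0
  · -- The block at the frontier whose gate is open is unique.
    obtain ⟨m, hm, hg⟩ := h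
    have hz : ∀ m' : Fin M, m' ≠ m → ∀ l, frontierPart M y m' l ^ 2 = 0 := by
      intro m' hne l
      unfold frontierPart
      split_ifs with hf
      · rcases lt_or_gt_of_ne hne with hlt | hlt
        · exact absurd (hf m hlt m.2.le) hg
        · rw [hm m' hlt m'.2.le]; simp
      · simp
    rw [Fintype.sum_prod_type, Finset.sum_eq_single m (fun m' _ hne =>
      Finset.sum_eq_zero fun l _ => hz m' hne l) (by simp)]
    have : ∀ l, frontierPart M y m l ^ 2 ≤ 1 := by
      intro l
      rw [frontierPart, if_pos hm]
      have h1 := gate_mem y m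
      have h2 := rampDeriv_mem (y m l)
      exact pow_le_one₀ (mul_nonneg h1.1 h2.1) (mul_le_one₀ h1.2 h2.1 h2.2)
    exact (Finset.sum_le_sum fun l _ => this l).trans (by simp)
  · push Not at h
    rw [Finset.sum_eq_zero]
    · positivity
    · intro i _
      unfold frontierPart
      split_ifs with hf
      · rw [h i.1 hf]; simp
      · simp

theorem integral_hardOracle {q : ℝ} (h0 : 0 < q) (h1 : q ≤ 1) (x : Vec d) :
    ∫ ξ, hardOracle c A s q x ξ ∂(coinsLaw M K q) = hardGrad c A s x := by
  have := isProbabilityMeasure_coinsLaw (M := M) (K := K) h0 h1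
  have h : ∀ ξ, hardOracle c A s q x ξ = hardGrad c A s x + scatter c fun i =>
      -(A / s * frontierPart M (blockCoords c s x) i.1 i.2) * coin q (ξ i) := by
    intro ξ
    rw [← hardOracle_sub_hardGrad]; abel
  simp only [h]
  rw [integral_add (integrable_const _) .of_finite, integral_scatter _ _ fun i => .of_finite]
  simp only [integral_const_mul, integral_coin h0 h1, mul_zero]
  have hz : scatter c (fun _ => (0 : ℝ)) = 0 := by
    have := scatter_sub c (fun _ => (0 : ℝ)) (fun _ => 0)
    simpa using this.symm
  simp [hz]

theorem variance_hardOracle_le {q : ℝ} (h0 : 0 < q) (h1 : q ≤ 1) (x : Vec d) :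
    ∫⁻ ξ, ENNReal.ofReal (‖hardOracle c A s q x ξ - hardGrad c A s x‖ ^ 2) ∂(coinsLaw M K q) ≤
      ENNReal.ofReal ((A / s) ^ 2 * K * (1 / q - 1)) := by
  have := isProbabilityMeasure_coinsLaw (M := M) (K := K) h0 h1
  rw [← ofReal_integral_eq_lintegral_ofReal .of_finite
    (Filter.Eventually.of_forall fun _ => sq_nonneg _)]
  refine ENNReal.ofReal_le_ofReal ?_
  simp only [hardOracle_sub_hardGrad, norm_scatter_sq]
  rw [integral_finsetSum _ fun i _ => .of_finite]
  simp only [mul_pow, neg_sq, integral_const_mul, integral_coin_sq h0 h1]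
  have hq : 0 ≤ 1 / q - 1 := by
    rw [sub_nonneg, le_div_iff₀ h0]; linarith
  rw [← Finset.sum_mul, ← Finset.mul_sum]
  gcongr
  exact sum_frontierPart_sq_le _

theorem continuous_smoothStep : Continuous smoothStep :=
  continuous_iff_continuousAt.2 fun x => (hasDerivAt_smoothStep x).continuousAt

theorem continuous_ramp : Continuous ramp :=
  continuous_iff_continuousAt.2 fun x => (hasDerivAt_ramp x).continuousAt

theorem measurable_gate {α : Type*} [MeasurableSpace α] {y : α → ℕ → Fin K → ℝ}
    (hy : ∀ m l, Measurable fun t => y t m l) (m : ℕ) : Measurable fun t => gate (y t) m := by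
  cases m with
  | zero => exact measurable_const
  | succ m =>
    refine continuous_smoothStep.measurable.comp ?_
    exact (Finset.measurable_sum _ fun l _ =>
      continuous_smoothStep.measurable.comp (hy m l)).sub_const _

theorem measurable_noisyPartial {α : Type*} [MeasurableSpace α] {y : α → ℕ → Fin K → ℝ}
    (hy : ∀ m l, Measurable fun t => y t m l) (q : ℝ) (ξ : Fin M × Fin K → Bool)
    (i : Fin M × Fin K) : Measurable fun t => noisyPartial q (y t) ξ i := by
  have hS : Measurable smoothStepDeriv := by unfold smoothStepDeriv; fun_prop
  have hR : Measurable rampDeriv := by unfold rampDeriv; fun_prop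
  have hW : Measurable wallDeriv := by unfold wallDeriv; fun_prop
  have hg := measurable_gate hy
  have ha : Measurable fun t => gateArg (y t) i.1 :=
    (Finset.measurable_sum _ fun l _ =>
      continuous_smoothStep.measurable.comp (hy _ l)).sub_const _
  have hn : Measurable fun t => nextRamp M (y t) i.1 := by
    unfold nextRamp
    split_ifs
    · exact Finset.measurable_sum _ fun l _ => continuous_ramp.measurable.comp (hy _ l)
    · exact measurable_const
  have hf : Measurable fun t => frontierPart M (y t) i.1 i.2 := by
    unfold frontierPart
    refine Measurable.ite ?_ ((hg _).mul (hR.comp (hy _ _))) measurable_const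
    have : {t | AtFrontier M (y t) i.1} = ⋂ k, ⋂ (_ : (i.1 : ℕ) < k), ⋂ (_ : k ≤ M),
        {t | gate (y t) k = 0} := by
      ext t; simp [AtFrontier]
    rw [this]
    refine MeasurableSet.iInter fun k => MeasurableSet.iInter fun _ => MeasurableSet.iInter fun _ => ?_
    exact hg k (measurableSet_singleton 0)
  unfold noisyPartial chainPartial
  exact (((hW.comp (hy _ _)).sub ((hg _).mul (hR.comp (hy _ _)))).sub
    (((hS.comp ha).mul (hS.comp (hy _ _))).mul hn)).sub (hf.mul_const _)

theorem measurable_hardOracle (q : ℝ) : Measurable (Function.uncurry (hardOracle c A s q)) := by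
  refine measurable_from_prod_countable_left fun ξ => ?_
  refine measurable_scatter c fun i => Measurable.const_mul ?_ _
  exact measurable_noisyPartial (fun m l => (blockCoord c s m l).measurable) q ξ i

end HardFunction

/-- The hard problem: all workers share the hard objective. -/
noncomputable abbrev hardProblem (n : ℕ) {M K d : ℕ} (c : Fin M × Fin K ↪ Fin d) (A s q : ℝ)
    (h0 : 0 < q) (h1 : q ≤ 1) : Problem n d where
  Ξ := Fin M × Fin K → Bool
  law _ := coinsLaw M K q
  isProbability _ := isProbabilityMeasure_coinsLaw h0 h1
  fn _ := hardFn c A s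
  oracle _ := hardOracle c A s q
  measurable_oracle _ := measurable_hardOracle c A s q

theorem objective_hardProblem {n : ℕ} (hn : 0 < n) {M K d : ℕ} (c : Fin M × Fin K ↪ Fin d)
    (A s q : ℝ) (h0 : 0 < q) (h1 : q ≤ 1) :
    (hardProblem n c A s q h0 h1).objective = hardFn c A s := by
  funext x
  have : (n : ℝ) ≠ 0 := by positivity
  simp [Problem.objective, this]

theorem gradient_hardFn {M K d : ℕ} (c : Fin M × Fin K ↪ Fin d) (A s : ℝ) :
    gradient (hardFn c A s) = hardGrad c A s :=
  funext fun x => (hasGradientAt_hardFn c A s x).gradient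

theorem homogeneous_hardProblem {n : ℕ} (hn : 0 < n) {M K d : ℕ} (c : Fin M × Fin K ↪ Fin d)
    {A s q L Δ σ : ℝ} (h0 : 0 < q) (h1 : q ≤ 1) (hA : 0 ≤ A) (hs : 0 < s)
    (hL : 800 * K ^ 2 * A / s ^ 2 ≤ L) (hΔ : A * (2 * K * M) ≤ Δ)
    (hσ : (A / s) ^ 2 * K * (1 / q - 1) ≤ σ ^ 2) :
    (hardProblem n c A s q h0 h1).Homogeneous L Δ σ where
  differentiable := by
    rw [objective_hardProblem hn]
    exact fun x => (hasGradientAt_hardFn c A s x).differentiableAt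
  smooth x y := by
    rw [objective_hardProblem hn, gradient_hardFn]
    exact (hardGrad_lipschitz c A s hs hA x y).trans (by gcongr)
  gap x := by
    rw [objective_hardProblem hn]
    exact (hardFn_gap c A s hA x).trans hΔ
  differentiable_fn _ x := (hasGradientAt_hardFn c A s x).differentiableAt
  integrable _ x := by
    have := isProbabilityMeasure_coinsLaw (M := M) (K := K) h0 h1
    exact Integrable.of_finite (μ := coinsLaw M K q) (f := hardOracle c A s q x)
  unbiased _ x := by
    change ∫ ξ, hardOracle c A s q x ξ ∂(coinsLaw M K q) = gradient (hardFn c A s) x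
    rw [gradient_hardFn, integral_hardOracle c A s h0 h1]
  variance _ x := by
    change ∫⁻ ξ, ENNReal.ofReal (‖hardOracle c A s q x ξ - gradient (hardFn c A s) x‖ ^ 2)
      ∂(coinsLaw M K q) ≤ _
    rw [gradient_hardFn]
    exact (variance_hardOracle_le c A s h0 h1 x).trans (ENNReal.ofReal_le_ofReal hσ)
  same_fn _ _ := rfl
  same_oracle _ _ := rfl
  same_law _ _ := rfl

/-! ### Executions -/

/-- Induction over a real time parameter with a positive lag. -/
theorem lag_induction {Q : ℝ → Prop} {δ : ℝ} (hδ : 0 < δ) (h0 : ∀ t < 0, Q t)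
    (h : ∀ t, (∀ s, s + δ ≤ t → Q s) → Q t) (t : ℝ) : Q t := by
  have key : ∀ k : ℕ, ∀ t < (k : ℝ) * δ, Q t := by
    intro k
    induction k with
    | zero => intro t ht; exact h0 t (by simpa using ht)
    | succ k ih =>
      intro t ht
      refine h t fun s hs => ih s ?_
      push_cast at ht
      linarith
  obtain ⟨k, hk⟩ := exists_nat_gt (t / δ)
  exact key k t ((div_lt_iff₀ hδ).1 hk)

namespace Algorithm

variable {n d : ℕ} {N : Network n} (A : Algorithm N d)

theorem isRun_run (P : Problem n d) (ω : A.Outcome P) : A.IsRun P ω (A.run P ω) :=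
  (A.existsUnique_run P ω).choose_spec.1

variable {A} {P P' : Problem n d} {ω : A.Outcome P} {ω' : A.Outcome P'} {r r' : Run n d}

theorem IsRun.start_add_le (h : A.IsRun P ω r) (i : Fin n) (m k : ℕ) :
    r.start i m + k * N.time i ≤ r.start i (m + k) := by
  induction k with
  | zero => simp
  | succ k ih =>
    rw [← add_assoc, h.start_succ i (m + k)]
    have := (A.wait i (m + k) ω.1 (A.view P ω r i (r.start i (m + k) + N.time i))).coe_nonneg
    push_cast
    linarith

theorem IsRun.start_nonneg (h : A.IsRun P ω r) (i : Fin n) (m : ℕ) : 0 ≤ r.start i m := by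
  have := h.start_add_le i 0 m
  rw [h.start_zero, zero_add, zero_add] at this
  exact le_trans (mul_nonneg (Nat.cast_nonneg _) (N.time_pos i).le) this

theorem mem_support_view {i : Fin n} {t : ℝ} {c : Fin d} :
    c ∈ View.support (A.view P ω r i t) ↔
      (∃ m, r.start i m + N.time i ≤ t ∧ P.oracle i (r.point i m) (ω.2 (i, m)) c ≠ 0) ∨
      ∃ j k, A.plan.Delivered ω.1 j k i t ∧ A.plan.decode ω.1 j k (r.sent j k) c ≠ 0 := by
  classical
  simp only [View.support, view, Set.mem_ofPred_eq]
  refine or_congr (exists_congr fun m => ?_) (exists_congr fun j => exists_congr fun k => ?_)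
  · split_ifs with h <;> simp [h]
  · split_ifs with h <;> simp [h]

theorem _root_.Plan.Delivered.mono {Z : Type} [MeasurableSpace Z] {C : Plan N d Z} {z : Z}
    {i j : Fin n} {k : ℕ} {s t : ℝ} (h : C.Delivered z i k j s) (hst : s ≤ t) :
    C.Delivered z i k j t :=
  ⟨h.1, h.2.trans (Finset.sum_le_sum fun u _ => C.flow_mono i k z u j hst)⟩

theorem support_view_mono {i : Fin n} {s t : ℝ} (hst : s ≤ t) :
    View.support (A.view P ω r i s) ⊆ View.support (A.view P ω r i t) := by
  intro c hc
  rw [mem_support_view] at hc ⊢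
  exact hc.imp (fun ⟨m, h1, h2⟩ => ⟨m, h1.trans hst, h2⟩)
    (fun ⟨j, k, h1, h2⟩ => ⟨j, k, h1.mono hst, h2⟩)

theorem _root_.Plan.decode_ne_zero {Z : Type} [MeasurableSpace Z] {C : Plan N d Z} {z : Z}
    {i : Fin n} {k : ℕ} {s : Vec d} {c : Fin d} (h : C.decode z i k s c ≠ 0) :
    (∃ l, C.index i k z l = c) ∧ s c ≠ 0 := by
  simp only [Plan.decode, WithLp.ofLp_sum, Finset.sum_apply] at h
  obtain ⟨l, -, hl⟩ := Finset.exists_ne_zero_of_sum_ne_zero h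
  rw [PiLp.single_apply] at hl
  split_ifs at hl with hc
  · subst hc
    exact ⟨⟨l, rfl⟩, (mul_ne_zero_iff.1 hl).2⟩
  · simp at hl

theorem IsRun.point_support (h : A.IsRun P ω r) {i : Fin n} {m : ℕ} {c : Fin d}
    (hc : r.point i m c ≠ 0) : c ∈ View.support (A.view P ω r i (r.start i m)) := by
  rw [h.point_eq] at hc
  exact A.query_support _ _ _ _ _ hc

theorem IsRun.sent_support (h : A.IsRun P ω r) {i : Fin n} {k : ℕ} {c : Fin d}
    (hc : r.sent i k c ≠ 0) : c ∈ View.support (A.view P ω r i (A.plan.launch i k ω.1)) := by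
  rw [h.sent_eq] at hc
  exact A.send_support _ _ _ _ _ hc

/-- Executions on two problems that coincide up to time `S` have the same local informations up to
time `S + δ`, if the stochastic gradients computed from then on coincide. -/
theorem view_eq_of_agree {δ S T t : ℝ} (h₁ : ∀ i, δ ≤ N.time i)
    (h₂ : ∀ z i k j t, A.plan.Delivered z i k j t → (A.plan.launch i k z : ℝ) + δ ≤ t)
    (hz : ω.1 = ω'.1)
    (ho : ∀ i m, r'.start i m < T →
      P.oracle i (r'.point i m) (ω.2 (i, m)) = P'.oracle i (r'.point i m) (ω'.2 (i, m)))
    (hS : S < T) (h : A.Agree ω.1 S r r') (ht : t ≤ S + δ) (i : Fin n) :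
    A.view P ω r i t = A.view P' ω' r' i t := by
  have key : ∀ m, (r.start i m + N.time i ≤ t ↔ r'.start i m + N.time i ≤ t) := by
    intro m
    have := h₁ i
    constructor
    · intro hm
      rwa [← (h.1 i m (Or.inl (by linarith))).1]
    · intro hm
      rwa [(h.1 i m (Or.inr (by linarith))).1]
  unfold view
  refine Prod.ext rfl (Prod.ext ?_ (Prod.ext ?_ ?_))
  · simp only [key]
  · funext m
    by_cases hm : r.start i m + N.time i ≤ t
    · have := h₁ i
      have hm' := (key m).1 hm
      simp only [if_pos hm, if_pos hm', (h.1 i m (Or.inl (by linarith))).2]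
      exact ho i m (by linarith)
    · simp only [if_neg hm, if_neg (fun hc => hm ((key m).2 hc))]
  · funext j k
    rw [← hz]
    by_cases hd : A.plan.Delivered ω.1 j k i t
    · have := h₂ _ _ _ _ _ hd
      simp only [if_pos hd, h.2 j k (by linarith)]
    · simp only [if_neg hd]

/-- Two executions agree as long as the stochastic gradients coincide. -/
theorem agree_of_oracle_eq {T : ℝ} (hr : A.IsRun P ω r) (hr' : A.IsRun P' ω' r') (hz : ω.1 = ω'.1)
    (ho : ∀ i m, r'.start i m < T →
      P.oracle i (r'.point i m) (ω.2 (i, m)) = P'.oracle i (r'.point i m) (ω'.2 (i, m)))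
    {S : ℝ} (hS : S < T) : A.Agree ω.1 S r r' := by
  obtain ⟨δ, hδ, h₁, h₂⟩ := A.exists_lag
  revert hS
  refine lag_induction (Q := fun S => S < T → A.Agree ω.1 S r r') hδ ?_ ?_ S
  · intro t ht _
    refine ⟨fun i m hm => ?_, fun i k hk => ?_⟩
    · exfalso
      rcases hm with hm | hm
      · linarith [hr.start_nonneg i m]
      · linarith [hr'.start_nonneg i m]
    · exfalso
      linarith [(A.plan.launch i k ω.1).coe_nonneg]
  intro t ih ht
  have hprev := ih (t - δ) (by linarith) (by linarith)
  have hview : ∀ s ≤ t, ∀ i, A.view P ω r i s = A.view P' ω' r' i s := fun s hs i =>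
    view_eq_of_agree h₁ h₂ hz ho (S := t - δ) (by linarith) hprev (by linarith) i
  have hs : ∀ i m, (r.start i m ≤ t ∨ r'.start i m ≤ t) → r.start i m = r'.start i m := by
    intro i m hm
    cases m with
    | zero => rw [hr.start_zero, hr'.start_zero]
    | succ m =>
      have hti := h₁ i
      rw [hr.start_succ, hr'.start_succ, ← hz] at hm ⊢
      have hnn := fun V => (A.wait i m ω.1 V).coe_nonneg
      have hle : r.start i m + N.time i ≤ t ∨ r'.start i m + N.time i ≤ t := by
        rcases hm with hm | hm
        · left; linarith [hnn (A.view P ω r i (r.start i m + N.time i))]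
        · right; linarith [hnn (A.view P' ω' r' i (r'.start i m + N.time i))]
      have he := (hprev.1 i m (hle.imp (fun _ => by linarith) (fun _ => by linarith))).1
      have ht' : r'.start i m + N.time i ≤ t := by
        rcases hle with h | h
        · rwa [← he]
        · exact h
      rw [he, hview _ ht' i]
  refine ⟨fun i m hm => ⟨hs i m hm, ?_⟩, fun i k hk => ?_⟩
  · have he := hs i m hm
    have ht' : r'.start i m ≤ t := by
      rcases hm with h | h
      · rwa [← he]
      · exact h
    rw [hr.point_eq, hr'.point_eq, he, ← hz, hview _ ht' i]
  · rw [hr.sent_eq, hr'.sent_eq, ← hz, hview _ hk i]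

/-! ### Measurability of executions -/

/-- Measurability of a family of records. -/
structure RunMeasurable {Ω : Type*} [MeasurableSpace Ω] (R : Ω → Run n d) : Prop where
  start : ∀ i m, Measurable fun ω => (R ω).start i m
  point : ∀ i m, Measurable fun ω => (R ω).point i m
  sent : ∀ i m, Measurable fun ω => (R ω).sent i m

theorem _root_.Plan.flow_continuous {Z : Type} [MeasurableSpace Z] (C : Plan N d Z) (i : Fin n)
    (k : ℕ) (z : Z) (u v : Fin n) : Continuous (C.flow i k z u v) := by
  have : LipschitzWith (Real.toNNReal |N.cap u v|) (C.flow i k z u v) := by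
    refine LipschitzWith.of_dist_le_mul fun s t => ?_
    rw [Real.coe_toNNReal _ (abs_nonneg _), Real.dist_eq, Real.dist_eq]
    wlog hst : s ≤ t generalizing s t
    · rw [abs_sub_comm, abs_sub_comm s t]
      exact this t s (le_of_not_ge hst)
    have h1 := C.flow_cap {(i, k)} z u v s t hst
    rw [Finset.sum_singleton] at h1
    have h2 := C.flow_mono i k z u v hst
    rw [abs_sub_comm, abs_sub_comm s t, abs_of_nonneg (sub_nonneg.2 h2),
      abs_of_nonneg (sub_nonneg.2 hst)]
    exact h1.trans (mul_le_mul_of_nonneg_right (le_abs_self _) (sub_nonneg.2 hst))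
  exact this.continuous

theorem _root_.Plan.measurableSet_delivered {Z : Type} [MeasurableSpace Z] (C : Plan N d Z)
    {Ω : Type*} [MeasurableSpace Ω] {z : Ω → Z} {t : Ω → ℝ} (hz : Measurable z) (ht : Measurable t)
    (i : Fin n) (k : ℕ) (j : Fin n) : MeasurableSet {ω | C.Delivered (z ω) i k j (t ω)} := by
  have hf : ∀ u, Measurable fun ω => C.flow i k (z ω) u j (t ω) := by
    intro u
    have := measurable_uncurry_of_continuous_of_measurable
      (u := fun (t : ℝ) (z : Z) => C.flow i k z u j t)
      (fun z => C.flow_continuous i k z u j) (fun t => C.measurable_flow i k u j t)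
    exact this.comp (ht.prodMk hz)
  unfold Plan.Delivered
  exact ((C.measurable_dest i k).comp hz (measurableSet_singleton j)).inter
    (measurableSet_le measurable_const (Finset.measurable_sum _ fun u _ => hf u))

theorem measurable_setNcard {Ω : Type*} [MeasurableSpace Ω] {S : Ω → Set ℕ}
    (hS : ∀ m, MeasurableSet {ω | m ∈ S ω}) : Measurable fun ω => (S ω).ncard := by
  classical
  have h : ∀ ω, (S ω).ncard =
      ⌊(∑' m, (if m ∈ S ω then (1 : ℝ≥0∞) else 0)).toReal⌋₊ := by
    intro ω
    have : ∑' m, (if m ∈ S ω then (1 : ℝ≥0∞) else 0) = ((S ω).encard : ℝ≥0∞) := by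
      rw [← ENNReal.tsum_set_one, tsum_subtype (S ω) (fun _ => (1 : ℝ≥0∞))]
      rfl
    rw [this, Set.ncard_def]
    rcases eq_or_ne (S ω).encard ⊤ with h | h
    · simp [h]
    · lift (S ω).encard to ℕ using h with k
      simp
  simp only [h]
  refine Nat.measurable_floor.comp (ENNReal.measurable_toReal.comp ?_)
  exact Measurable.tsum fun m => Measurable.ite (hS m) measurable_const measurable_const

theorem _root_.EuclideanSpace.measurable_single {Ω ι : Type*} [MeasurableSpace Ω] [Fintype ι]
    [DecidableEq ι] [Countable ι]
    {j : Ω → ι} {a : Ω → ℝ} (hj : ∀ i, MeasurableSet {ω | j ω = i}) (ha : Measurable a) :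
    Measurable fun ω => EuclideanSpace.single (j ω) (a ω) := by
  refine (WithLp.measurable_toLp 2 _).comp (measurable_pi_iff.2 fun i => ?_)
  have : (fun ω => (Pi.single (j ω) (a ω) : ι → ℝ) i) = fun ω => if j ω = i then a ω else 0 := by
    funext ω
    by_cases h : j ω = i
    · subst h; simp
    · simp [h, Ne.symm h]
  change Measurable (fun ω => (Pi.single (j ω) (a ω) : ι → ℝ) i)
  rw [this]
  exact Measurable.ite (hj i) ha measurable_const

theorem _root_.Plan.measurable_decode {Z : Type} [MeasurableSpace Z] (C : Plan N d Z)
    {Ω : Type*} [MeasurableSpace Ω] {z : Ω → Z} {s : Ω → Vec d} (hz : Measurable z)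
    (hs : Measurable s) (i : Fin n) (k : ℕ) : Measurable fun ω => C.decode (z ω) i k (s ω) := by
  unfold Plan.decode
  refine Finset.measurable_sum _ fun l _ => ?_
  have hidx : Measurable fun ω => C.index i k (z ω) l :=
    (measurable_pi_apply l).comp ((C.measurable_index i k).comp hz)
  refine EuclideanSpace.measurable_single (fun c => hidx (measurableSet_singleton c)) ?_
  refine (((measurable_pi_apply l).comp ((C.measurable_coef i k).comp hz))).mul ?_
  have h : (fun ω => s ω (C.index i k (z ω) l)) =
      fun ω => ∑ c, if C.index i k (z ω) l = c then s ω c else 0 := by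
    funext ω; simp
  rw [h]
  refine Finset.measurable_sum _ fun c _ => Measurable.ite (hidx (measurableSet_singleton c)) ?_
    measurable_const
  exact (EuclideanSpace.proj c : Vec d →L[ℝ] ℝ).measurable.comp hs

theorem measurable_view {R : A.Outcome P → Run n d} (hR : RunMeasurable R) {t : A.Outcome P → ℝ}
    (ht : Measurable t) (i : Fin n) : Measurable fun ω => A.view P ω (R ω) i (t ω) := by
  have hm : ∀ m, MeasurableSet {ω | (R ω).start i m + N.time i ≤ t ω} := fun m =>
    measurableSet_le ((hR.start i m).add_const _) ht
  unfold view
  refine ht.prodMk ((measurable_setNcard hm).prodMk (Measurable.prodMk ?_ ?_))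
  · refine measurable_pi_iff.2 fun m => Measurable.ite (hm m) ?_ measurable_const
    exact (P.measurable_oracle i).comp ((hR.point i m).prodMk
      ((measurable_pi_apply (i, m)).comp measurable_snd))
  · refine measurable_pi_iff.2 fun j => measurable_pi_iff.2 fun k => Measurable.ite
      (A.plan.measurableSet_delivered measurable_fst ht j k i) ?_ measurable_const
    exact A.plan.measurable_decode measurable_fst (hR.sent j k) j k

theorem RunMeasurable.step {R : A.Outcome P → Run n d} (hR : RunMeasurable R) :
    RunMeasurable fun ω => A.step P ω (R ω) := by
  have hstart : ∀ i m, Measurable fun ω : A.Outcome P => (A.step P ω (R ω)).start i m := by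
    intro i m
    cases m with
    | zero => exact measurable_const
    | succ m =>
      have ht := (hR.start i m).add_const (N.time i)
      refine ht.add (measurable_coe_nnreal_real.comp ?_)
      exact (A.measurable_wait i m).comp (measurable_fst.prodMk (measurable_view hR ht i))
  refine ⟨hstart, fun i m => ?_, fun i k => ?_⟩
  · exact (A.measurable_query i m).comp (measurable_fst.prodMk (measurable_view hR (hstart i m) i))
  · refine (A.measurable_send i k).comp (measurable_fst.prodMk (measurable_view hR ?_ i))
    exact measurable_coe_nnreal_real.comp ((A.plan.measurable_launch i k).comp measurable_fst)

variable (A P) in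
/-- The execution is a measurable function of the outcome: it is the limit of the iterates of
`step`, which are eventually constant in each component. -/
theorem runMeasurable_run : RunMeasurable fun ω => A.run P ω := by
  obtain ⟨δ, hδ, h₁, h₂⟩ := A.exists_lag
  let R : ℕ → A.Outcome P → Run n d := fun k ω =>
    (A.step P ω)^[k] ⟨fun _ _ => 0, fun _ _ => 0, fun _ _ => 0⟩
  have hRs : ∀ k ω, R (k + 1) ω = A.step P ω (R k ω) := fun k ω => Function.iterate_succ_apply' _ _ _
  have hRm : ∀ k, RunMeasurable (R k) := by
    intro k
    induction k with
    | zero => exact ⟨fun _ _ => measurable_const, fun _ _ => measurable_const,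
        fun _ _ => measurable_const⟩
    | succ k ih => simp only [funext (hRs k)]; exact ih.step
  have hag : ∀ (k : ℕ) ω, A.Agree ω.1 ((k : ℝ) * δ - δ) (R k ω) (A.run P ω) := by
    intro k ω
    induction k with
    | zero =>
      refine ⟨fun i m hm => ?_, fun i m hm => ?_⟩
      · exfalso
        have h1 := (A.isRun_run P ω).start_nonneg i m
        have h2 : (R 0 ω).start i m = 0 := rfl
        rw [h2] at hm
        push_cast at hm
        rcases hm with hm | hm <;> linarith
      · exfalso
        have := (A.plan.launch i m ω.1).coe_nonneg
        push_cast at hm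
        linarith
    | succ k ih =>
      have := step_agree (P := P) h₁ h₂ ih
      rw [← hRs, isRun_iff.1 (A.isRun_run P ω)] at this
      exact this.mono (by push_cast; linarith)
  have hbig : ∀ T : ℝ, ∀ᶠ k : ℕ in Filter.atTop, T ≤ (k : ℝ) * δ - δ := by
    intro T
    obtain ⟨k₀, hk₀⟩ := exists_nat_ge ((T + δ) / δ)
    filter_upwards [Filter.eventually_ge_atTop k₀] with k hk
    rw [div_le_iff₀ hδ] at hk₀
    have : (k₀ : ℝ) ≤ k := by exact_mod_cast hk
    nlinarith
  refine ⟨fun i m => ?_, fun i m => ?_, fun i k => ?_⟩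
  · refine measurable_of_tendsto_metrizable (fun k => (hRm k).start i m) (tendsto_pi_nhds.2 fun ω => ?_)
    refine tendsto_const_nhds.congr' ?_
    filter_upwards [hbig ((A.run P ω).start i m)] with k hk
    exact (((hag k ω).1 i m (Or.inr hk)).1).symm
  · refine measurable_of_tendsto_metrizable (fun k => (hRm k).point i m) (tendsto_pi_nhds.2 fun ω => ?_)
    refine tendsto_const_nhds.congr' ?_
    filter_upwards [hbig ((A.run P ω).start i m)] with k hk
    exact (((hag k ω).1 i m (Or.inr hk)).2).symm
  · refine measurable_of_tendsto_metrizable (fun l => (hRm l).sent i k) (tendsto_pi_nhds.2 fun ω => ?_)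
    refine tendsto_const_nhds.congr' ?_
    filter_upwards [hbig (A.plan.launch i k ω.1)] with l hl
    exact ((hag l ω).2 i k hl).symm

end Algorithm

/-! ### Resampling -/

/-- Replacing the coordinates in `S` of a family of independent variables by an independent copy
does not change the distribution. -/
theorem measurePreserving_resample {ι : Type*} {X : ι → Type*} [∀ i, MeasurableSpace (X i)]
    (μ : (i : ι) → Measure (X i)) [∀ i, IsProbabilityMeasure (μ i)] (S : Set ι)
    [DecidablePred (· ∈ S)] :
    MeasurePreserving (fun p : (∀ i, X i) × (∀ i, X i) => S.piecewise p.2 p.1)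
      ((Measure.infinitePi μ).prod (Measure.infinitePi μ)) (Measure.infinitePi μ) := by
  have hm : Measurable fun p : (∀ i, X i) × (∀ i, X i) => S.piecewise p.2 p.1 := by
    refine measurable_pi_iff.2 fun i => ?_
    by_cases hi : i ∈ S
    · simp only [Set.piecewise, hi, if_true]; fun_prop
    · simp only [Set.piecewise, hi, if_false]; fun_prop
  refine ⟨hm, Measure.eq_infinitePi μ fun s t ht => ?_⟩
  rw [Measure.map_apply hm (MeasurableSet.pi s.countable_toSet fun i _ => ht i)]
  have hset : (fun p : (∀ i, X i) × (∀ i, X i) => S.piecewise p.2 p.1) ⁻¹' (Set.pi s t) =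
      (Set.pi (s.filter (· ∉ S)) t) ×ˢ (Set.pi (s.filter (· ∈ S)) t) := by
    ext p
    simp only [Set.mem_preimage, Set.mem_pi, Finset.mem_coe, Set.mem_prod, Finset.mem_filter]
    constructor
    · intro h
      refine ⟨fun i hi => ?_, fun i hi => ?_⟩
      · have := h i hi.1
        rwa [Set.piecewise_eq_of_notMem _ _ _ hi.2] at this
      · have := h i hi.1
        rwa [Set.piecewise_eq_of_mem _ _ _ hi.2] at this
    · rintro ⟨h1, h2⟩ i hi
      by_cases hS : i ∈ S
      · rw [Set.piecewise_eq_of_mem _ _ _ hS]; exact h2 i ⟨hi, hS⟩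
      · rw [Set.piecewise_eq_of_notMem _ _ _ hS]; exact h1 i ⟨hi, hS⟩
  rw [hset, Measure.prod_prod, Measure.infinitePi_pi _ fun i _ => ht i,
    Measure.infinitePi_pi _ fun i _ => ht i, mul_comm]
  exact Finset.prod_filter_mul_prod_filter_not s (· ∈ S) _

/-- An event that is not affected by coordinate `i₀` is independent of the events on this
coordinate. -/
theorem infinitePi_inter_eq_mul {ι : Type*} {X : ι → Type*} [∀ i, MeasurableSpace (X i)]
    (μ : (i : ι) → Measure (X i)) [∀ i, IsProbabilityMeasure (μ i)] (i₀ : ι)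
    {E : Set (∀ i, X i)} (hE : MeasurableSet E)
    (hinv : ∀ ξ ξ' : ∀ i, X i, (∀ i, i ≠ i₀ → ξ i = ξ' i) → (ξ ∈ E ↔ ξ' ∈ E))
    {B : Set (X i₀)} (hB : MeasurableSet B) :
    Measure.infinitePi μ (E ∩ {ξ | ξ i₀ ∈ B}) = Measure.infinitePi μ E * μ i₀ B := by
  classical
  have hBm : MeasurableSet {ξ : ∀ i, X i | ξ i₀ ∈ B} := measurable_pi_apply i₀ hB
  rw [← (measurePreserving_resample μ {i₀}).measure_preimage (hE.inter hBm).nullMeasurableSet]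
  have hset : (fun p : (∀ i, X i) × (∀ i, X i) => ({i₀} : Set ι).piecewise p.2 p.1) ⁻¹'
      (E ∩ {ξ | ξ i₀ ∈ B}) = E ×ˢ {ξ | ξ i₀ ∈ B} := by
    ext p
    simp only [Set.mem_preimage, Set.mem_inter_iff, Set.mem_prod]
    refine and_congr (hinv _ _ fun i hi => ?_) ?_
    · rw [Set.piecewise_eq_of_notMem _ _ _ (by simpa using hi)]
    · simp
  rw [hset, Measure.prod_prod]
  congr 1
  exact (measurePreserving_eval_infinitePi μ i₀).measure_preimage hB.nullMeasurableSet

/-- A single Bernoulli variable of a single sample is independent of every event that it does not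
affect. -/
theorem infinitePi_inter_coin {n M K : ℕ} {q : ℝ} (h0 : 0 < q) (h1 : q ≤ 1)
    (p : Fin n × ℕ) (i : Fin M × Fin K) {E : Set (Fin n × ℕ → Fin M × Fin K → Bool)}
    (hE : MeasurableSet E)
    (hinv : ∀ ξ ξ' : Fin n × ℕ → Fin M × Fin K → Bool,
      (∀ p' i', ¬(p' = p ∧ i' = i) → ξ p' i' = ξ' p' i') → (ξ ∈ E ↔ ξ' ∈ E)) :
    Measure.infinitePi (fun _ : Fin n × ℕ => coinsLaw M K q) (E ∩ {ξ | ξ p i = true}) =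
      Measure.infinitePi (fun _ : Fin n × ℕ => coinsLaw M K q) E * ENNReal.ofReal q := by
  classical
  have := isProbabilityMeasure_coinsLaw (M := M) (K := K) h0 h1
  have := isProbabilityMeasure_coinLaw h0 h1
  set ν := Measure.infinitePi (fun _ : Fin n × ℕ => coinsLaw M K q) with hν
  have hf : Measurable fun ξ : Fin n × ℕ → Fin M × Fin K → Bool => ξ p i :=
    (measurable_pi_apply i).comp (measurable_pi_apply p)
  have hBm : MeasurableSet {ξ : Fin n × ℕ → Fin M × Fin K → Bool | ξ p i = true} :=
    hf (measurableSet_singleton true)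
  have hmp := measurePreserving_resample (fun _ : Fin n × ℕ => coinsLaw M K q) {p}
  rw [← hmp.measure_preimage (hE.inter hBm).nullMeasurableSet,
    ← hmp.measure_preimage hE.nullMeasurableSet, ← hν,
    Measure.prod_apply (hmp.measurable (hE.inter hBm)), Measure.prod_apply (hmp.measurable hE),
    ← lintegral_mul_const' _ _ ENNReal.ofReal_ne_top]
  refine lintegral_congr fun ξ => ?_
  -- For a fixed value of the other samples, only the sample `p` remains.
  let F : Set (Fin M × Fin K → Bool) := {η | Function.update ξ p η ∈ E}
  have hpw : ∀ ξ' : Fin n × ℕ → Fin M × Fin K → Bool,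
      ({p} : Set (Fin n × ℕ)).piecewise ξ' ξ = Function.update ξ p (ξ' p) := by
    intro ξ'
    funext p'
    by_cases h : p' = p
    · subst h; simp
    · rw [Set.piecewise_eq_of_notMem _ _ _ (by simpa using h), Function.update_of_ne h]
  have e1 : Prod.mk ξ ⁻¹' ((fun x : (Fin n × ℕ → Fin M × Fin K → Bool) × _ =>
      ({p} : Set (Fin n × ℕ)).piecewise x.2 x.1) ⁻¹' (E ∩ {ξ | ξ p i = true})) =
      (fun ξ' => ξ' p) ⁻¹' (F ∩ {η | η i ∈ ({true} : Set Bool)}) := by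
    ext ξ'
    simp only [Set.mem_preimage, hpw, Set.mem_inter_iff, F, Set.mem_ofPred_eq,
      Function.update_self, Set.mem_singleton_iff]
  have e2 : Prod.mk ξ ⁻¹' ((fun x : (Fin n × ℕ → Fin M × Fin K → Bool) × _ =>
      ({p} : Set (Fin n × ℕ)).piecewise x.2 x.1) ⁻¹' E) = (fun ξ' => ξ' p) ⁻¹' F := by
    ext ξ'
    simp only [Set.mem_preimage, hpw, F, Set.mem_ofPred_eq]
  have hev := measurePreserving_eval_infinitePi (fun _ : Fin n × ℕ => coinsLaw M K q) p
  have hd : ∀ T : Set (Fin M × Fin K → Bool), MeasurableSet T := fun T => T.toFinite.measurableSet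
  rw [e1, e2, hev.measure_preimage (hd _).nullMeasurableSet,
    hev.measure_preimage (hd _).nullMeasurableSet, ← coinLaw_true]
  refine infinitePi_inter_eq_mul (fun _ : Fin M × Fin K => coinLaw q) i (hd F) ?_
    (measurableSet_singleton true)
  intro η η' hη
  refine hinv _ _ fun p' i' hne => ?_
  by_cases h : p' = p
  · subst h
    simp only [Function.update_self]
    exact hη i' fun h => hne ⟨rfl, h⟩
  · simp [Function.update_of_ne h]

/-! ### Averaging over permutations -/

open Classical in
/-- If a condition `E` and a set `C π` are not affected by exchanging position `a` with a position
in `U`, then among the permutations that satisfy `E` the fraction of those with `π a ∈ C π` is at most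
`#C / #U`. -/
theorem card_perm_mem_le {α : Type*} [Fintype α] [DecidableEq α] (a : α) (U : Finset α)
    (E : Equiv.Perm α → Prop) (C : Equiv.Perm α → Finset α)
    (hE : ∀ π, ∀ u ∈ U, E (π * Equiv.swap a u) ↔ E π)
    (hC : ∀ π, ∀ u ∈ U, C (π * Equiv.swap a u) = C π) {N : ℕ} (hN : ∀ π, (C π).card ≤ N) :
    U.card * (Finset.univ.filter fun π => E π ∧ π a ∈ C π).card ≤
      N * (Finset.univ.filter fun π => E π).card := by
  have h1 : ∀ u ∈ U, (Finset.univ.filter fun π => E π ∧ π a ∈ C π).card =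
      (Finset.univ.filter fun π : Equiv.Perm α => E π ∧ π u ∈ C π).card := by
    intro u hu
    refine Finset.card_bij' (fun π _ => π * Equiv.swap a u) (fun π _ => π * Equiv.swap a u)
      ?_ ?_ ?_ ?_
    · intro π hπ
      simp only [Finset.mem_filter, Finset.mem_univ, true_and] at hπ ⊢
      rw [hE π u hu, hC π u hu]
      simpa using hπ
    · intro π hπ
      simp only [Finset.mem_filter, Finset.mem_univ, true_and] at hπ ⊢
      rw [hE π u hu, hC π u hu]
      simpa using hπ
    · intro π _; simp [mul_assoc]
    · intro π _; simp [mul_assoc]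
  rw [← smul_eq_mul, ← Finset.sum_const, Finset.sum_congr rfl h1]
  simp only [Finset.card_filter]
  rw [Finset.sum_comm, Finset.mul_sum]
  refine Finset.sum_le_sum fun π _ => ?_
  by_cases hEπ : E π
  · simp only [hEπ, true_and, if_true, mul_one]
    rw [← Finset.card_filter]
    refine le_trans ?_ (hN π)
    refine Finset.card_le_card_of_injOn π (fun u hu => ?_) π.injective.injOn
    simpa using (Finset.mem_filter.1 hu).2
  · simp [hEπ]

/-! ### Truncated oracles -/

section Truncation

variable {M K d : ℕ} (c : Fin M × Fin K ↪ Fin d) (A s q : ℝ)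

/-- The set `S` contains no coordinate beyond block `m`. -/
def Confined (m : ℕ) (S : Set (Fin d)) : Prop := ∀ i, m < (i.1 : ℕ) → c i ∉ S

/-- The set `S` contains block `m`. -/
def Covers (m : ℕ) (S : Set (Fin d)) : Prop := ∀ i, (i.1 : ℕ) = m → c i ∈ S

/-- The coordinates up to block `m`. -/
def truncCoords (m : ℕ) (y : ℕ → Fin K → ℝ) : ℕ → Fin K → ℝ := fun k l => if k ≤ m then y k l else 0

/-- The oracle that neither uses nor reveals any coordinate beyond block `m`. -/
noncomputable def truncOracle (m : ℕ) (x : Vec d) (ξ : Fin M × Fin K → Bool) : Vec d :=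
  scatter c fun i =>
    if (i.1 : ℕ) ≤ m then A / s * noisyPartial q (truncCoords m (blockCoords c s x)) ξ i else 0

variable {c}

theorem blockCoords_eq_zero_of_confined {m : ℕ} {S : Set (Fin d)} (hS : Confined c m S) {x : Vec d}
    (hx : ∀ j, x j ≠ 0 → j ∈ S) {k : ℕ} (hk : m < k) (l : Fin K) : blockCoords c s x k l = 0 := by
  by_cases h : k < M
  · have h1 := blockCoords_apply c s x (⟨k, h⟩, l)
    have h2 : x (c (⟨k, h⟩, l)) = 0 := by
      by_contra hne
      exact hS (⟨k, h⟩, l) hk (hx _ hne)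
    rw [h2, mul_zero] at h1
    exact h1
  · simp [blockCoords, blockCoord, h]

theorem gate_eq_zero_of_confined {m : ℕ} {S : Set (Fin d)} (hS : Confined c m S)
    (hc : ¬ Covers c m S) {x : Vec d} (hx : ∀ j, x j ≠ 0 → j ∈ S) {k : ℕ} (hk : m < k) :
    gate (blockCoords c s x) k = 0 := by
  unfold Covers at hc
  push Not at hc
  obtain ⟨i, him, hi⟩ := hc
  obtain ⟨k, rfl⟩ : ∃ k', k = k' + 1 := ⟨k - 1, by omega⟩
  have hz : blockCoords c s x k i.2 = 0 := by
    rcases Nat.lt_or_ge m k with h | h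
    · exact blockCoords_eq_zero_of_confined s hS hx h i.2
    · obtain rfl : k = i.1 := by omega
      rw [blockCoords_apply]
      have : x (c i) = 0 := by
        by_contra hne
        exact hi (hx _ hne)
      rw [this, mul_zero]
  exact gate_succ_eq_zero _ hz.le

/-- As long as nobody knows the whole block `m`, the truncated oracle agrees with the hard one. -/
theorem hardOracle_eq_truncOracle {m : ℕ} {S : Set (Fin d)} (hS : Confined c m S)
    (hc : ¬ Covers c m S) {x : Vec d} (hx : ∀ j, x j ≠ 0 → j ∈ S) (ξ : Fin M × Fin K → Bool) :
    hardOracle c A s q x ξ = truncOracle c A s q m x ξ := by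
  have hy : truncCoords m (blockCoords c s x) = blockCoords c s x := by
    funext k l
    unfold truncCoords
    split_ifs with h
    · rfl
    · exact (blockCoords_eq_zero_of_confined s hS hx (not_le.1 h) l).symm
  unfold hardOracle truncOracle
  rw [hy]
  congr 1
  funext i
  split_ifs with h
  · rfl
  · push Not at h
    have hg := gate_eq_zero_of_confined s hS hc hx h
    have h0 := blockCoords_eq_zero_of_confined s hS hx h i.2
    have hf : frontierPart M (blockCoords c s x) i.1 i.2 = 0 := by
      unfold frontierPart
      split_ifs <;> simp [hg]
    simp [noisyPartial, chainPartial_of_eq_zero _ h0, hg, hf]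

theorem truncOracle_confined (m : ℕ) (x : Vec d) (ξ : Fin M × Fin K → Bool) {i : Fin M × Fin K}
    (hi : m < (i.1 : ℕ)) : truncOracle c A s q m x ξ (c i) = 0 := by
  rw [truncOracle, scatter_apply, if_neg (by omega)]

/-- A coordinate of the frontier block is revealed only by a successful Bernoulli variable. -/
theorem coin_of_hardOracle_ne_zero {m : ℕ} {S : Set (Fin d)} (hS : Confined c m S)
    (hc : ¬ Covers c m S) {x : Vec d} (hx : ∀ j, x j ≠ 0 → j ∈ S) {ξ : Fin M × Fin K → Bool}
    {i : Fin M × Fin K} (hi : (i.1 : ℕ) = m) (hxi : x (c i) = 0)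
    (ho : hardOracle c A s q x ξ (c i) ≠ 0) : ξ i = true := by
  by_contra hξ
  apply ho
  rw [hardOracle, scatter_apply]
  have h0 : blockCoords c s x i.1 i.2 = 0 := by rw [blockCoords_apply, hxi, mul_zero]
  have hfr : AtFrontier M (blockCoords c s x) i.1 := fun k hk _ =>
    gate_eq_zero_of_confined s hS hc hx (by omega)
  simp only [Bool.not_eq_true] at hξ
  simp [noisyPartial, chainPartial_of_eq_zero _ h0, frontierPart, if_pos hfr, h0, hξ, coin]

variable (c) in
theorem measurable_truncOracle (m : ℕ) : Measurable (Function.uncurry (truncOracle c A s q m)) := by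
  refine measurable_from_prod_countable_left fun ξ => ?_
  refine measurable_scatter c fun i => ?_
  split_ifs
  · refine Measurable.const_mul (measurable_noisyPartial (fun k l => ?_) q ξ i) _
    unfold truncCoords
    split_ifs
    · exact (blockCoord c s k l).measurable
    · exact measurable_const
  · exact measurable_const

end Truncation

/-- The workers use the truncated oracle; the objective plays no role. -/
noncomputable abbrev truncProblem (n : ℕ) {M K d : ℕ} (c : Fin M × Fin K ↪ Fin d) (A s q : ℝ)
    (h0 : 0 < q) (h1 : q ≤ 1) (m : ℕ) : Problem n d where
  Ξ := Fin M × Fin K → Bool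
  law _ := coinsLaw M K q
  isProbability _ := isProbabilityMeasure_coinsLaw h0 h1
  fn _ _ := 0
  oracle _ := truncOracle c A s q m
  measurable_oracle _ := measurable_truncOracle c A s q m

/-! ### Progress along the chain -/

namespace Algorithm

variable {n d M K : ℕ} {N : Network n} (A : Algorithm N d)

/-- The outcomes for the hard problems. -/
abbrev CoinOutcome (M K : ℕ) := A.Z × (Fin n × ℕ → Fin M × Fin K → Bool)

/-- The coordinates that worker `j` knows at time `t`. -/
def known (P : Problem n d) (ω : A.Outcome P) (j : Fin n) (t : ℝ) : Set (Fin d) :=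
  View.support (A.view P ω (A.run P ω) j t)

/-- At time `t`, some worker knows block `m`. -/
def Completed (c : Fin M × Fin K ↪ Fin d) (P : Problem n d) (ω : A.Outcome P) (m : ℕ) (t : ℝ) :
    Prop := ∃ j, Covers c m (A.known P ω j t)

variable {A} {c : Fin M × Fin K ↪ Fin d}

theorem Completed.mono {P : Problem n d} {ω : A.Outcome P} {m : ℕ} {t u : ℝ}
    (h : A.Completed c P ω m t) (htu : t ≤ u) : A.Completed c P ω m u :=
  h.imp fun _ hj i hi => support_view_mono htu (hj i hi)

theorem known_eq_empty {P : Problem n d} {ω : A.Outcome P} {j : Fin n} {t : ℝ} (ht : t < 0) :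
    A.known P ω j t = ∅ := by
  obtain ⟨δ, hδ, h₁, h₂⟩ := A.exists_lag
  ext e
  simp only [known, mem_support_view, Set.mem_empty_iff_false, iff_false]
  rintro (⟨m, hm, -⟩ | ⟨i, k, hd, -⟩)
  · linarith [(A.isRun_run P ω).start_nonneg j m, N.time_pos j]
  · linarith [h₂ _ _ _ _ _ hd, (A.plan.launch i k ω.1).coe_nonneg]

theorem not_completed_of_neg (hK : 0 < K) {P : Problem n d} {ω : A.Outcome P} {m : ℕ} (hm : m < M)
    {t : ℝ} (ht : t < 0) : ¬ A.Completed c P ω m t := by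
  rintro ⟨j, hj⟩
  have := hj (⟨m, hm⟩, ⟨0, hK⟩) rfl
  rw [known_eq_empty ht] at this
  exact this

variable {a s q : ℝ} {h0 : 0 < q} {h1 : q ≤ 1}

/-- Before some worker knows block `m`, nobody knows a coordinate of a later block. -/
theorem confined_of_not_completed (ω : A.CoinOutcome M K) (m : ℕ) (t : ℝ)
    (ht : ¬ A.Completed c (hardProblem n c a s q h0 h1) ω m t) (j : Fin n) :
    Confined c m (A.known (hardProblem n c a s q h0 h1) ω j t) := by
  obtain ⟨δ, hδ, h₁, h₂⟩ := A.exists_lag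
  set P := hardProblem n c a s q h0 h1
  revert j ht
  refine lag_induction (Q := fun t => ¬ A.Completed c P ω m t → ∀ j, Confined c m (A.known P ω j t))
    hδ ?_ ?_ t
  · intro t ht _ j i _ hmem
    rw [known_eq_empty ht] at hmem
    exact hmem
  intro t ih ht j i hi hmem
  have hlate : ∀ u, u + δ ≤ t → ¬ A.Completed c P ω m u := fun u hu h => ht (h.mono (by linarith))
  rcases mem_support_view.1 hmem with ⟨b, hb, ho⟩ | ⟨i', k, hd, hk⟩
  · have hst : (A.run P ω).start j b + δ ≤ t := by linarith [h₁ j]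
    have hconf := ih _ hst (hlate _ hst) j
    have hcov : ¬ Covers c m (A.known P ω j ((A.run P ω).start j b)) := fun h => hlate _ hst ⟨j, h⟩
    have heq := hardOracle_eq_truncOracle a s q hconf hcov
      (fun e he => (A.isRun_run P ω).point_support he) (ω.2 (j, b))
    apply ho
    change hardOracle c a s q ((A.run P ω).point j b) (ω.2 (j, b)) (c i) = 0
    rw [heq]
    exact truncOracle_confined a s q m _ _ hi
  · have hst := h₂ _ _ _ _ _ hd
    exact ih _ hst (hlate _ hst) i' i hi
      ((A.isRun_run P ω).sent_support (Plan.decode_ne_zero hk).2)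

theorem confined_truncProblem (ω : A.CoinOutcome M K) (m : ℕ) (t : ℝ) (j : Fin n) :
    Confined c m (A.known (truncProblem n c a s q h0 h1 m) ω j t) := by
  obtain ⟨δ, hδ, h₁, h₂⟩ := A.exists_lag
  set P := truncProblem n c a s q h0 h1 m
  revert j
  refine lag_induction (Q := fun t => ∀ j, Confined c m (A.known P ω j t)) hδ ?_ ?_ t
  · intro t ht j i _ hmem
    rw [known_eq_empty ht] at hmem
    exact hmem
  intro t ih j i hi hmem
  rcases mem_support_view.1 hmem with ⟨b, hb, ho⟩ | ⟨i', k, hd, hk⟩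
  · exact ho (truncOracle_confined a s q m _ _ hi)
  · exact ih _ (h₂ _ _ _ _ _ hd) i' i hi
      ((A.isRun_run P ω).sent_support (Plan.decode_ne_zero hk).2)

variable (A c a s q h0 h1)

/-- The first time, capped at `T`, at which some worker knows block `m`. Since it is defined by means
of the truncated oracle, it does not depend on the later blocks. -/
noncomputable def hitTime (T : ℝ) (m : ℕ) (ω : A.CoinOutcome M K) : ℝ :=
  sInf ({t | A.Completed c (truncProblem n c a s q h0 h1 m) ω m t} ∪ {T})

/-- Gradient computation `b` is the first one of worker `j` that does not start before `hitTime`. -/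
def FirstDraw (T : ℝ) (m : ℕ) (ω : A.CoinOutcome M K) (j : Fin n) (b : ℕ) : Prop :=
  A.hitTime c a s q h0 h1 T m ω ≤ (A.run (truncProblem n c a s q h0 h1 m) ω).start j b ∧
  ∀ b' < b, (A.run (truncProblem n c a s q h0 h1 m) ω).start j b' < A.hitTime c a s q h0 h1 T m ω

/-- In one of the first `W` gradient computations of worker `j` after `hitTime`, coordinate `i` is
revealed (if its block is at the frontier). -/
def Drawn (T : ℝ) (m W : ℕ) (ω : A.CoinOutcome M K) (j : Fin n) (i : Fin M × Fin K) : Prop :=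
  ∃ b, A.FirstDraw c a s q h0 h1 T m ω j b ∧ ∃ k < W, ω.2 (j, b + k) i = true

/-- Worker `j` receives coordinate `e` in a message that is launched and delivered within time `w`
after `hitTime`. -/
def Received (T w : ℝ) (m : ℕ) (ω : A.CoinOutcome M K) (j : Fin n) (e : Fin d) : Prop :=
  ∃ i k, A.hitTime c a s q h0 h1 T m ω ≤ A.plan.launch i k ω.1 ∧
    A.plan.Delivered ω.1 i k j (A.hitTime c a s q h0 h1 T m ω + w) ∧ ∃ l, A.plan.index i k ω.1 l = e

variable {A c a s q h0 h1}

theorem bddBelow_hit (hK : 0 < K) {m : ℕ} (hm : m < M) (T : ℝ) (ω : A.CoinOutcome M K) :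
    BddBelow ({t | A.Completed c (truncProblem n c a s q h0 h1 m) ω m t} ∪ {T}) := by
  refine ⟨min 0 T, ?_⟩
  rintro t (ht | rfl)
  · refine (min_le_left _ _).trans (not_lt.1 fun h => not_completed_of_neg hK hm h ht)
  · exact min_le_right _ _

theorem not_completed_of_lt_hitTime (hK : 0 < K) {m : ℕ} (hm : m < M) {T : ℝ}
    {ω : A.CoinOutcome M K} {t : ℝ} (ht : t < A.hitTime c a s q h0 h1 T m ω) :
    ¬ A.Completed c (truncProblem n c a s q h0 h1 m) ω m t := fun h =>
  absurd (csInf_le (bddBelow_hit hK hm T ω) (Or.inl h)) (not_le.2 ht)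

theorem oracle_eq_before_hitTime (hK : 0 < K) {m : ℕ} (hm : m < M) {T : ℝ} (ω : A.CoinOutcome M K)
    (j : Fin n) (b : ℕ) (hb : (A.run (truncProblem n c a s q h0 h1 m) ω).start j b <
      A.hitTime c a s q h0 h1 T m ω) :
    hardOracle c a s q ((A.run (truncProblem n c a s q h0 h1 m) ω).point j b) (ω.2 (j, b)) =
      truncOracle c a s q m ((A.run (truncProblem n c a s q h0 h1 m) ω).point j b) (ω.2 (j, b)) :=
  hardOracle_eq_truncOracle a s q (confined_truncProblem ω m _ j)
    (fun h => not_completed_of_lt_hitTime hK hm hb ⟨j, h⟩)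
    (fun _ he => (A.isRun_run (truncProblem n c a s q h0 h1 m) ω).point_support he) _

theorem agree_before_hitTime (hK : 0 < K) {m : ℕ} (hm : m < M) {T : ℝ} (ω : A.CoinOutcome M K)
    {S : ℝ} (hS : S < A.hitTime c a s q h0 h1 T m ω) :
    A.Agree ω.1 S (A.run (hardProblem n c a s q h0 h1) ω)
      (A.run (truncProblem n c a s q h0 h1 m) ω) :=
  agree_of_oracle_eq (A.isRun_run (hardProblem n c a s q h0 h1) ω)
    (A.isRun_run (truncProblem n c a s q h0 h1 m) ω) rfl
    (oracle_eq_before_hitTime hK hm ω) hS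

/-- Up to shortly after `hitTime` the workers know the same for both oracles. -/
theorem known_eq_known_truncProblem (hK : 0 < K) {m : ℕ} (hm : m < M) {T : ℝ} {δ : ℝ}
    (h₁ : ∀ i, δ ≤ N.time i)
    (h₂ : ∀ z i k j t, A.plan.Delivered z i k j t → (A.plan.launch i k z : ℝ) + δ ≤ t)
    (ω : A.CoinOutcome M K) {t : ℝ} (ht : t < A.hitTime c a s q h0 h1 T m ω + δ) (j : Fin n) :
    A.known (hardProblem n c a s q h0 h1) ω j t = A.known (truncProblem n c a s q h0 h1 m) ω j t := by
  unfold known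
  rw [view_eq_of_agree (P' := truncProblem n c a s q h0 h1 m) (ω' := ω) (S := t - δ) h₁ h₂ rfl
    (oracle_eq_before_hitTime (T := T) hK hm ω) (by linarith)
    (agree_before_hitTime hK hm ω (by linarith)) (by linarith) j]

theorem le_hitTime (hK : 0 < K) {m : ℕ} (hm : m < M) {T u : ℝ} (hu : u ≤ T) (ω : A.CoinOutcome M K)
    (h : ¬ A.Completed c (hardProblem n c a s q h0 h1) ω m u) :
    u ≤ A.hitTime c a s q h0 h1 T m ω := by
  obtain ⟨δ, hδ, h₁, h₂⟩ := A.exists_lag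
  by_contra hlt
  push Not at hlt
  obtain ⟨t, ht, htlt⟩ := exists_lt_of_csInf_lt (s := {t | A.Completed c
    (truncProblem n c a s q h0 h1 m) ω m t} ∪ {T}) ⟨T, Or.inr rfl⟩
    (show A.hitTime c a s q h0 h1 T m ω < min u (A.hitTime c a s q h0 h1 T m ω + δ) from
      lt_min hlt (by linarith))
  rcases ht with ⟨j, hj⟩ | rfl
  · refine h (Completed.mono (t := t) ⟨j, ?_⟩ (htlt.trans_le (min_le_left _ _)).le)
    rwa [known_eq_known_truncProblem hK hm h₁ h₂ ω (htlt.trans_le (min_le_right _ _))]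
  · exact absurd (htlt.trans_le (min_le_left _ _)) (not_lt.2 hu)

/-- Nobody knows a coordinate of a block after `m` before `hitTime`. -/
theorem hitTime_le_of_known (hK : 0 < K) {m : ℕ} (hm : m < M) {T t : ℝ} {ω : A.CoinOutcome M K}
    {j : Fin n} {i : Fin M × Fin K} (hi : m < (i.1 : ℕ))
    (h : c i ∈ A.known (hardProblem n c a s q h0 h1) ω j t) :
    A.hitTime c a s q h0 h1 T m ω ≤ t := by
  obtain ⟨δ, hδ, h₁, h₂⟩ := A.exists_lag
  by_contra hlt
  push Not at hlt
  rw [known_eq_known_truncProblem (T := T) hK hm h₁ h₂ ω (by linarith)] at h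
  exact confined_truncProblem ω m t j i hi h

/-- A gradient computation between `hitTime` and `hitTime + w` is among the first `w / h` ones. -/
theorem exists_firstDraw (hK : 0 < K) {m : ℕ} (hm : m < M) {T w h : ℝ} (hh : 0 < h)
    (htime : ∀ i, N.time i = h) {ω : A.CoinOutcome M K} {j : Fin n} {b : ℕ}
    (hb : A.hitTime c a s q h0 h1 T m ω ≤ (A.run (hardProblem n c a s q h0 h1) ω).start j b)
    (hbw : (A.run (hardProblem n c a s q h0 h1) ω).start j b + h ≤
      A.hitTime c a s q h0 h1 T m ω + w) :
    ∃ b₀, A.FirstDraw c a s q h0 h1 T m ω j b₀ ∧ ∃ k < ⌊w / h⌋₊, b₀ + k = b := by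
  classical
  set τ := A.hitTime c a s q h0 h1 T m ω
  set r := A.run (hardProblem n c a s q h0 h1) ω
  set r' := A.run (truncProblem n c a s q h0 h1 m) ω
  have hr : A.IsRun (hardProblem n c a s q h0 h1) ω r := A.isRun_run (hardProblem n c a s q h0 h1) ω
  have hiff : ∀ b, τ ≤ r'.start j b ↔ τ ≤ r.start j b := by
    intro b
    rw [← not_lt, ← not_lt, not_iff_not]
    constructor
    · intro hlt
      rwa [((agree_before_hitTime hK hm ω hlt).1 j b (Or.inr le_rfl)).1]
    · intro hlt
      rwa [← ((agree_before_hitTime hK hm ω hlt).1 j b (Or.inl le_rfl)).1]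
  have hex : ∃ b, τ ≤ r'.start j b := ⟨b, (hiff b).2 hb⟩
  have hle : Nat.find hex ≤ b := Nat.find_min' hex ((hiff b).2 hb)
  refine ⟨Nat.find hex, ⟨Nat.find_spec hex, fun b' hb' => not_le.1 (Nat.find_min hex hb')⟩,
    b - Nat.find hex, ?_, by omega⟩
  have h2 := (hiff _).1 (Nat.find_spec hex)
  have h3 := hr.start_add_le j (Nat.find hex) (b - Nat.find hex)
  rw [Nat.add_sub_cancel' hle, htime] at h3
  refine Nat.lt_of_succ_le (Nat.le_floor ?_)
  rw [le_div_iff₀ hh]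
  push_cast
  linarith

/-- If some worker completes block `m + 1` within time `w` after the completion of block `m`, then it
has received or drawn all coordinates of the block within that time, and each coordinate has been
drawn by some worker. -/
theorem received_or_drawn (hK : 0 < K) {m : ℕ} (hm : m + 1 < M) {T w h t : ℝ} (hh : 0 < h)
    (htime : ∀ i, N.time i = h) (hw : 0 ≤ w) (htT : t ≤ T) {ω : A.CoinOutcome M K}
    (hfull : A.Completed c (hardProblem n c a s q h0 h1) ω (m + 1) t)
    (hnot : ¬ A.Completed c (hardProblem n c a s q h0 h1) ω m (t - w)) :
    (∃ j, ∀ i : Fin M × Fin K, (i.1 : ℕ) = m + 1 → A.Received c a s q h0 h1 T w m ω j (c i) ∨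
      A.Drawn c a s q h0 h1 T m ⌊w / h⌋₊ ω j i) ∧
    ∀ i : Fin M × Fin K, (i.1 : ℕ) = m + 1 → ∃ j, A.Drawn c a s q h0 h1 T m ⌊w / h⌋₊ ω j i := by
  obtain ⟨δ, hδ, h₁, h₂⟩ := A.exists_lag
  have hm' : m < M := by omega
  set P := hardProblem n c a s q h0 h1
  have hr : A.IsRun P ω (A.run P ω) := A.isRun_run P ω
  have htw : t ≤ A.hitTime c a s q h0 h1 T m ω + w := by
    have := le_hitTime (a := a) (s := s) (h0 := h0) (h1 := h1) hK hm' (u := t - w) (T := T)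
      (by linarith) ω hnot
    linarith
  -- Go back to a moment at which the block has just been completed.
  obtain ⟨t', ht't, hfull', hnot'⟩ : ∃ t' ≤ t, A.Completed c P ω (m + 1) t' ∧
      ¬ A.Completed c P ω (m + 1) (t' - δ) := by
    revert hfull
    clear htw hnot htT
    refine lag_induction (Q := fun t => A.Completed c P ω (m + 1) t → ∃ t' ≤ t,
      A.Completed c P ω (m + 1) t' ∧ ¬ A.Completed c P ω (m + 1) (t' - δ)) hδ ?_ ?_ t
    · intro t ht hf
      exact absurd hf (not_completed_of_neg hK hm ht)
    · intro t ih hf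
      by_cases hp : A.Completed c P ω (m + 1) (t - δ)
      · obtain ⟨t', h1, h2⟩ := ih (t - δ) (by linarith) hp
        exact ⟨t', by linarith, h2⟩
      · exact ⟨t, le_rfl, hf, hp⟩
  have hearly : ∀ u, u + δ ≤ t' → ¬ A.Completed c P ω (m + 1) u := fun u hu h =>
    hnot' (h.mono (by linarith))
  have hdraw : ∀ (u : ℝ), u ≤ t' → ∀ (j : Fin n) (i : Fin M × Fin K), (i.1 : ℕ) = m + 1 → ∀ b,
      (A.run P ω).start j b + N.time j ≤ u →
      P.oracle j ((A.run P ω).point j b) (ω.2 (j, b)) (c i) ≠ 0 →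
      c i ∈ A.known P ω j ((A.run P ω).start j b) ∨ A.Drawn c a s q h0 h1 T m ⌊w / h⌋₊ ω j i := by
    intro u hu j i hi b hb ho
    by_cases hx : (A.run P ω).point j b (c i) = 0
    · right
      have hst : (A.run P ω).start j b + δ ≤ t' := by linarith [h₁ j]
      have hcoin := coin_of_hardOracle_ne_zero a s q
        (confined_of_not_completed ω (m + 1) _ (hearly _ hst) j)
        (fun h => hearly _ hst ⟨j, h⟩) (fun e he => hr.point_support he) hi hx ho
      have hge : A.hitTime c a s q h0 h1 T m ω ≤ (A.run P ω).start j b := by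
        by_contra hlt
        push Not at hlt
        have hag := ((agree_before_hitTime hK hm' ω hlt).1 j b (Or.inl le_rfl))
        have := oracle_eq_before_hitTime hK hm' ω j b (by rw [← hag.1]; exact hlt)
        rw [← hag.2] at this
        apply ho
        change hardOracle c a s q _ _ (c i) = 0
        rw [this]
        exact truncOracle_confined a s q m _ _ (by omega)
      obtain ⟨b₀, hb₀, k, hk, rfl⟩ := exists_firstDraw (w := w) hK hm' hh htime hge
        (by rw [← htime j]; linarith)
      exact ⟨b₀, hb₀, k, hk, hcoin⟩
    · exact Or.inl (hr.point_support hx)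
  have hown : ∀ u, u ≤ t' → ∀ (j : Fin n) (i : Fin M × Fin K), (i.1 : ℕ) = m + 1 →
      c i ∈ A.known P ω j u →
      A.Received c a s q h0 h1 T w m ω j (c i) ∨ A.Drawn c a s q h0 h1 T m ⌊w / h⌋₊ ω j i := by
    refine fun u => lag_induction (Q := fun u => u ≤ t' → ∀ (j : Fin n) (i : Fin M × Fin K),
      (i.1 : ℕ) = m + 1 → c i ∈ A.known P ω j u → A.Received c a s q h0 h1 T w m ω j (c i) ∨
        A.Drawn c a s q h0 h1 T m ⌊w / h⌋₊ ω j i) hδ ?_ ?_ u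
    · intro u hu _ j i _ hmem
      rw [known_eq_empty hu] at hmem
      exact hmem.elim
    · intro u ih hu j i hi hmem
      rcases mem_support_view.1 hmem with ⟨b, hb, ho⟩ | ⟨i', k, hd, hk⟩
      · rcases hdraw u hu j i hi b hb ho with h | h
        · have := h₁ j
          exact ih _ (by linarith) (by linarith) j i hi h
        · exact Or.inr h
      · left
        have hdec := Plan.decode_ne_zero hk
        exact ⟨i', k, hitTime_le_of_known hK hm' (by omega) (hr.sent_support hdec.2),
          hd.mono (by linarith), hdec.1⟩
  have hany : ∀ u, u ≤ t' → ∀ (j : Fin n) (i : Fin M × Fin K), (i.1 : ℕ) = m + 1 →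
      c i ∈ A.known P ω j u → ∃ j', A.Drawn c a s q h0 h1 T m ⌊w / h⌋₊ ω j' i := by
    refine fun u => lag_induction (Q := fun u => u ≤ t' → ∀ (j : Fin n) (i : Fin M × Fin K),
      (i.1 : ℕ) = m + 1 → c i ∈ A.known P ω j u →
        ∃ j', A.Drawn c a s q h0 h1 T m ⌊w / h⌋₊ ω j' i) hδ ?_ ?_ u
    · intro u hu _ j i _ hmem
      rw [known_eq_empty hu] at hmem
      exact hmem.elim
    · intro u ih hu j i hi hmem
      rcases mem_support_view.1 hmem with ⟨b, hb, ho⟩ | ⟨i', k, hd, hk⟩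
      · rcases hdraw u hu j i hi b hb ho with h | h
        · have := h₁ j
          exact ih _ (by linarith) (by linarith) j i hi h
        · exact ⟨j, h⟩
      · have hst := h₂ _ _ _ _ _ hd
        exact ih _ hst (by linarith) i' i hi (hr.sent_support (Plan.decode_ne_zero hk).2)
  obtain ⟨j, hj⟩ := hfull'
  exact ⟨⟨j, fun i hi => hown t' le_rfl j i hi (hj i hi)⟩,
    fun i hi => hany t' le_rfl j i hi (hj i hi)⟩

end Algorithm

namespace Algorithm

variable {n d M K : ℕ} {N : Network n} {A : Algorithm N d}

/-! ### Dependence of the progress on the random choices -/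

/-- Executions with the same stochastic gradients are equal. -/
theorem run_eq_of_oracle_eq {P P' : Problem n d} {ω : A.Outcome P} {ω' : A.Outcome P'}
    (hz : ω.1 = ω'.1)
    (ho : ∀ i m x, P.oracle i x (ω.2 (i, m)) = P'.oracle i x (ω'.2 (i, m))) :
    A.run P ω = A.run P' ω' ∧ ∀ j t, A.known P ω j t = A.known P' ω' j t := by
  have hag : ∀ S : ℝ, A.Agree ω.1 S (A.run P ω) (A.run P' ω') := fun S =>
    agree_of_oracle_eq (T := S + 1) (A.isRun_run P ω) (A.isRun_run P' ω') hz
      (fun i m _ => ho i m _) (by linarith)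
  refine ⟨Run.ext ?_ ?_ ?_, fun j t => ?_⟩
  · funext i m
    exact ((hag ((A.run P ω).start i m)).1 i m (Or.inl le_rfl)).1
  · funext i m
    exact ((hag ((A.run P ω).start i m)).1 i m (Or.inl le_rfl)).2
  · funext i k
    exact (hag (A.plan.launch i k ω.1)).2 i k le_rfl
  · obtain ⟨δ, hδ, h₁, h₂⟩ := A.exists_lag
    unfold known
    rw [view_eq_of_agree (T := t + 1) h₁ h₂ hz (fun i m _ => ho i m _) (by linarith) (hag t)
      (by linarith) j]

theorem truncOracle_congr {c c' : Fin M × Fin K ↪ Fin d} (a s q : ℝ) {m : ℕ}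
    (hc : ∀ i, (i.1 : ℕ) ≤ m → c i = c' i) {ξ ξ' : Fin M × Fin K → Bool}
    (hξ : ∀ i, (i.1 : ℕ) ≤ m → ξ i = ξ' i) (x : Vec d) :
    truncOracle c a s q m x ξ = truncOracle c' a s q m x ξ' := by
  have hy : truncCoords m (blockCoords c s x) = truncCoords m (blockCoords c' s x) := by
    funext k l
    unfold truncCoords
    split_ifs with h
    · by_cases hk : k < M
      · simp [blockCoords, blockCoord, hk, hc (⟨k, hk⟩, l) h]
      · simp [blockCoords, blockCoord, hk]
    · rfl
  unfold truncOracle scatter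
  refine Finset.sum_congr rfl fun i _ => ?_
  dsimp only
  split_ifs with h
  · rw [hc i h, hy]
    simp only [noisyPartial, hξ i h]
  · have h0 : ∀ j : Fin d, (EuclideanSpace.single j (0 : ℝ) : Vec d) = 0 := by
      intro j
      ext k
      by_cases hk : k = j <;> simp [hk]
    rw [h0, h0]

section Congruence

variable {c c' : Fin M × Fin K ↪ Fin d} {a s q : ℝ} {h0 : 0 < q} {h1 : q ≤ 1} {m : ℕ}
  {ω ω' : A.CoinOutcome M K}

theorem trunc_congr (hc : ∀ i, (i.1 : ℕ) ≤ m → c i = c' i) (hz : ω.1 = ω'.1)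
    (hξ : ∀ p i, (i.1 : ℕ) ≤ m → ω.2 p i = ω'.2 p i) :
    A.run (truncProblem n c a s q h0 h1 m) ω = A.run (truncProblem n c' a s q h0 h1 m) ω' ∧
    ∀ j t, A.known (truncProblem n c a s q h0 h1 m) ω j t =
      A.known (truncProblem n c' a s q h0 h1 m) ω' j t :=
  run_eq_of_oracle_eq (P := truncProblem n c a s q h0 h1 m)
    (P' := truncProblem n c' a s q h0 h1 m) hz
    fun _ _ x => truncOracle_congr a s q hc (hξ _) x

theorem hitTime_congr (hc : ∀ i, (i.1 : ℕ) ≤ m → c i = c' i) (hz : ω.1 = ω'.1)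
    (hξ : ∀ p i, (i.1 : ℕ) ≤ m → ω.2 p i = ω'.2 p i) (T : ℝ) :
    A.hitTime c a s q h0 h1 T m ω = A.hitTime c' a s q h0 h1 T m ω' := by
  unfold hitTime Completed Covers
  have hk := (trunc_congr (a := a) (s := s) (h0 := h0) (h1 := h1) hc hz hξ).2
  congr 2
  ext t
  simp only [Set.mem_ofPred_eq]
  refine exists_congr fun j => forall_congr' fun i => ?_
  refine imp_congr_right fun hi => ?_
  rw [hc i hi.le, hk]

theorem firstDraw_congr (hc : ∀ i, (i.1 : ℕ) ≤ m → c i = c' i) (hz : ω.1 = ω'.1)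
    (hξ : ∀ p i, (i.1 : ℕ) ≤ m → ω.2 p i = ω'.2 p i) (T : ℝ) (j : Fin n) (b : ℕ) :
    A.FirstDraw c a s q h0 h1 T m ω j b ↔ A.FirstDraw c' a s q h0 h1 T m ω' j b := by
  unfold FirstDraw
  rw [hitTime_congr hc hz hξ, (trunc_congr (a := a) (s := s) (h0 := h0) (h1 := h1) hc hz hξ).1]

theorem received_congr (hc : ∀ i, (i.1 : ℕ) ≤ m → c i = c' i) (hz : ω.1 = ω'.1)
    (hξ : ∀ p i, (i.1 : ℕ) ≤ m → ω.2 p i = ω'.2 p i) (T w : ℝ) (j : Fin n) (e : Fin d) :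
    A.Received c a s q h0 h1 T w m ω j e ↔ A.Received c' a s q h0 h1 T w m ω' j e := by
  unfold Received
  rw [hitTime_congr hc hz hξ, hz]

theorem drawn_congr (hc : ∀ i, (i.1 : ℕ) ≤ m → c i = c' i) (hz : ω.1 = ω'.1)
    (hξ : ∀ p i, (i.1 : ℕ) ≤ m → ω.2 p i = ω'.2 p i) (T : ℝ) (W : ℕ) (j : Fin n)
    {i : Fin M × Fin K} (hi : ∀ p, ω.2 p i = ω'.2 p i) :
    A.Drawn c a s q h0 h1 T m W ω j i ↔ A.Drawn c' a s q h0 h1 T m W ω' j i := by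
  unfold Drawn
  refine exists_congr fun b => and_congr (firstDraw_congr hc hz hξ T j b) ?_
  simp only [hi]

end Congruence

/-! ### Measurability of the progress -/

section Measurability

variable (A) (c : Fin M × Fin K ↪ Fin d) (a s q : ℝ) (h0 : 0 < q) (h1 : q ≤ 1)

theorem measurableSet_known (P : Problem n d) (j : Fin n) (t : ℝ) (e : Fin d) :
    MeasurableSet {ω | e ∈ A.known P ω j t} := by
  have hV := measurable_view (A.runMeasurable_run P) (measurable_const (a := t)) j
  have hproj : ∀ {f : A.Outcome P → Vec d}, Measurable f → MeasurableSet {ω | f ω e ≠ 0} :=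
    fun hf => (((EuclideanSpace.proj e : Vec d →L[ℝ] ℝ).measurable.comp hf)
      (measurableSet_singleton 0)).compl
  have hset : {ω | e ∈ A.known P ω j t} =
      (⋃ m, {ω | (A.view P ω (A.run P ω) j t).2.2.1 m e ≠ 0}) ∪
      ⋃ i, ⋃ k, {ω | (A.view P ω (A.run P ω) j t).2.2.2 i k e ≠ 0} := by
    ext ω; simp [known, View.support]
  rw [hset]
  refine MeasurableSet.union (MeasurableSet.iUnion fun m => hproj ?_)
    (MeasurableSet.iUnion fun i => MeasurableSet.iUnion fun k => hproj ?_)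
  · exact (measurable_pi_apply m).comp hV.snd.snd.fst
  · exact (measurable_pi_apply k).comp ((measurable_pi_apply i).comp hV.snd.snd.snd)

theorem measurableSet_completed (P : Problem n d) (m : ℕ) (t : ℝ) :
    MeasurableSet {ω | A.Completed c P ω m t} := by
  unfold Completed Covers
  simp only [Set.ofPred_exists, Set.ofPred_forall]
  exact MeasurableSet.iUnion fun j => MeasurableSet.iInter fun i => MeasurableSet.iInter fun _ =>
    measurableSet_known A P j t _

theorem measurable_hitTime (hK : 0 < K) {m : ℕ} (hm : m < M) (T : ℝ) :
    Measurable (A.hitTime c a s q h0 h1 T m) := by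
  refine measurable_of_Iio fun x => ?_
  have hset : A.hitTime c a s q h0 h1 T m ⁻¹' Set.Iio x = {_ω | T < x} ∪
      ⋃ t : ℚ, ⋃ _ : (t : ℝ) < x, {ω | A.Completed c (truncProblem n c a s q h0 h1 m) ω m t} := by
    ext ω
    simp only [Set.mem_preimage, Set.mem_Iio, Set.mem_union, Set.mem_ofPred_eq, Set.mem_iUnion]
    unfold hitTime
    rw [csInf_lt_iff (bddBelow_hit hK hm T ω) ⟨T, Or.inr rfl⟩]
    constructor
    · rintro ⟨t, ht | rfl, htx⟩
      · obtain ⟨t', h1, h2⟩ := exists_rat_btwn htx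
        exact Or.inr ⟨t', h2, Completed.mono ht h1.le⟩
      · exact Or.inl htx
    · rintro (h | ⟨t, ht, h⟩)
      · exact ⟨T, Or.inr rfl, h⟩
      · exact ⟨t, Or.inl h, ht⟩
  rw [hset]
  exact (MeasurableSet.const _).union (MeasurableSet.iUnion fun t => MeasurableSet.iUnion fun _ =>
    measurableSet_completed A c _ m t)

theorem measurableSet_firstDraw (hK : 0 < K) {m : ℕ} (hm : m < M) (T : ℝ) (j : Fin n) (b : ℕ) :
    MeasurableSet {ω | A.FirstDraw c a s q h0 h1 T m ω j b} := by
  have hh := measurable_hitTime A c a s q h0 h1 hK hm T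
  have hs := fun b => (A.runMeasurable_run (truncProblem n c a s q h0 h1 m)).start j b
  unfold FirstDraw
  simp only [Set.ofPred_and, Set.ofPred_forall]
  exact (measurableSet_le hh (hs b)).inter (MeasurableSet.iInter fun b' =>
    MeasurableSet.iInter fun _ => measurableSet_lt (hs b') hh)

theorem measurableSet_drawn (hK : 0 < K) {m : ℕ} (hm : m < M) (T : ℝ) (W : ℕ) (j : Fin n)
    (i : Fin M × Fin K) : MeasurableSet {ω | A.Drawn c a s q h0 h1 T m W ω j i} := by
  unfold Drawn
  simp only [Set.ofPred_exists, Set.ofPred_and]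
  refine MeasurableSet.iUnion fun b => (measurableSet_firstDraw A c a s q h0 h1 hK hm T j b).inter
    (MeasurableSet.iUnion fun k => (MeasurableSet.const _).inter ?_)
  have hf : Measurable fun ω : A.CoinOutcome M K => ω.2 (j, b + k) i :=
    (measurable_pi_apply i).comp ((measurable_pi_apply _).comp measurable_snd)
  exact hf (measurableSet_singleton true)

theorem measurableSet_received (hK : 0 < K) {m : ℕ} (hm : m < M) (T w : ℝ) (j : Fin n)
    (e : Fin d) : MeasurableSet {ω | A.Received c a s q h0 h1 T w m ω j e} := by
  have hh := measurable_hitTime A c a s q h0 h1 hK hm T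
  unfold Received
  simp only [Set.ofPred_exists, Set.ofPred_and]
  refine MeasurableSet.iUnion fun i => MeasurableSet.iUnion fun k => MeasurableSet.inter ?_
    (MeasurableSet.inter ?_ (MeasurableSet.iUnion fun l => ?_))
  · exact measurableSet_le hh (measurable_coe_nnreal_real.comp
      ((A.plan.measurable_launch i k).comp measurable_fst))
  · exact A.plan.measurableSet_delivered measurable_fst (hh.add_const w) i k j
  · have : Measurable fun ω : A.CoinOutcome M K => A.plan.index i k ω.1 l :=
      (measurable_pi_apply l).comp ((A.plan.measurable_index i k).comp measurable_fst)
    exact this (measurableSet_singleton e)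

end Measurability

/-! ### Bounds for the probability of fast progress -/

theorem _root_.Network.sum_cap_le {p : ℕ} {b : ℝ} (hb : 0 ≤ b)
    (hdeg : ∀ v, (N.graph.neighborSet v).ncard ≤ p)
    (hbw : ∀ u v, N.graph.Adj u v → N.bw u v = b) (j : Fin n) : ∑ u, N.cap u j ≤ p * b := by
  classical
  have h : ∀ u, N.cap u j = if u ∈ (N.graph.neighborSet j).toFinset then b else 0 := by
    intro u
    simp only [Network.cap, Set.mem_toFinset, SimpleGraph.mem_neighborSet, N.graph.adj_comm j u]
    split_ifs with ha
    · exact hbw u j ha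
    · rfl
  simp only [h]
  rw [Finset.sum_ite_mem, Finset.univ_inter, Finset.sum_const, nsmul_eq_mul]
  gcongr
  rw [← Set.ncard_eq_toFinset_card']
  exact hdeg j

open Classical in
/-- The number of coordinates received within time `w` is bounded by the bandwidth. -/
theorem card_received_le {p : ℕ} {b w : ℝ} (hb : 0 ≤ b) (hw : 0 ≤ w)
    (hdeg : ∀ v, (N.graph.neighborSet v).ncard ≤ p)
    (hbw : ∀ u v, N.graph.Adj u v → N.bw u v = b) (c : Fin M × Fin K ↪ Fin d) (a s q : ℝ)
    (h0 : 0 < q) (h1 : q ≤ 1) (T : ℝ) (m : ℕ) (ω : A.CoinOutcome M K) (j : Fin n) :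
    (Finset.univ.filter fun e => A.Received c a s q h0 h1 T w m ω j e).card ≤ ⌊p * b * w⌋₊ := by
  set τ := A.hitTime c a s q h0 h1 T m ω
  set C := Finset.univ.filter fun e => A.Received c a s q h0 h1 T w m ω j e with hC
  have hex : ∀ e : C, ∃ ik : Fin n × ℕ, τ ≤ A.plan.launch ik.1 ik.2 ω.1 ∧
      A.plan.Delivered ω.1 ik.1 ik.2 j (τ + w) ∧ ∃ l, A.plan.index ik.1 ik.2 ω.1 l = e := by
    rintro ⟨e, he⟩
    obtain ⟨i, k, h⟩ := (Finset.mem_filter.1 he).2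
    exact ⟨(i, k), h⟩
  choose g hg1 hg2 hg3 using hex
  let Ms : Finset (Fin n × ℕ) := Finset.univ.image g
  have hMs : ∀ ik ∈ Ms, τ ≤ A.plan.launch ik.1 ik.2 ω.1 ∧
      A.plan.Delivered ω.1 ik.1 ik.2 j (τ + w) := by
    intro ik hik
    obtain ⟨e, -, rfl⟩ := Finset.mem_image.1 hik
    exact ⟨hg1 e, hg2 e⟩
  have hcard : C.card ≤ ∑ ik ∈ Ms, A.plan.size ik.1 ik.2 := by
    have hsub : C ⊆ Ms.biUnion fun ik => Finset.univ.image (A.plan.index ik.1 ik.2 ω.1) := by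
      intro e he
      obtain ⟨l, hl⟩ := hg3 ⟨e, he⟩
      exact Finset.mem_biUnion.2 ⟨g ⟨e, he⟩, Finset.mem_image_of_mem _ (Finset.mem_univ _),
        Finset.mem_image.2 ⟨l, Finset.mem_univ _, hl⟩⟩
    refine (Finset.card_le_card hsub).trans (Finset.card_biUnion_le.trans
      (Finset.sum_le_sum fun ik _ => ?_))
    exact Finset.card_image_le.trans (by simp)
  refine hcard.trans (Nat.le_floor ?_)
  push_cast
  calc ∑ ik ∈ Ms, (A.plan.size ik.1 ik.2 : ℝ)
      ≤ ∑ ik ∈ Ms, ∑ u, (A.plan.flow ik.1 ik.2 ω.1 u j (τ + w) - A.plan.flow ik.1 ik.2 ω.1 u j τ) := by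
        refine Finset.sum_le_sum fun ik hik => ?_
        obtain ⟨hl, hd⟩ := hMs ik hik
        simp only [A.plan.flow_launch _ _ _ _ _ _ hl, sub_zero]
        exact hd.2
    _ = ∑ u, ∑ ik ∈ Ms, (A.plan.flow ik.1 ik.2 ω.1 u j (τ + w) -
          A.plan.flow ik.1 ik.2 ω.1 u j τ) := Finset.sum_comm
    _ ≤ ∑ u, N.cap u j * w := by
        refine Finset.sum_le_sum fun u _ => ?_
        have := A.plan.flow_cap Ms ω.1 u j τ (τ + w) (by linarith)
        rwa [add_sub_cancel_left] at this
    _ ≤ p * b * w := by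
        rw [← Finset.sum_mul]
        exact mul_le_mul_of_nonneg_right (N.sum_cap_le hb hdeg hbw j) hw

section Probability

variable (A) (a s q : ℝ) (h0 : 0 < q) (h1 : q ≤ 1) (T w : ℝ) (m W : ℕ)

/-- The distribution of all Bernoulli variables. -/
noncomputable def coinMeasure (n M K : ℕ) (q : ℝ) : Measure (Fin n × ℕ → Fin M × Fin K → Bool) :=
  Measure.infinitePi fun _ => coinsLaw M K q

theorem isProbabilityMeasure_coinMeasure {q : ℝ} (h0 : 0 < q) (h1 : q ≤ 1) :
    IsProbabilityMeasure (coinMeasure n M K q) := by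
  have := isProbabilityMeasure_coinsLaw (M := M) (K := K) h0 h1
  unfold coinMeasure; infer_instance

/-- Worker `j` has received or drawn the first `l` coordinates of block `m + 1`. -/
def Partial (c : Fin M × Fin K ↪ Fin d) (j : Fin n) (l : ℕ) (ω : A.CoinOutcome M K) : Prop :=
  ∀ i : Fin M × Fin K, (i.1 : ℕ) = m + 1 → (i.2 : ℕ) < l →
    A.Received c a s q h0 h1 T w m ω j (c i) ∨ A.Drawn c a s q h0 h1 T m W ω j i

theorem measurableSet_partial (hK : 0 < K) {m : ℕ} (hm : m < M) (c : Fin M × Fin K ↪ Fin d)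
    (j : Fin n) (l : ℕ) : MeasurableSet {ω | A.Partial a s q h0 h1 T w m W c j l ω} := by
  unfold Partial
  simp only [Set.ofPred_forall, Set.ofPred_or]
  exact MeasurableSet.iInter fun i => MeasurableSet.iInter fun _ => MeasurableSet.iInter fun _ =>
    (measurableSet_received A c a s q h0 h1 hK hm T w j _).union
      (measurableSet_drawn A c a s q h0 h1 hK hm T W j i)

/-- A coordinate of the next block is drawn with probability at most `W q`, independently of the other
coordinates. -/
theorem measure_partial_inter_drawn_le (hK : 0 < K) {m : ℕ} (hm : m < M)
    (c : Fin M × Fin K ↪ Fin d) (j : Fin n) (z : A.Z) (i : Fin M × Fin K)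
    (hi : (i.1 : ℕ) = m + 1) :
    coinMeasure n M K q {ξ | A.Partial a s q h0 h1 T w m W c j i.2 (z, ξ) ∧
      A.Drawn c a s q h0 h1 T m W (z, ξ) j i} ≤
    W * ENNReal.ofReal q * coinMeasure n M K q {ξ | A.Partial a s q h0 h1 T w m W c j i.2 (z, ξ)} := by
  set ν := coinMeasure n M K q with hν
  set E := {ξ | A.Partial a s q h0 h1 T w m W c j i.2 (z, ξ)} with hE
  let F : ℕ → Set (Fin n × ℕ → Fin M × Fin K → Bool) := fun b =>
    {ξ | A.FirstDraw c a s q h0 h1 T m (z, ξ) j b}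
  have hEm : MeasurableSet E :=
    measurable_prodMk_left (measurableSet_partial A a s q h0 h1 T w W hK hm c j i.2)
  have hFm : ∀ b, MeasurableSet (F b) := fun b =>
    measurable_prodMk_left (measurableSet_firstDraw A c a s q h0 h1 hK hm T j b)
  have hFd : Pairwise (Function.onFun Disjoint fun b => E ∩ F b) := by
    intro b b' hne
    refine Set.disjoint_left.2 fun ξ h h' => ?_
    rcases lt_or_gt_of_ne hne with hlt | hlt
    · exact absurd (h'.2.2 b hlt) (not_lt.2 h.2.1)
    · exact absurd (h.2.2 b' hlt) (not_lt.2 h'.2.1)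
  have hsub : {ξ | A.Partial a s q h0 h1 T w m W c j i.2 (z, ξ) ∧
      A.Drawn c a s q h0 h1 T m W (z, ξ) j i} ⊆
      ⋃ b, ⋃ k ∈ Finset.range W, (E ∩ F b) ∩ {ξ | ξ (j, b + k) i = true} := by
    rintro ξ ⟨hp, b, hb, k, hk, hbit⟩
    simp only [Set.mem_iUnion]
    exact ⟨b, k, Finset.mem_range.2 hk, ⟨hp, hb⟩, hbit⟩
  have hcoin : ∀ b k, ν ((E ∩ F b) ∩ {ξ | ξ (j, b + k) i = true}) =
      ν (E ∩ F b) * ENNReal.ofReal q := by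
    intro b k
    refine infinitePi_inter_coin h0 h1 (j, b + k) i (hEm.inter (hFm b)) fun ξ ξ' h => ?_
    have hlow : ∀ p i', ((i'.1 : ℕ) ≤ m ∨ (i'.2 : ℕ) < i.2) → ξ p i' = ξ' p i' := by
      intro p i' hi'
      refine h p i' ?_
      rintro ⟨-, rfl⟩
      omega
    refine and_congr ?_ (firstDraw_congr (ω := (z, ξ)) (ω' := (z, ξ')) (fun _ _ => rfl) rfl (fun p i' hi' => hlow p i' (Or.inl hi'))
      T j b)
    refine forall_congr' fun i' => imp_congr_right fun _ => imp_congr_right fun hlt => or_congr ?_ ?_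
    · exact received_congr (ω := (z, ξ)) (ω' := (z, ξ')) (fun _ _ => rfl) rfl (fun p i' hi' => hlow p i' (Or.inl hi')) T w j _
    · exact drawn_congr (ω := (z, ξ)) (ω' := (z, ξ')) (fun _ _ => rfl) rfl (fun p i' hi' => hlow p i' (Or.inl hi')) T W j
        (fun p => hlow p i' (Or.inr hlt))
  calc ν _ ≤ ν (⋃ b, ⋃ k ∈ Finset.range W, (E ∩ F b) ∩ {ξ | ξ (j, b + k) i = true}) :=
        measure_mono hsub
    _ ≤ ∑' b, ∑ k ∈ Finset.range W, ν ((E ∩ F b) ∩ {ξ | ξ (j, b + k) i = true}) :=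
        (measure_iUnion_le _).trans (ENNReal.tsum_le_tsum fun b => measure_biUnion_finset_le _ _)
    _ = ∑' b, W * ENNReal.ofReal q * ν (E ∩ F b) := by
        refine tsum_congr fun b => ?_
        simp only [hcoin, Finset.sum_const, Finset.card_range, nsmul_eq_mul]
        ring
    _ = W * ENNReal.ofReal q * ν (⋃ b, E ∩ F b) := by
        rw [ENNReal.tsum_mul_left, measure_iUnion hFd fun b => hEm.inter (hFm b)]
    _ ≤ _ := by
        gcongr
        exact Set.iUnion_subset fun b => Set.inter_subset_left

open Classical in
/-- Averaged over the positions, a coordinate of the next block is among the received ones with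
probability at most the number of received coordinates over the number of free positions, independently
of the other coordinates. -/
theorem sum_measure_partial_inter_received_le (hK : 0 < K) {m : ℕ} (hm : m < M)
    (pos : Fin M × Fin K ↪ Fin d) (j : Fin n) (z : A.Z) (i : Fin M × Fin K)
    (hi : (i.1 : ℕ) = m + 1) {R : ℕ}
    (hR : ∀ (c : Fin M × Fin K ↪ Fin d) (ω : A.CoinOutcome M K),
      (Finset.univ.filter fun e => A.Received c a s q h0 h1 T w m ω j e).card ≤ R) :
    ((d - M * K : ℕ) : ℝ≥0∞) * ∑ π : Equiv.Perm (Fin d), coinMeasure n M K q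
      {ξ | A.Partial a s q h0 h1 T w m W (pos.trans π.toEmbedding) j i.2 (z, ξ) ∧
        A.Received (pos.trans π.toEmbedding) a s q h0 h1 T w m (z, ξ) j (π (pos i))} ≤
    R * ∑ π : Equiv.Perm (Fin d), coinMeasure n M K q
      {ξ | A.Partial a s q h0 h1 T w m W (pos.trans π.toEmbedding) j i.2 (z, ξ)} := by
  set ν := coinMeasure n M K q with hν
  have hpm : ∀ π : Equiv.Perm (Fin d), MeasurableSet
      {ξ | A.Partial a s q h0 h1 T w m W (pos.trans π.toEmbedding) j i.2 (z, ξ)} := fun π =>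
    measurable_prodMk_left (measurableSet_partial A a s q h0 h1 T w W hK hm _ j i.2)
  have hrm : ∀ π : Equiv.Perm (Fin d), MeasurableSet {ξ |
      A.Received (pos.trans π.toEmbedding) a s q h0 h1 T w m (z, ξ) j (π (pos i))} := fun π =>
    measurable_prodMk_left (measurableSet_received A _ a s q h0 h1 hK hm T w j _)
  have hprm : ∀ π : Equiv.Perm (Fin d), MeasurableSet
      {ξ | A.Partial a s q h0 h1 T w m W (pos.trans π.toEmbedding) j i.2 (z, ξ) ∧
        A.Received (pos.trans π.toEmbedding) a s q h0 h1 T w m (z, ξ) j (π (pos i))} := fun π =>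
    (hpm π).inter (hrm π)
  simp only [← lintegral_indicator_one (hpm _), ← lintegral_indicator_one (hprm _)]
  rw [← lintegral_finsetSum _ fun π _ => measurable_one.indicator (hpm π),
    ← lintegral_finsetSum _ fun π _ => measurable_one.indicator (hprm π),
    ← lintegral_const_mul' _ _ (ENNReal.natCast_ne_top _),
    ← lintegral_const_mul' _ _ (ENNReal.natCast_ne_top _)]
  refine lintegral_mono fun ξ => ?_
  -- Exchanging the position of coordinate `i` with a free one affects none of the other conditions.
  let U : Finset (Fin d) := Finset.univ \ Finset.univ.map pos
  have hU : U.card = d - M * K := by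
    rw [Finset.card_sdiff_of_subset (Finset.subset_univ _)]
    simp
  have hfix : ∀ (π : Equiv.Perm (Fin d)), ∀ u ∈ U, ∀ i', i' ≠ i →
      (pos.trans (π * Equiv.swap (pos i) u).toEmbedding) i' = (pos.trans π.toEmbedding) i' := by
    intro π u hu i' hne
    have h1 : pos i' ≠ pos i := fun h => hne (pos.injective h)
    have h2 : pos i' ≠ u := by
      rintro rfl
      simp [U] at hu
    simp [Equiv.swap_apply_of_ne_of_ne h1 h2]
  have hlow : ∀ (π : Equiv.Perm (Fin d)), ∀ u ∈ U, ∀ i', (i'.1 : ℕ) ≤ m →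
      (pos.trans (π * Equiv.swap (pos i) u).toEmbedding) i' = (pos.trans π.toEmbedding) i' := by
    intro π u hu i' hi'
    refine hfix π u hu i' ?_
    rintro rfl
    omega
  have key := card_perm_mem_le (pos i) U
    (fun π => A.Partial a s q h0 h1 T w m W (pos.trans π.toEmbedding) j i.2 (z, ξ))
    (fun π => Finset.univ.filter fun e =>
      A.Received (pos.trans π.toEmbedding) a s q h0 h1 T w m (z, ξ) j e)
    (fun π u hu => by
      refine forall_congr' fun i' => imp_congr_right fun _ => imp_congr_right fun hlt => or_congr ?_ ?_
      · rw [hfix π u hu i' (by rintro rfl; omega)]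
        exact received_congr (hlow π u hu) rfl (fun _ _ _ => rfl) T w j _
      · exact drawn_congr (hlow π u hu) rfl (fun _ _ _ => rfl) T W j (fun _ => rfl))
    (fun π u hu => by
      refine Finset.filter_congr fun e _ => ?_
      exact received_congr (hlow π u hu) rfl (fun _ _ _ => rfl) T w j e)
    (fun π => hR _ _)
  rw [hU] at key
  have key' : ((d - M * K : ℕ) : ℝ≥0∞) * (Finset.univ.filter fun π : Equiv.Perm (Fin d) =>
      A.Partial a s q h0 h1 T w m W (pos.trans π.toEmbedding) j i.2 (z, ξ) ∧
      A.Received (pos.trans π.toEmbedding) a s q h0 h1 T w m (z, ξ) j (π (pos i))).card ≤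
      R * (Finset.univ.filter fun π : Equiv.Perm (Fin d) =>
      A.Partial a s q h0 h1 T w m W (pos.trans π.toEmbedding) j i.2 (z, ξ)).card := by
    simp only [Finset.mem_filter, Finset.mem_univ, true_and] at key
    exact_mod_cast key
  simpa only [Finset.card_filter, Nat.cast_sum, Nat.cast_ite, Nat.cast_one, Nat.cast_zero,
    Set.indicator_apply, Set.mem_ofPred_eq, Pi.one_apply] using key'

end Probability
end Algorithm

/-! ### Slow progress on the hard objective -/

namespace Algorithm

variable {n d M K : ℕ} {N : Network n}

section FastProgress

variable (A : Algorithm N d) (a s q : ℝ) (h0 : 0 < q) (h1 : q ≤ 1) (T w : ℝ) (W : ℕ)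

open Classical in
/-- Averaged over the positions, a given worker receives or draws the first `l` coordinates of the
next block with a probability that decays exponentially in `l`. -/
theorem sum_measure_partial_le (hK : 0 < K) {m : ℕ} (hm : m + 1 < M) (hd : M * K < d)
    (pos : Fin M × Fin K ↪ Fin d) (j : Fin n) (z : A.Z) {R : ℕ}
    (hR : ∀ (c : Fin M × Fin K ↪ Fin d) (ω : A.CoinOutcome M K),
      (Finset.univ.filter fun e => A.Received c a s q h0 h1 T w m ω j e).card ≤ R)
    (l : ℕ) (hl : l ≤ K) :
    ∑ π : Equiv.Perm (Fin d), coinMeasure n M K q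
      {ξ | A.Partial a s q h0 h1 T w m W (pos.trans π.toEmbedding) j l (z, ξ)} ≤
    ((R : ℝ≥0∞) / (d - M * K : ℕ) + W * ENNReal.ofReal q) ^ l *
      Fintype.card (Equiv.Perm (Fin d)) := by
  have := isProbabilityMeasure_coinMeasure (n := n) (M := M) (K := K) h0 h1
  have hm' : m < M := by omega
  induction l with
  | zero =>
    rw [pow_zero, one_mul]
    refine (Finset.sum_le_card_nsmul _ _ 1 fun π _ => prob_le_one).trans ?_
    simp
  | succ l ih =>
    have ih := ih (by omega)
    let i : Fin M × Fin K := (⟨m + 1, hm⟩, ⟨l, by omega⟩)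
    set S := ∑ π : Equiv.Perm (Fin d), coinMeasure n M K q
      {ξ | A.Partial a s q h0 h1 T w m W (pos.trans π.toEmbedding) j l (z, ξ)} with hS
    have hUne : ((d - M * K : ℕ) : ℝ≥0∞) ≠ 0 := by
      rw [Nat.cast_ne_zero]; omega
    have e1 := sum_measure_partial_inter_received_le A a s q h0 h1 T w W hK hm' pos j z i rfl hR
    have e1' : ∑ π : Equiv.Perm (Fin d), coinMeasure n M K q
        {ξ | A.Partial a s q h0 h1 T w m W (pos.trans π.toEmbedding) j l (z, ξ) ∧
          A.Received (pos.trans π.toEmbedding) a s q h0 h1 T w m (z, ξ) j (π (pos i))} ≤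
        (R : ℝ≥0∞) / (d - M * K : ℕ) * S := by
      rw [← ENNReal.mul_div_right_comm, ENNReal.le_div_iff_mul_le (Or.inl hUne)
        (Or.inl (ENNReal.natCast_ne_top _)), mul_comm]
      exact e1
    have e2 : ∑ π : Equiv.Perm (Fin d), coinMeasure n M K q
        {ξ | A.Partial a s q h0 h1 T w m W (pos.trans π.toEmbedding) j l (z, ξ) ∧
          A.Drawn (pos.trans π.toEmbedding) a s q h0 h1 T m W (z, ξ) j i} ≤
        W * ENNReal.ofReal q * S := by
      rw [hS, Finset.mul_sum]
      exact Finset.sum_le_sum fun π _ =>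
        measure_partial_inter_drawn_le A a s q h0 h1 T w W hK hm' _ j z i rfl
    calc ∑ π : Equiv.Perm (Fin d), coinMeasure n M K q
          {ξ | A.Partial a s q h0 h1 T w m W (pos.trans π.toEmbedding) j (l + 1) (z, ξ)}
        ≤ ∑ π : Equiv.Perm (Fin d), (coinMeasure n M K q
          {ξ | A.Partial a s q h0 h1 T w m W (pos.trans π.toEmbedding) j l (z, ξ) ∧
            A.Received (pos.trans π.toEmbedding) a s q h0 h1 T w m (z, ξ) j (π (pos i))} +
          coinMeasure n M K q
          {ξ | A.Partial a s q h0 h1 T w m W (pos.trans π.toEmbedding) j l (z, ξ) ∧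
            A.Drawn (pos.trans π.toEmbedding) a s q h0 h1 T m W (z, ξ) j i}) := by
          refine Finset.sum_le_sum fun π _ => (measure_mono ?_).trans (measure_union_le _ _)
          intro ξ hξ
          have hp : A.Partial a s q h0 h1 T w m W (pos.trans π.toEmbedding) j l (z, ξ) :=
            fun i' hi' hlt => hξ i' hi' (by omega)
          rcases hξ i rfl (Nat.lt_succ_self l) with h | h
          · exact Or.inl ⟨hp, h⟩
          · exact Or.inr ⟨hp, h⟩
      _ ≤ ((R : ℝ≥0∞) / (d - M * K : ℕ) + W * ENNReal.ofReal q) * S := by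
          rw [Finset.sum_add_distrib, add_mul]
          exact add_le_add e1' e2
      _ ≤ _ := by
          rw [pow_succ', mul_assoc]
          gcongr

/-- A necessary condition for the completion of block `m + 1` within time `w` after block `m`. -/
def Fast (c : Fin M × Fin K ↪ Fin d) (m : ℕ) (ω : A.CoinOutcome M K) : Prop :=
  (∃ j, A.Partial a s q h0 h1 T w m W c j K ω) ∧
  ∀ i : Fin M × Fin K, (i.1 : ℕ) = m + 1 → ∃ j, A.Drawn c a s q h0 h1 T m W ω j i

theorem measurableSet_fast (hK : 0 < K) {m : ℕ} (hm : m < M) (c : Fin M × Fin K ↪ Fin d) :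
    MeasurableSet {ω | A.Fast a s q h0 h1 T w W c m ω} := by
  unfold Fast
  simp only [Set.ofPred_and, Set.ofPred_exists, Set.ofPred_forall]
  exact (MeasurableSet.iUnion fun j => measurableSet_partial A a s q h0 h1 T w W hK hm c j K).inter
    (MeasurableSet.iInter fun i => MeasurableSet.iInter fun _ => MeasurableSet.iUnion fun j =>
      measurableSet_drawn A c a s q h0 h1 hK hm T W j i)

open Classical in
/-- The probability of fast progress, averaged over the positions. The first alternative in `hδ` counts
the workers that collect a whole block; the second one only counts the draws of the first coordinate
of the block, which has to be drawn by somebody. -/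
theorem sum_measure_fast_le (hK : 0 < K) {m : ℕ} (hm : m + 1 < M) (hd : M * K < d)
    (pos : Fin M × Fin K ↪ Fin d) {R : ℕ}
    (hR : ∀ (c : Fin M × Fin K ↪ Fin d) (ω : A.CoinOutcome M K) (j : Fin n),
      (Finset.univ.filter fun e => A.Received c a s q h0 h1 T w m ω j e).card ≤ R) {δ : ℝ≥0∞}
    (hδ : (n : ℝ≥0∞) * ((R : ℝ≥0∞) / (d - M * K : ℕ) + W * ENNReal.ofReal q) ^ K ≤ δ ∨
      (n : ℝ≥0∞) * (W * ENNReal.ofReal q) ≤ δ) :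
    ∑ π : Equiv.Perm (Fin d), A.seed.prod (coinMeasure n M K q)
      {ω | A.Fast a s q h0 h1 T w W (pos.trans π.toEmbedding) m ω} ≤
    Fintype.card (Equiv.Perm (Fin d)) * δ := by
  have := isProbabilityMeasure_coinMeasure (n := n) (M := M) (K := K) h0 h1
  have hm' : m < M := by omega
  have hfm : ∀ π : Equiv.Perm (Fin d), MeasurableSet
      {ω | A.Fast a s q h0 h1 T w W (pos.trans π.toEmbedding) m ω} := fun π =>
    measurableSet_fast A a s q h0 h1 T w W hK hm' _
  simp only [Measure.prod_apply (hfm _)]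
  rw [← lintegral_finsetSum _ fun π _ => measurable_measure_prodMk_left (hfm π)]
  have hz : ∀ z : A.Z, ∑ π : Equiv.Perm (Fin d), coinMeasure n M K q (Prod.mk z ⁻¹'
      {ω | A.Fast a s q h0 h1 T w W (pos.trans π.toEmbedding) m ω}) ≤
      Fintype.card (Equiv.Perm (Fin d)) * δ := by
    intro z
    rcases hδ with hδ | hδ
    · calc ∑ π : Equiv.Perm (Fin d), coinMeasure n M K q (Prod.mk z ⁻¹'
            {ω | A.Fast a s q h0 h1 T w W (pos.trans π.toEmbedding) m ω})
          ≤ ∑ π : Equiv.Perm (Fin d), ∑ j : Fin n, coinMeasure n M K q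
            {ξ | A.Partial a s q h0 h1 T w m W (pos.trans π.toEmbedding) j K (z, ξ)} := by
            refine Finset.sum_le_sum fun π _ => (measure_mono ?_).trans
              (measure_iUnion_fintype_le _ _)
            rintro ξ ⟨⟨j, hj⟩, -⟩
            exact Set.mem_iUnion.2 ⟨j, hj⟩
        _ ≤ ∑ j : Fin n, ((R : ℝ≥0∞) / (d - M * K : ℕ) + W * ENNReal.ofReal q) ^ K *
              Fintype.card (Equiv.Perm (Fin d)) := by
            rw [Finset.sum_comm]
            exact Finset.sum_le_sum fun j _ => sum_measure_partial_le A a s q h0 h1 T w W hK hm hd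
              pos j z (fun c ω => hR c ω j) K le_rfl
        _ ≤ _ := by
            rw [Finset.sum_const, Finset.card_univ, Fintype.card_fin, nsmul_eq_mul, ← mul_assoc,
              mul_comm]
            gcongr
    · rw [← nsmul_eq_mul]
      refine Finset.sum_le_card_nsmul _ _ _ fun π _ => ?_
      let i : Fin M × Fin K := (⟨m + 1, hm⟩, ⟨0, hK⟩)
      refine le_trans ((measure_mono (t := ⋃ j : Fin n,
        {ξ | A.Partial a s q h0 h1 T w m W (pos.trans π.toEmbedding) j i.2 (z, ξ) ∧
        A.Drawn (pos.trans π.toEmbedding) a s q h0 h1 T m W (z, ξ) j i}) ?_).trans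
        (measure_iUnion_fintype_le _ _)) (le_trans ?_ hδ)
      · rintro ξ ⟨-, hξ⟩
        obtain ⟨j, hj⟩ := hξ i rfl
        exact Set.mem_iUnion.2 ⟨j, fun i' _ hlt => absurd hlt (Nat.not_lt_zero _), hj⟩
      · rw [← nsmul_eq_mul]
        refine (Finset.sum_le_card_nsmul _ _ (W * ENNReal.ofReal q) fun j _ => ?_).trans (by simp)
        refine (measure_partial_inter_drawn_le A a s q h0 h1 T w W hK hm' _ j z i rfl).trans ?_
        exact mul_le_of_le_one_right' prob_le_one
  refine (lintegral_mono hz).trans ?_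
  simp

/-- The blocks are completed in their order. -/
theorem completed_pred {a s q : ℝ} {h0 : 0 < q} {h1 : q ≤ 1} (hK : 0 < K)
    {c : Fin M × Fin K ↪ Fin d} {m : ℕ} (hm : m + 1 < M)
    {ω : A.CoinOutcome M K} {t : ℝ}
    (h : A.Completed c (hardProblem n c a s q h0 h1) ω (m + 1) t) :
    A.Completed c (hardProblem n c a s q h0 h1) ω m t := by
  by_contra hne
  obtain ⟨j, hj⟩ := h
  exact confined_of_not_completed ω m t hne j (⟨m + 1, hm⟩, ⟨0, hK⟩) (Nat.lt_succ_self m) (hj _ rfl)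

open Classical in
/-- The completion of block `m` takes time `w` for every previous block without fast progress. -/
theorem le_of_completed {a s q : ℝ} {h0 : 0 < q} {h1 : q ≤ 1} {T w h : ℝ} (hK : 0 < K)
    {c : Fin M × Fin K ↪ Fin d} (hh : 0 < h) (htime : ∀ i, N.time i = h) (hw : 0 ≤ w)
    {ω : A.CoinOutcome M K} (m : ℕ) (hm : m < M) (t : ℝ) (ht : t ≤ T)
    (hc : A.Completed c (hardProblem n c a s q h0 h1) ω m t) :
    w * ((Finset.range m).filter fun k =>
      ¬ A.Fast a s q h0 h1 T w ⌊w / h⌋₊ c k ω).card ≤ t := by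
  induction m generalizing t with
  | zero =>
    simp only [Finset.range_zero, Finset.filter_empty, Finset.card_empty, Nat.cast_zero, mul_zero]
    exact not_lt.1 fun hlt => not_completed_of_neg hK hm hlt hc
  | succ m ih =>
    rw [Finset.range_add_one, Finset.filter_insert]
    split_ifs with hf
    · exact ih (by omega) t ht (completed_pred A hK hm hc)
    · rw [Finset.card_insert_of_notMem (by simp)]
      push_cast
      have hp : A.Completed c (hardProblem n c a s q h0 h1) ω m (t - w) := by
        by_contra hne
        obtain ⟨⟨j, hj⟩, h2⟩ := received_or_drawn hK hm hh htime hw ht hc hne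
        exact hf ⟨⟨j, fun i hi _ => hj i hi⟩, h2⟩
      have := ih (by omega) (t - w) (by linarith) hp
      linarith

end FastProgress

end Algorithm

open Classical in
/-- If fast progress has a small probability, then for every algorithm there are positions of the
coordinates of the hard objective for which at least half of the `M - 1` steps from one block to the
next take time `w`, with probability at least `3 / 4`. -/
theorem ofReal_le_optimalTime {n d M K p : ℕ} {N : Network n} {h b a s q L Δ σ ε w : ℝ}
    (hn : 0 < n) (hh : 0 < h) (hb : 0 ≤ b) (htime : ∀ i, N.time i = h)
    (hdeg : ∀ v, (N.graph.neighborSet v).ncard ≤ p) (hbw : ∀ u v, N.graph.Adj u v → N.bw u v = b)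
    (hK : 0 < K) (hM : 2 ≤ M) (hd : M * K < d) (h0 : 0 < q) (h1 : q ≤ 1) (ha : 0 ≤ a) (hs : 0 < s)
    (hL : 800 * K ^ 2 * a / s ^ 2 ≤ L) (hΔ : a * (2 * K * M) ≤ Δ)
    (hσ : (a / s) ^ 2 * K * (1 / q - 1) ≤ σ ^ 2) (hε : 0 < ε) (has : (a / s) ^ 2 = 2 * ε)
    (hw : 0 < w)
    (hδ : (n : ℝ≥0∞) * ((⌊p * b * w⌋₊ : ℝ≥0∞) / (d - M * K : ℕ) +
        ⌊w / h⌋₊ * ENNReal.ofReal q) ^ K ≤ 1 / 8 ∨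
      (n : ℝ≥0∞) * (⌊w / h⌋₊ * ENNReal.ofReal q) ≤ 1 / 8) (S : Setting) :
    ENNReal.ofReal (w * (M - 1) / 2) ≤ optimalTime N (problemClass (d := d) L Δ σ S) ε := by
  refine le_iInf fun A => ?_
  set T : ℝ := w * (M - 1) / 2 with hT
  have hpm := Algorithm.isProbabilityMeasure_coinMeasure (n := n) (M := M) (K := K) h0 h1
  let pos : Fin M × Fin K ↪ Fin d :=
    (finProdFinEquiv.toEmbedding.trans (Fin.castLEEmb hd.le))
  set μ := A.seed.prod (Algorithm.coinMeasure n M K q) with hμ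
  let Bad : Equiv.Perm (Fin d) → ℕ → Set (A.CoinOutcome M K) := fun π m =>
    {ω | A.Fast a s q h0 h1 T w ⌊w / h⌋₊ (pos.trans π.toEmbedding) m ω}
  have hbad : ∀ m ∈ Finset.range (M - 1), ∑ π, μ (Bad π m) ≤
      Fintype.card (Equiv.Perm (Fin d)) * (1 / 8) := by
    intro m hm
    rw [Finset.mem_range] at hm
    exact Algorithm.sum_measure_fast_le A a s q h0 h1 T w _ hK (by omega) hd pos
      (fun c ω j => Algorithm.card_received_le hb hw.le hdeg hbw c a s q h0 h1 T m ω j) hδ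
  -- Some position of the coordinates is at least as bad as the average.
  obtain ⟨π, -, hπ⟩ : ∃ π ∈ (Finset.univ : Finset (Equiv.Perm (Fin d))),
      ∑ m ∈ Finset.range (M - 1), μ (Bad π m) ≤ (M - 1 : ℕ) * (1 / 8) := by
    by_contra! hall
    refine absurd (ENNReal.sum_lt_sum_of_nonempty Finset.univ_nonempty hall) (not_lt.2 ?_)
    rw [Finset.sum_comm]
    refine (Finset.sum_le_sum hbad).trans (le_of_eq ?_)
    simp only [Finset.sum_const, Finset.card_range, Finset.card_univ, nsmul_eq_mul]
    ring
  set c := pos.trans π.toEmbedding with hc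
  set P := hardProblem n c a s q h0 h1 with hP
  have hhom : P.Homogeneous L Δ σ := homogeneous_hardProblem hn c h0 h1 ha hs hL hΔ hσ
  have hmem : P ∈ problemClass (d := d) L Δ σ S := by
    cases S
    · exact hhom
    · exact hhom.toHeterogeneous
  refine le_iSup₂_of_le P hmem (le_iInf₂ fun t ht => ?_)
  by_contra hlt
  push Not at hlt
  have htT : (t : ℝ) ≤ T := by
    rw [ENNReal.lt_ofReal_iff_toReal_lt ENNReal.coe_ne_top] at hlt
    exact hlt.le
  refine absurd ht (not_le.2 ?_)
  have hbm : ∀ m ∈ Finset.range (M - 1), MeasurableSet (Bad π m) := fun m hm =>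
    Algorithm.measurableSet_fast A a s q h0 h1 T w _ hK
      (by rw [Finset.mem_range] at hm; omega) c
  -- By Markov's inequality, half of the blocks or more are fast with probability at most `1 / 4`.
  let cnt : A.CoinOutcome M K → ℝ≥0∞ := fun ω =>
    ∑ m ∈ Finset.range (M - 1), (Bad π m).indicator 1 ω
  have hcnt : Measurable cnt := Finset.measurable_sum _ fun m hm =>
    measurable_one.indicator (hbm m hm)
  have hint : ∫⁻ ω, cnt ω ∂μ ≤ (M - 1 : ℕ) * (1 / 8) := by
    rw [lintegral_finsetSum _ fun m hm => measurable_one.indicator (hbm m hm)]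
    refine (Finset.sum_le_sum fun m hm => ?_).trans hπ
    rw [lintegral_indicator_one (hbm m hm)]
  set V : Set (A.CoinOutcome M K) := {ω | ((M - 1 : ℕ) : ℝ≥0∞) / 2 ≤ cnt ω} with hV
  have hVm : MeasurableSet V := measurableSet_le measurable_const hcnt
  have hM1 : ((M - 1 : ℕ) : ℝ≥0∞) ≠ 0 := by rw [Nat.cast_ne_zero]; omega
  have hM2 : ((M - 1 : ℕ) : ℝ≥0∞) ≠ ⊤ := ENNReal.natCast_ne_top _
  have hVle : μ V ≤ 1 / 4 := by
    have h1 := (mul_meas_ge_le_lintegral hcnt (((M - 1 : ℕ) : ℝ≥0∞) / 2) (μ := μ)).trans hint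
    have h2 : (((M - 1 : ℕ) : ℝ≥0∞) / 2) * μ V ≤ (((M - 1 : ℕ) : ℝ≥0∞) / 2) * (1 / 4) := by
      refine h1.trans (le_of_eq ?_)
      rw [div_eq_mul_inv, div_eq_mul_inv, mul_assoc, one_div, one_mul,
        ← ENNReal.mul_inv (by simp) (by simp)]
      norm_num
    exact (ENNReal.mul_le_mul_iff_right (ENNReal.div_pos hM1 (by simp)).ne' (ENNReal.div_ne_top hM2 (by simp))).1 h2
  -- Otherwise the last block is not reached by time `t`, hence every reachable point has a coordinate
  -- with a large partial derivative. Since `3 / 4 * (2 * ε) > ε`, time `t` does not suffice.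
  have hgood : ∀ ω ∉ V, ENNReal.ofReal (2 * ε) ≤
      ⨅ y ∈ A.reachable P ω t, ENNReal.ofReal (‖gradient P.objective y‖ ^ 2) := by
    intro ω hω
    refine le_iInf₂ fun y hy => ENNReal.ofReal_le_ofReal ?_
    obtain ⟨j, hj⟩ := hy
    have hnc : ¬ A.Completed c P ω (M - 1) t := by
      intro hcomp
      have hle := Algorithm.le_of_completed A (w := w) hK hh htime hw.le (M - 1) (by omega) t htT hcomp
      have hcard := Finset.card_filter_add_card_filter_not (s := Finset.range (M - 1))
        fun k => A.Fast a s q h0 h1 T w ⌊w / h⌋₊ c k ω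
      rw [Finset.card_range] at hcard
      have hcntω : cnt ω = (((Finset.range (M - 1)).filter fun k =>
          A.Fast a s q h0 h1 T w ⌊w / h⌋₊ c k ω).card : ℝ≥0∞) := by
        simp only [cnt, Finset.card_filter, Nat.cast_sum, Nat.cast_ite, Nat.cast_one, Nat.cast_zero,
          Set.indicator_apply, Pi.one_apply]
        rfl
      set x := ((Finset.range (M - 1)).filter fun k =>
          A.Fast a s q h0 h1 T w ⌊w / h⌋₊ c k ω).card
      simp only [hV, Set.mem_ofPred_eq, not_le, hcntω] at hω
      have hx : (x : ℝ) * 2 < (M - 1 : ℕ) := by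
        rw [ENNReal.lt_div_iff_mul_lt (by simp) (by simp)] at hω
        exact_mod_cast hω
      have hcard' : ((((Finset.range (M - 1)).filter fun k =>
          ¬ A.Fast a s q h0 h1 T w ⌊w / h⌋₊ c k ω).card : ℕ) : ℝ) = (M - 1 : ℕ) - x := by
        rw [eq_sub_iff_add_eq', ← Nat.cast_add, hcard]
      rw [hcard'] at hle
      have hM' : ((M - 1 : ℕ) : ℝ) = M - 1 := by
        rw [Nat.cast_sub (by omega)]; simp
      rw [hM'] at hle hx
      nlinarith
    unfold Algorithm.Completed Covers at hnc
    push Not at hnc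
    obtain ⟨i, -, hi⟩ := hnc j
    have hyi : y (c i) = 0 := by
      by_contra hne
      exact hi (hj _ hne)
    rw [hP, objective_hardProblem hn, gradient_hardFn, ← has]
    exact le_norm_hardGrad c a s y hyi
  calc ENNReal.ofReal ε < ENNReal.ofReal (2 * ε) * (3 / 4) := by
        rw [show (3 / 4 : ℝ≥0∞) = ENNReal.ofReal (3 / 4) by
          rw [ENNReal.ofReal_div_of_pos (by norm_num)]; norm_num,
          ← ENNReal.ofReal_mul (by linarith)]
        exact (ENNReal.ofReal_lt_ofReal_iff (by linarith)).2 (by linarith)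
    _ ≤ ENNReal.ofReal (2 * ε) * μ Vᶜ := by
        gcongr
        rw [prob_compl_eq_one_sub hVm]
        refine le_trans ?_ (tsub_le_tsub_left hVle 1)
        rw [show (1 : ℝ≥0∞) = ENNReal.ofReal 1 by simp,
          show ENNReal.ofReal 1 / 4 = ENNReal.ofReal (1 / 4) by
            rw [ENNReal.ofReal_div_of_pos (by norm_num)]; norm_num,
          ← ENNReal.ofReal_sub _ (by norm_num),
          show (3 / 4 : ℝ≥0∞) = ENNReal.ofReal (3 / 4) by
            rw [ENNReal.ofReal_div_of_pos (by norm_num)]; norm_num]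
        exact ENNReal.ofReal_le_ofReal (by norm_num)
    _ = ∫⁻ _ω in Vᶜ, ENNReal.ofReal (2 * ε) ∂μ := by simp
    _ ≤ ∫⁻ ω in Vᶜ, ⨅ y ∈ A.reachable P ω t, ENNReal.ofReal (‖gradient P.objective y‖ ^ 2) ∂μ :=
        setLIntegral_mono' hVm.compl fun ω hω => hgood ω hω
    _ ≤ A.expectedBest P t := setLIntegral_le_lintegral _ _

/-! ### Choice of the parameters of the hard objective -/

theorem log_two_le_log_add_one {n : ℕ} (hn : 0 < n) : 0.69 ≤ Real.log (n + 1) := by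
  have h1 : (1 : ℝ) ≤ n := by exact_mod_cast hn
  have := Real.log_le_log (by norm_num) (show (2 : ℝ) ≤ n + 1 by linarith)
  linarith [Real.log_two_gt_d9]

theorem Network.card_pos {n : ℕ} (N : Network n) : 0 < n := by
  obtain ⟨i⟩ := N.connected.nonempty
  exact i.pos

/-- A fast worker is unlikely even after a union bound over the workers. -/
theorem natCast_mul_pow_le {n K : ℕ} (hn : 0 < n) (hK : Real.log (n + 1) ≤ K) {x : ℝ} (h0 : 0 ≤ x)
    (hx : x ≤ Real.exp (-4)) : n * x ^ K ≤ 1 / 8 := by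
  have hn' : (1 : ℝ) ≤ n := by exact_mod_cast hn
  have h1 : x ^ K ≤ ((n + 1 : ℝ) ^ 4)⁻¹ := by
    calc x ^ K ≤ Real.exp (-4) ^ K := pow_le_pow_left₀ h0 hx K
      _ = Real.exp (K * (-4)) := (Real.exp_nat_mul _ _).symm
      _ ≤ Real.exp (-(4 * Real.log (n + 1))) := Real.exp_le_exp.2 (by linarith)
      _ = _ := by
        rw [Real.exp_neg, show (4 : ℝ) * Real.log (n + 1) = (4 : ℕ) * Real.log (n + 1) by norm_num,
          Real.exp_nat_mul, Real.exp_log (by linarith)]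
  calc n * x ^ K ≤ n * ((n + 1 : ℝ) ^ 4)⁻¹ := by gcongr
    _ ≤ 1 / 8 := by
      rw [← div_eq_mul_inv, div_le_div_iff₀ (by positivity) (by norm_num)]
      nlinarith [pow_le_pow_left₀ (by norm_num : (0 : ℝ) ≤ 2) (show (2 : ℝ) ≤ n + 1 by linarith) 3]

theorem ofReal_mul_pow_add {n R U W K : ℕ} (hU : 0 < U) {q : ℝ} (hq : 0 ≤ q) :
    (n : ℝ≥0∞) * ((R : ℝ≥0∞) / U + W * ENNReal.ofReal q) ^ K =
      ENNReal.ofReal (n * (R / U + W * q) ^ K) := by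
  have hU' : (0 : ℝ) < U := by exact_mod_cast hU
  rw [ENNReal.ofReal_mul (by positivity), ENNReal.ofReal_pow (by positivity),
    ENNReal.ofReal_add (by positivity) (by positivity), ENNReal.ofReal_div_of_pos hU',
    ENNReal.ofReal_mul (by positivity)]
  simp only [ENNReal.ofReal_natCast]

theorem sparseRate_eq {n d : ℕ} {h b L Δ σ ε : ℝ} (hb : 0 < b) (hε : 0 < ε) :
    sparseRate n d h b L Δ σ ε =
      d / b * (L * Δ / ε) + h * σ ^ 2 / (n * ε) * (L * Δ / ε) + h * (L * Δ / ε) := by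
  unfold sparseRate
  field_simp

set_option maxHeartbeats 800000 in
/-- For windows of length `w` in which no worker is likely to complete a block, the hard objective
needs about `L Δ / (ε log⁴ n)` windows. -/
theorem ofReal_window_le_optimalTime {n d p : ℕ} {N : Network n} {h b L Δ σ ε : ℝ}
    (hh : 0 < h) (hb : 0 < b) (hL : 0 < L) (hσ : 0 < σ) (hε : 0 < ε)
    (htime : ∀ i, N.time i = h) (hdeg : ∀ v, (N.graph.neighborSet v).ncard ≤ p)
    (hbw : ∀ u v, N.graph.Adj u v → N.bw u v = b)
    (hX : 8000000 * Real.log (n + 1) ^ 10 ≤ L * Δ / ε)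
    (hd : L * Δ / ε ≤ d * Real.log (n + 1) ^ 3) {w : ℝ} (hw : 0 < w)
    (hδ : 2 * p * b * w / d + w / h * (2 * ε * (3 * Real.log (n + 1)) / σ ^ 2) ≤ Real.exp (-4) ∨
      n * (⌊w / h⌋₊ * (2 * ε * ⌈Real.log (n + 1)⌉₊ / σ ^ 2)) ≤ 1 / 8) (S : Setting) :
    ENNReal.ofReal (w * (L * Δ / ε) / (800000 * Real.log (n + 1) ^ 4)) ≤
      optimalTime N (problemClass (d := d) L Δ σ S) ε := by
  have hn := N.card_pos
  have hlam := log_two_le_log_add_one hn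
  set lam := Real.log (n + 1) with hlamdef
  set X := L * Δ / ε with hXdef
  have hlam0 : 0 < lam := by linarith
  set K := ⌈lam⌉₊ with hKdef
  have hK : 0 < K := Nat.ceil_pos.2 hlam0
  have hKlam : lam ≤ K := Nat.le_ceil _
  have hK3 : (K : ℝ) ≤ 3 * lam := by
    have := Nat.ceil_lt_add_one hlam0.le
    linarith
  have hK0 : (0 : ℝ) < K := by exact_mod_cast hK
  have hlam6 : (1 / 10 : ℝ) ≤ lam ^ 6 :=
    le_trans (by norm_num) (pow_le_pow_left₀ (by norm_num) hlam 6)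
  have hX0 : 0 < X := lt_of_lt_of_le (by positivity) hX
  -- The factor `lam ^ 4` leaves room for the three factors `K` in the gap
  -- `3200 * K ^ 3 * M * ε / L` of the hard objective.
  set Y := X / (200000 * lam ^ 4) with hYdef
  have hY : 4 ≤ Y := by
    rw [hYdef, le_div_iff₀ (by positivity)]
    have h10 : lam ^ 10 = lam ^ 6 * lam ^ 4 := by ring
    have h4 := mul_le_mul_of_nonneg_right hlam6 (pow_nonneg hlam0.le 4)
    linarith
  have hXY : X = Y * (200000 * lam ^ 4) := by rw [hYdef]; field_simp
  set M := ⌊Y⌋₊ with hMdef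
  have hMY : (M : ℝ) ≤ Y := Nat.floor_le (by linarith)
  have hYM : Y < M + 1 := Nat.lt_floor_add_one _
  have hM : 4 ≤ M := Nat.le_floor (by exact_mod_cast hY)
  have hMK : (M * K : ℝ) ≤ d / 2 := by
    have h3 : 0 < lam ^ 3 := by positivity
    have h1 : (M * K : ℝ) ≤ Y * (3 * lam) := by gcongr
    have h2 : Y * (3 * lam) * (2 * lam ^ 3) ≤ X := by
      have e1 : Y * (3 * lam) * (2 * lam ^ 3) = 6 * (Y * lam ^ 4) := by ring
      have e2 : X = 200000 * (Y * lam ^ 4) := by rw [hXY]; ring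
      have : 0 < Y * lam ^ 4 := by positivity
      linarith
    have h4 : Y * (3 * lam) * 2 * lam ^ 3 ≤ d * lam ^ 3 := by linarith
    have h5 := le_of_mul_le_mul_right h4 h3
    linarith
  have hd0 : (0 : ℝ) < d := by
    have : (0 : ℝ) < M * K := by
      have : (0 : ℝ) < M := by exact_mod_cast (by omega : 0 < M)
      positivity
    linarith
  have hMKd : M * K < d := by
    have : (M * K : ℝ) < d := by linarith
    exact_mod_cast this
  have hU : (d : ℝ) / 2 ≤ (d - M * K : ℕ) := by
    rw [Nat.cast_sub hMKd.le]
    push_cast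
    linarith
  -- With this probability the `K` Bernoulli variables of a block, each scaled by `√(2 * ε)`, have a
  -- total variance of at most `σ ^ 2`.
  set q := min 1 (2 * ε * K / σ ^ 2) with hqdef
  have hσ2 : 0 < σ ^ 2 := by positivity
  have hq0 : 0 < q := lt_min one_pos (by positivity)
  have hqle : q ≤ 2 * ε * K / σ ^ 2 := min_le_right _ _
  -- The scales are such that `a / s = √(2 * ε)` and the smoothness constant is exactly `L`.
  set s := Real.sqrt (2 * ε) * (800 * K ^ 2) / L with hsdef
  set a := 2 * ε * (800 * K ^ 2) / L with hadef
  have hr : 0 < Real.sqrt (2 * ε) := Real.sqrt_pos.2 (by linarith)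
  have hr2 : Real.sqrt (2 * ε) ^ 2 = 2 * ε := Real.sq_sqrt (by linarith)
  have hs : 0 < s := by positivity
  have ha : 0 < a := by positivity
  have has : (a / s) ^ 2 = 2 * ε := by
    have : a / s = Real.sqrt (2 * ε) := by
      rw [div_eq_iff hs.ne', hsdef, hadef]
      field_simp
      rw [hr2]
    rw [this, hr2]
  have hsm : 800 * (K : ℝ) ^ 2 * a / s ^ 2 ≤ L := by
    refine le_of_eq ?_
    have : s ^ 2 = a ^ 2 / (2 * ε) := by
      rw [← has]; field_simp
    rw [this, hadef]
    field_simp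
  have hgap : a * (2 * K * M) ≤ Δ := by
    have h1 : (K : ℝ) ^ 3 ≤ (3 * lam) ^ 3 := pow_le_pow_left₀ hK0.le hK3 3
    have h2 : 3200 * (K : ℝ) ^ 3 * M ≤ X := by
      calc 3200 * (K : ℝ) ^ 3 * M ≤ 3200 * (3 * lam) ^ 3 * Y := by gcongr
        _ ≤ X := by
          have e1 : 3200 * (3 * lam) ^ 3 * Y = 86400 * (Y * lam ^ 3) := by ring
          have e2 : X = 200000 * (lam * (Y * lam ^ 3)) := by rw [hXY]; ring
          have e3 := mul_le_mul_of_nonneg_right hlam (show 0 ≤ Y * lam ^ 3 by positivity)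
          have : 0 < Y * lam ^ 3 := by positivity
          linarith
    have h3 : a * (2 * K * M) = 3200 * (K : ℝ) ^ 3 * M * (ε / L) := by rw [hadef]; ring
    have h4 : Δ = X * (ε / L) := by rw [hXdef]; field_simp
    rw [h3, h4]
    gcongr
  have hvar : (a / s) ^ 2 * K * (1 / q - 1) ≤ σ ^ 2 := by
    rw [has]
    have h1 : 1 / q ≤ 1 + σ ^ 2 / (2 * ε * K) := by
      rw [div_le_iff₀ hq0, hqdef]
      rcases min_choice 1 (2 * ε * K / σ ^ 2) with h | h
      · rw [h, mul_one]
        have : 0 ≤ σ ^ 2 / (2 * ε * K) := by positivity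
        linarith
      · rw [h, add_mul]
        have : 0 ≤ 2 * ε * K / σ ^ 2 := by positivity
        have h2 : σ ^ 2 / (2 * ε * K) * (2 * ε * K / σ ^ 2) = 1 := by field_simp
        linarith
    calc 2 * ε * K * (1 / q - 1) ≤ 2 * ε * K * (σ ^ 2 / (2 * ε * K)) := by
          gcongr
          linarith
      _ = σ ^ 2 := by field_simp
  have hflo : (⌊w / h⌋₊ : ℝ) ≤ w / h := Nat.floor_le (by positivity)
  have hfloR : (⌊p * b * w⌋₊ : ℝ) ≤ p * b * w := Nat.floor_le (by positivity)
  refine le_trans (ENNReal.ofReal_le_ofReal ?_) (ofReal_le_optimalTime hn hh hb.le htime hdeg hbw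
    hK (by omega) hMKd hq0 (min_le_left _ _) ha.le hs hsm hgap hvar hε has hw ?_ S)
  · rw [hXY, div_le_iff₀ (by positivity)]
    have hM' : (4 : ℝ) ≤ M := by exact_mod_cast hM
    calc w * (Y * (200000 * lam ^ 4)) ≤ w * ((2 * (M - 1)) * (200000 * lam ^ 4)) := by
          gcongr
          linarith
      _ = _ := by ring
  · refine hδ.imp (fun hδ => ?_) fun hδ => ?_
    · rw [ofReal_mul_pow_add (by omega) hq0.le, show (1 / 8 : ℝ≥0∞) = ENNReal.ofReal (1 / 8) by
        rw [ENNReal.ofReal_div_of_pos (by norm_num)]; norm_num]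
      refine ENNReal.ofReal_le_ofReal (natCast_mul_pow_le hn hKlam (by positivity) (le_trans ?_ hδ))
      refine add_le_add ?_ ?_
      · calc (⌊p * b * w⌋₊ : ℝ) / (d - M * K : ℕ) ≤ p * b * w / (d / 2) := by gcongr
          _ = _ := by field_simp
      · calc (⌊w / h⌋₊ : ℝ) * q ≤ w / h * (2 * ε * K / σ ^ 2) := by gcongr
          _ ≤ _ := by gcongr
    · rw [show (1 / 8 : ℝ≥0∞) = ENNReal.ofReal (1 / 8) by
        rw [ENNReal.ofReal_div_of_pos (by norm_num)]; norm_num,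
        ← ENNReal.ofReal_natCast n, ← ENNReal.ofReal_natCast ⌊w / h⌋₊,
        ← ENNReal.ofReal_mul (by positivity), ← ENNReal.ofReal_mul (by positivity)]
      refine ENNReal.ofReal_le_ofReal (le_trans ?_ hδ)
      gcongr

/-- The length of a window in units of `d / (b log (n + 1))`, such that both the messages and the
gradient computations in the window are unlikely to reveal a given coordinate. -/
noncomputable def lowerConst (p : ℕ) (c₀ : ℝ) : ℝ :=
  Real.exp (-4) / (3 * p + 6 / c₀)

theorem lowerConst_pos (p : ℕ) {c₀ : ℝ} (h : 0 < c₀) : 0 < lowerConst p c₀ := by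
  unfold lowerConst
  have := Real.exp_pos (-4)
  positivity

set_option maxHeartbeats 800000 in
/-- The three terms of the rate come from three lengths of the windows. In `c * d / (b log (n + 1))`
seconds a worker receives or draws a given coordinate with a small probability; this uses the lower
bound on `σ ^ 2 / ε`. In `h * σ ^ 2 / (16 * n * ε * K)` seconds all workers together are unlikely to
draw a given coordinate. In `h / 2` seconds nothing is computed. -/
theorem ofReal_sparseRate_le_optimalTime {n d p : ℕ} {N : Network n} {h b L Δ σ ε c₀ : ℝ}
    (hc : 0 < c₀) (hh : 0 < h) (hb : 0 < b) (hL : 0 < L) (hσ : 0 ≤ σ) (hε : 0 < ε)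
    (htime : ∀ i, N.time i = h) (hdeg : ∀ v, (N.graph.neighborSet v).ncard ≤ p)
    (hbw : ∀ u v, N.graph.Adj u v → N.bw u v = b) (hc₀ : c₀ * (d / (b * h)) ≤ σ ^ 2 / ε)
    (hX : 8000000 * Real.log (n + 1) ^ 10 ≤ L * Δ / ε)
    (hd : 1 * (L * Δ) / (Real.log (n + 1) ^ 3 * ε) ≤ d) (S : Setting) :
    ENNReal.ofReal (min (lowerConst p c₀ / 800000) (1 / 38400000) / 3 / Real.log (n + 1) ^ 5 *
      sparseRate n d h b L Δ σ ε) ≤ optimalTime N (problemClass (d := d) L Δ σ S) ε := by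
  have hn := N.card_pos
  have hn0 : (0 : ℝ) < n := by exact_mod_cast hn
  have hlam := log_two_le_log_add_one hn
  rw [sparseRate_eq hb hε]
  set lam := Real.log (n + 1) with hlamdef
  have hlam0 : 0 < lam := by linarith
  have hd' : L * Δ / ε ≤ d * lam ^ 3 := by
    rw [div_le_iff₀ (by positivity)] at hd
    rw [div_le_iff₀ hε]
    linarith
  set X := L * Δ / ε with hXdef
  have hX0 : 0 < X := lt_of_lt_of_le (by positivity) hX
  have hd0 : (0 : ℝ) < d := by
    have h3 : 0 < lam ^ 3 := by positivity
    by_contra hneg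
    nlinarith
  have hσ0 : 0 < σ := by
    refine lt_of_le_of_ne hσ fun h0 => ?_
    rw [← h0] at hc₀
    have : 0 < c₀ * (d / (b * h)) := by positivity
    norm_num at hc₀
    linarith
  have hlc := lowerConst_pos p hc
  have key : ∀ w : ℝ, _ → _ → _ := fun w hw hδ => ofReal_window_le_optimalTime (w := w)
    hh hb hL hσ0 hε htime hdeg hbw hX hd' hw hδ S
  rw [← hlamdef, ← hXdef] at key
  set O := optimalTime N (problemClass (d := d) L Δ σ S) ε
  set c' := min (lowerConst p c₀ / 800000) (1 / 38400000) with hc'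
  have hc'1 : c' ≤ lowerConst p c₀ / 800000 := min_le_left _ _
  have hc'2 : c' ≤ 1 / 38400000 := min_le_right _ _
  have hc'0 : 0 < c' := lt_min (by positivity) (by norm_num)
  -- The term for the communication.
  have t1 : ENNReal.ofReal (c' / lam ^ 5 * (d / b * X)) ≤ O := by
    refine le_trans (ENNReal.ofReal_le_ofReal ?_)
      (key (lowerConst p c₀ * (d / b) / lam) (by positivity) (Or.inl ?_))
    · calc c' / lam ^ 5 * (d / b * X) ≤ lowerConst p c₀ / 800000 / lam ^ 5 * (d / b * X) := by
            gcongr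
        _ = _ := by field_simp
    · have e1 : 2 * p * b * (lowerConst p c₀ * (d / b) / lam) / d =
          lowerConst p c₀ * p * (2 / lam) := by field_simp
      have e2 : ε / σ ^ 2 ≤ b * h / (c₀ * d) := by
        rw [div_le_div_iff₀ (by positivity) (by positivity)]
        rw [← mul_div_assoc, div_le_div_iff₀ (by positivity) hε] at hc₀
        linarith
      have e3 : 2 / lam ≤ 3 := by
        rw [div_le_iff₀ hlam0]; linarith
      calc 2 * p * b * (lowerConst p c₀ * (d / b) / lam) / d +
            lowerConst p c₀ * (d / b) / lam / h * (2 * ε * (3 * lam) / σ ^ 2)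
          = lowerConst p c₀ * p * (2 / lam) +
            lowerConst p c₀ * (d / b) / lam / h * (2 * (3 * lam)) * (ε / σ ^ 2) := by
            rw [e1]; ring
        _ ≤ lowerConst p c₀ * p * 3 +
            lowerConst p c₀ * (d / b) / lam / h * (2 * (3 * lam)) * (b * h / (c₀ * d)) := by
            gcongr
        _ = lowerConst p c₀ * (3 * p + 6 / c₀) := by field_simp; ring
        _ = Real.exp (-4) := by
            unfold lowerConst
            exact div_mul_cancel₀ _ (by positivity)
        _ ≤ _ := le_rfl
  -- The term for the variance.
  have t2 : ENNReal.ofReal (c' / lam ^ 5 * (h * σ ^ 2 / (n * ε) * X)) ≤ O := by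
    have hKp : 0 < ⌈lam⌉₊ := Nat.ceil_pos.2 hlam0
    have hK0 : (0 : ℝ) < ⌈lam⌉₊ := by exact_mod_cast hKp
    have hK3 : (⌈lam⌉₊ : ℝ) ≤ 3 * lam := by
      have := Nat.ceil_lt_add_one hlam0.le
      linarith
    refine le_trans (ENNReal.ofReal_le_ofReal ?_)
      (key (h * σ ^ 2 / (16 * n * ε * ⌈lam⌉₊)) (by positivity) (Or.inr ?_))
    · calc c' / lam ^ 5 * (h * σ ^ 2 / (n * ε) * X)
          ≤ 1 / 38400000 / lam ^ 5 * (h * σ ^ 2 / (n * ε) * X) := by gcongr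
        _ = h * σ ^ 2 / (16 * n * ε * (3 * lam)) * X / (800000 * lam ^ 4) := by
            field_simp; norm_num
        _ ≤ _ := by gcongr
    · have hflo : (⌊h * σ ^ 2 / (16 * n * ε * ⌈lam⌉₊) / h⌋₊ : ℝ) ≤
          h * σ ^ 2 / (16 * n * ε * ⌈lam⌉₊) / h := Nat.floor_le (by positivity)
      calc n * (⌊h * σ ^ 2 / (16 * n * ε * ⌈lam⌉₊) / h⌋₊ * (2 * ε * ⌈lam⌉₊ / σ ^ 2))
          ≤ n * (h * σ ^ 2 / (16 * n * ε * ⌈lam⌉₊) / h * (2 * ε * ⌈lam⌉₊ / σ ^ 2)) := by gcongr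
        _ ≤ 1 / 8 := by
            refine le_of_eq ?_
            field_simp
            norm_num
  -- The term for the number of iterations.
  have t3 : ENNReal.ofReal (c' / lam ^ 5 * (h * X)) ≤ O := by
    refine le_trans (ENNReal.ofReal_le_ofReal ?_) (key (h / 2) (by positivity) (Or.inr ?_))
    · calc c' / lam ^ 5 * (h * X) ≤ 1 / 38400000 / lam ^ 5 * (h * X) := by gcongr
        _ = h / 2 * X / (800000 * lam ^ 4) * (1 / (24 * lam)) := by field_simp; norm_num
        _ ≤ h / 2 * X / (800000 * lam ^ 4) * 1 := by
            gcongr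
            rw [div_le_one (by positivity)]
            linarith
        _ = _ := mul_one _
    · have : ⌊h / 2 / h⌋₊ = 0 := by
        rw [Nat.floor_eq_zero, div_lt_one hh]
        linarith
      rw [this]
      norm_num
  rcases le_total (d / b * X) (h * σ ^ 2 / (n * ε) * X) with h12 | h12 <;>
  rcases le_total (d / b * X) (h * X) with h13 | h13 <;>
  rcases le_total (h * σ ^ 2 / (n * ε) * X) (h * X) with h23 | h23
  all_goals
    first
    | refine le_trans (ENNReal.ofReal_le_ofReal ?_) t1
      rw [div_right_comm, div_mul_eq_mul_div, mul_div_assoc]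
      exact mul_le_mul_of_nonneg_left (by linarith) (by positivity)
    | refine le_trans (ENNReal.ofReal_le_ofReal ?_) t2
      rw [div_right_comm, div_mul_eq_mul_div, mul_div_assoc]
      exact mul_le_mul_of_nonneg_left (by linarith) (by positivity)
    | refine le_trans (ENNReal.ofReal_le_ofReal ?_) t3
      rw [div_right_comm, div_mul_eq_mul_div, mul_div_assoc]
      exact mul_le_mul_of_nonneg_left (by linarith) (by positivity)

/-! ### Convergence of Leon SGD -/

/-- Quadratic upper bound for functions with a Lipschitz gradient. -/
theorem le_add_inner_gradient_add {d : ℕ} {f : Vec d → ℝ} {L : ℝ} (hf : Differentiable ℝ f)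
    (hL : ∀ x y, ‖gradient f x - gradient f y‖ ≤ L * ‖x - y‖) (x v : Vec d) :
    f (x + v) ≤ f x + inner ℝ (gradient f x) v + L / 2 * ‖v‖ ^ 2 := by
  let φ : ℝ → ℝ := fun t => f (x + t • v) - t * inner ℝ (gradient f x) v - L / 2 * ‖v‖ ^ 2 * t ^ 2
  have hφ : ∀ t, HasDerivAt φ (inner ℝ (gradient f (x + t • v)) v - inner ℝ (gradient f x) v -
      L / 2 * ‖v‖ ^ 2 * (2 * t)) t := by
    intro t
    have h1 : HasDerivAt (fun t : ℝ => x + t • v) v t := by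
      simpa using ((hasDerivAt_id t).smul_const v).const_add x
    have h2 := (hf (x + t • v)).hasGradientAt.hasFDerivAt.comp_hasDerivAt t h1
    have h3 := (hasDerivAt_id t).mul_const (inner ℝ (gradient f x) v)
    have h4 := (hasDerivAt_pow 2 t).const_mul (L / 2 * ‖v‖ ^ 2)
    refine HasDerivAt.congr_deriv (f := φ) ((h2.sub h3).sub h4) ?_
    simp
  have hanti : AntitoneOn φ (Set.Icc 0 1) := by
    refine antitoneOn_of_deriv_nonpos (convex_Icc 0 1)
      (fun t _ => (hφ t).continuousAt.continuousWithinAt)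
      (fun t _ => (hφ t).differentiableAt.differentiableWithinAt) fun t ht => ?_
    rw [interior_Icc] at ht
    rw [(hφ t).deriv, ← inner_sub_left]
    have h1 := real_inner_le_norm (gradient f (x + t • v) - gradient f x) v
    have h2 := hL (x + t • v) x
    rw [add_sub_cancel_left, norm_smul, Real.norm_of_nonneg ht.1.le] at h2
    have h3 := mul_le_mul_of_nonneg_right h2 (norm_nonneg v)
    nlinarith
  have := hanti (Set.left_mem_Icc.2 zero_le_one) (Set.right_mem_Icc.2 zero_le_one) zero_le_one
  simp only [φ, one_smul, zero_smul, add_zero, one_mul, zero_mul] at this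
  linarith

/-- The second moment of a sum of independent centred random vectors. -/
theorem integral_norm_sum_sq {ι Ξ : Type*} [MeasurableSpace Ξ] {d : ℕ} (law : ι → Measure Ξ)
    [∀ p, IsProbabilityMeasure (law p)] (φ : ι → Ξ → Vec d) (hφ : ∀ p, Measurable (φ p))
    (hL2 : ∀ p, MemLp (φ p) 2 (law p)) (h0 : ∀ p, ∫ y, φ p y ∂law p = 0) (S : Finset ι) :
    ∫ ξ, ‖∑ p ∈ S, φ p (ξ p)‖ ^ 2 ∂Measure.infinitePi law =
      ∑ p ∈ S, ∫ y, ‖φ p y‖ ^ 2 ∂law p := by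
  set μ := Measure.infinitePi law with hμ
  have hcm : ∀ p c, Measurable fun y => φ p y c := fun p c =>
    (EuclideanSpace.proj (𝕜 := ℝ) c).continuous.measurable.comp (hφ p)
  have hcL : ∀ p c, MemLp (fun y => φ p y c) 2 (law p) := fun p c =>
    (EuclideanSpace.proj (𝕜 := ℝ) c).comp_memLp' (hL2 p)
  have hmp : ∀ p, MeasurePreserving (Function.eval p) μ (law p) := fun p =>
    measurePreserving_eval_infinitePi law p
  have hcL' : ∀ p c, MemLp (fun ξ : ι → Ξ => φ p (ξ p) c) 2 μ := fun p c =>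
    (hcL p c).comp_measurePreserving (hmp p)
  have hc0 : ∀ p c, ∫ y, φ p y c ∂law p = 0 := by
    intro p c
    have := (EuclideanSpace.proj (𝕜 := ℝ) c).integral_comp_comm
      ((hL2 p).integrable (by norm_num))
    rw [h0 p, map_zero] at this
    exact this
  have hmove : ∀ (p : ι) (g : Ξ → ℝ), Measurable g → ∫ ξ, g (ξ p) ∂μ = ∫ y, g y ∂law p := by
    intro p g hg
    rw [← (hmp p).map_eq, integral_map (measurable_pi_apply p).aemeasurable
      hg.aestronglyMeasurable]
  have hc0' : ∀ p c, ∫ ξ, φ p (ξ p) c ∂μ = 0 := fun p c => by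
    rw [hmove p _ (hcm p c), hc0]
  have hcoord : ∀ c, ∫ ξ, (∑ p ∈ S, φ p (ξ p) c) ^ 2 ∂μ =
      ∑ p ∈ S, ∫ y, φ p y c ^ 2 ∂law p := by
    intro c
    have hind := ProbabilityTheory.iIndepFun_infinitePi (P := law) (X := fun p y => φ p y c)
      fun p => hcm p c
    have h1 := ProbabilityTheory.IndepFun.variance_sum (μ := μ) (s := S)
      (X := fun p ξ => φ p (ξ p) c) (fun p _ => hcL' p c)
      fun p _ p' _ hne => hind.indepFun hne
    rw [ProbabilityTheory.variance_of_integral_eq_zero] at h1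
    · simp only [Finset.sum_apply] at h1
      rw [h1]
      refine Finset.sum_congr rfl fun p _ => ?_
      rw [ProbabilityTheory.variance_of_integral_eq_zero (hcL' p c).aestronglyMeasurable.aemeasurable
        (hc0' p c)]
      exact hmove p _ ((hcm p c).pow_const 2)
    · exact Finset.aemeasurable_sum _ fun p _ => (hcL' p c).aestronglyMeasurable.aemeasurable
    · simp only [Finset.sum_apply]
      rw [integral_finsetSum _ fun p _ => (hcL' p c).integrable (by norm_num)]
      exact Finset.sum_eq_zero fun p _ => hc0' p c
  have hsq : ∀ ξ : ι → Ξ, ‖∑ p ∈ S, φ p (ξ p)‖ ^ 2 = ∑ c, (∑ p ∈ S, φ p (ξ p) c) ^ 2 := by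
    intro ξ
    rw [EuclideanSpace.norm_sq_eq]
    refine Finset.sum_congr rfl fun c _ => ?_
    rw [Real.norm_eq_abs, sq_abs, WithLp.ofLp_sum, Finset.sum_apply]
  simp only [hsq]
  rw [integral_finsetSum]
  · simp only [hcoord]
    rw [Finset.sum_comm]
    refine Finset.sum_congr rfl fun p _ => ?_
    rw [← integral_finsetSum _ fun c _ => (hcL p c).integrable_sq]
    refine integral_congr_ae (Filter.Eventually.of_forall fun y => ?_)
    simp only [EuclideanSpace.norm_sq_eq, Real.norm_eq_abs, sq_abs]
  · intro c _
    exact (memLp_finsetSum S fun p _ => hcL' p c).integrable_sq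

namespace Problem

variable {n d : ℕ} {P : Problem n d} {L Δ σ : ℝ}

/-- The joint law of all samples. -/
noncomputable def samples (P : Problem n d) : Measure (Fin n × ℕ → P.Ξ) :=
  Measure.infinitePi fun p : Fin n × ℕ => P.law p.1

instance (P : Problem n d) : IsProbabilityMeasure P.samples := by
  unfold samples; infer_instance

theorem gradient_objective (hP : P.Heterogeneous L Δ σ) (x : Vec d) :
    gradient P.objective x = (1 / (n : ℝ)) • ∑ i, gradient (P.fn i) x := by
  have h : ∀ i, HasFDerivAt (P.fn i) ((InnerProductSpace.toDual ℝ (Vec d)) (gradient (P.fn i) x)) x :=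
    fun i => (hP.differentiable_fn i x).hasGradientAt.hasFDerivAt
  have h1 := (HasFDerivAt.fun_sum (u := Finset.univ) fun i _ => h i).const_mul (1 / (n : ℝ))
  refine HasGradientAt.gradient ?_
  rw [hasGradientAt_iff_hasFDerivAt]
  refine h1.congr_fderiv ?_
  rw [map_smul, map_sum]

theorem measurable_oracle_comp (P : Problem n d) {Ω : Type*} [MeasurableSpace Ω] (i : Fin n)
    {x : Ω → Vec d} {ξ : Ω → P.Ξ} (hx : Measurable x) (hξ : Measurable ξ) :
    Measurable fun ω => P.oracle i (x ω) (ξ ω) :=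
  (P.measurable_oracle i).comp (hx.prodMk hξ)

theorem Heterogeneous.continuous_gradient (hP : P.Heterogeneous L Δ σ) (hL : 0 ≤ L) :
    Continuous (gradient P.objective) := by
  refine LipschitzWith.continuous (K := ⟨L, hL⟩) (LipschitzWith.of_dist_le_mul fun x y => ?_)
  rw [dist_eq_norm, dist_eq_norm]
  exact hP.smooth x y

/-- The average of the stochastic gradients of all workers at `x` in iteration `k`. -/
noncomputable def batchGradient (P : Problem n d) (B k : ℕ) (x : Vec d) (ξ : Fin n × ℕ → P.Ξ) :
    Vec d :=
  (1 / (n : ℝ)) • ∑ i, (1 / (B : ℝ)) • ∑ j ∈ Finset.range B, P.oracle i x (ξ (i, k * B + j))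

theorem leonIterate_succ (P : Problem n d) (B k : ℕ) (ξ : Fin n × ℕ → P.Ξ) :
    leonIterate P L B ξ (k + 1) = leonIterate P L B ξ k -
      (1 / (2 * L)) • P.batchGradient B k (leonIterate P L B ξ k) ξ := by
  rw [leonIterate, batchGradient, smul_smul, mul_one_div]

theorem measurable_leonIterate (P : Problem n d) (B k : ℕ) :
    Measurable fun ξ => leonIterate P L B ξ k := by
  induction k with
  | zero => exact measurable_const
  | succ k ih =>
    simp only [leonIterate]
    have := fun (i : Fin n) (m : ℕ) =>
      P.measurable_oracle_comp i ih (measurable_pi_apply (X := fun _ => P.Ξ) (i, m))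
    fun_prop

theorem leonIterate_congr (P : Problem n d) {B k : ℕ} {ξ ξ' : Fin n × ℕ → P.Ξ}
    (h : ∀ i m, m < k * B → ξ (i, m) = ξ' (i, m)) :
    leonIterate P L B ξ k = leonIterate P L B ξ' k := by
  induction k with
  | zero => rfl
  | succ k ih =>
    have hk : k * B + B = (k + 1) * B := by ring
    have e := ih fun i m hm => h i m (by omega)
    simp only [leonIterate, e]
    congr 2
    refine Finset.sum_congr rfl fun i _ => congrArg _ (Finset.sum_congr rfl fun j hj => ?_)
    rw [Finset.mem_range] at hj
    rw [h i _ (by omega)]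

theorem batchGradient_congr (P : Problem n d) {B k : ℕ} (x : Vec d) {ξ ξ' : Fin n × ℕ → P.Ξ}
    (h : ∀ i m, k * B ≤ m → m < k * B + B → ξ (i, m) = ξ' (i, m)) :
    P.batchGradient B k x ξ = P.batchGradient B k x ξ' := by
  unfold batchGradient
  refine congrArg _ (Finset.sum_congr rfl fun i _ => congrArg _ (Finset.sum_congr rfl fun j hj => ?_))
  rw [Finset.mem_range] at hj
  rw [h i _ (by omega) (by omega)]

/-- The noise of one stochastic gradient. -/
noncomputable def noise (P : Problem n d) (x : Vec d) (p : Fin n × ℕ) (y : P.Ξ) : Vec d :=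
  P.oracle p.1 x y - gradient (P.fn p.1) x

theorem measurable_noise (P : Problem n d) (x : Vec d) (p : Fin n × ℕ) :
    Measurable (P.noise x p) :=
  (P.measurable_oracle_comp p.1 measurable_const measurable_id).sub measurable_const

theorem memLp_noise (hP : P.Heterogeneous L Δ σ) (x : Vec d) (p : Fin n × ℕ) :
    MemLp (P.noise x p) 2 (P.law p.1) := by
  refine (memLp_two_iff_integrable_sq_norm (P.measurable_noise x p).aestronglyMeasurable).2
    ⟨((P.measurable_noise x p).norm.pow_const 2).aestronglyMeasurable, ?_⟩
  rw [hasFiniteIntegral_iff_ofReal (Filter.Eventually.of_forall fun y => by positivity)]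
  exact (hP.variance p.1 x).trans_lt ENNReal.ofReal_lt_top

theorem integral_noise (hP : P.Heterogeneous L Δ σ) (x : Vec d) (p : Fin n × ℕ) :
    ∫ y, P.noise x p y ∂P.law p.1 = 0 := by
  unfold noise
  rw [integral_sub (hP.integrable p.1 x) (integrable_const _), hP.unbiased p.1 x]
  simp

theorem integral_norm_noise_sq_le (hP : P.Heterogeneous L Δ σ) (x : Vec d) (p : Fin n × ℕ) :
    ∫ y, ‖P.noise x p y‖ ^ 2 ∂P.law p.1 ≤ σ ^ 2 := by
  rw [integral_eq_lintegral_of_nonneg_ae (Filter.Eventually.of_forall fun y => by positivity)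
    ((P.measurable_noise x p).norm.pow_const 2).aestronglyMeasurable]
  exact ENNReal.toReal_le_of_le_ofReal (by positivity) (hP.variance p.1 x)

theorem batchGradient_eq (hP : P.Heterogeneous L Δ σ) {B : ℕ} (hB : 0 < B) (k : ℕ)
    (x : Vec d) (ξ : Fin n × ℕ → P.Ξ) :
    P.batchGradient B k x ξ = gradient P.objective x + (1 / (n * B : ℝ)) •
      ∑ p ∈ Finset.univ ×ˢ Finset.Ico (k * B) (k * B + B), P.noise x p (ξ p) := by
  have hB' : (B : ℝ) ≠ 0 := by exact_mod_cast hB.ne'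
  rw [gradient_objective hP, Finset.sum_product, batchGradient,
    show (1 / (n * B : ℝ)) = 1 / n * (1 / B) by field_simp, ← smul_smul, ← smul_add, Finset.smul_sum (r := (1 / (B : ℝ))), ← Finset.sum_add_distrib]
  refine congrArg _ (Finset.sum_congr rfl fun i _ => ?_)
  rw [Finset.sum_Ico_eq_sum_range, add_tsub_cancel_left]
  simp only [noise]
  rw [Finset.sum_sub_distrib, Finset.sum_const, Finset.card_range, smul_sub,
    ← Nat.cast_smul_eq_nsmul ℝ, smul_smul, one_div_mul_cancel hB', one_smul, add_sub_cancel]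

/-- Expected decrease of the objective in one step. The batch size makes the variance of the averaged
gradient at most `ε`. -/
theorem lintegral_gap_step_le (hP : P.Heterogeneous L Δ σ) (hL : 0 < L) {ε : ℝ} (hε : 0 < ε)
    (hn : 0 < n) {B : ℕ} (hB : 0 < B) (hBσ : σ ^ 2 / ε ≤ n * B) (k : ℕ) (x : Vec d) :
    ∫⁻ ξ, ENNReal.ofReal (P.objective (x - (1 / (2 * L)) • P.batchGradient B k x ξ) -
        (P.objective 0 - Δ)) ∂P.samples +
      ENNReal.ofReal (3 / (8 * L) * ‖gradient P.objective x‖ ^ 2) ≤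
    ENNReal.ofReal (P.objective x - (P.objective 0 - Δ)) + ENNReal.ofReal (ε / (8 * L)) := by
  have hn' : (0 : ℝ) < n := by exact_mod_cast hn
  have hB' : (0 : ℝ) < B := by exact_mod_cast hB
  set S : Finset (Fin n × ℕ) := Finset.univ ×ˢ Finset.Ico (k * B) (k * B + B) with hS
  set g := gradient P.objective x with hg
  let e : (Fin n × ℕ → P.Ξ) → Vec d := fun ξ => (1 / (n * B : ℝ)) • ∑ p ∈ S, P.noise x p (ξ p)
  have hmp : ∀ p : Fin n × ℕ, MeasurePreserving (Function.eval p) P.samples (P.law p.1) := fun p =>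
    measurePreserving_eval_infinitePi (fun p : Fin n × ℕ => P.law p.1) p
  have hsL : MemLp (fun ξ : Fin n × ℕ → P.Ξ => ∑ p ∈ S, P.noise x p (ξ p)) 2 P.samples :=
    memLp_finsetSum S fun p _ => (memLp_noise hP x p).comp_measurePreserving (hmp p)
  have heL : MemLp e 2 P.samples := hsL.const_smul (1 / (n * B : ℝ))
  have hei : Integrable e P.samples := heL.integrable (by norm_num)
  have he0 : ∫ ξ, e ξ ∂P.samples = 0 := by
    simp only [e]
    have hi : ∀ p ∈ S, Integrable (fun ξ : Fin n × ℕ → P.Ξ => P.noise x p (ξ p)) P.samples :=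
      fun p _ => ((memLp_noise hP x p).comp_measurePreserving (hmp p)).integrable (by norm_num)
    rw [integral_smul, integral_finsetSum S hi, Finset.sum_eq_zero, smul_zero]
    intro p _
    have := integral_map (μ := P.samples) (φ := Function.eval p) (measurable_pi_apply p).aemeasurable
      (P.measurable_noise x p).aestronglyMeasurable
    rw [(hmp p).map_eq, integral_noise hP] at this
    exact this.symm
  have he2 : ∫ ξ, ‖e ξ‖ ^ 2 ∂P.samples ≤ ε := by
    have h1 : ∫ ξ, ‖∑ p ∈ S, P.noise x p (ξ p)‖ ^ 2 ∂P.samples ≤ n * B * σ ^ 2 := by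
      unfold samples
      rw [integral_norm_sum_sq (fun p : Fin n × ℕ => P.law p.1) (P.noise x)
        (P.measurable_noise x) (memLp_noise hP x) (integral_noise hP x) S]
      refine (Finset.sum_le_card_nsmul S _ _ fun p _ => integral_norm_noise_sq_le hP x p).trans ?_
      rw [hS, Finset.card_product, Finset.card_univ, Fintype.card_fin, Nat.card_Ico,
        add_tsub_cancel_left, nsmul_eq_mul]
      push_cast
      exact le_rfl
    simp only [e, norm_smul, mul_pow]
    rw [integral_const_mul, Real.norm_of_nonneg (by positivity)]
    calc (1 / (n * B : ℝ)) ^ 2 * _ ≤ (1 / (n * B : ℝ)) ^ 2 * (n * B * σ ^ 2) := by gcongr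
      _ = σ ^ 2 / (n * B) := by field_simp
      _ ≤ ε := by
        rw [div_le_iff₀ hε] at hBσ
        rw [div_le_iff₀ (by positivity)]
        linarith
  let U : (Fin n × ℕ → P.Ξ) → ℝ := fun ξ => P.objective x - (P.objective 0 - Δ) -
    3 / (8 * L) * ‖g‖ ^ 2 - 1 / (4 * L) * inner ℝ g (e ξ) + 1 / (8 * L) * ‖e ξ‖ ^ 2
  have hpt : ∀ ξ, P.objective (x - (1 / (2 * L)) • P.batchGradient B k x ξ) -
      (P.objective 0 - Δ) ≤ U ξ := by
    intro ξ
    have h1 := le_add_inner_gradient_add hP.differentiable hP.smooth x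
      (-((1 / (2 * L)) • P.batchGradient B k x ξ))
    rw [← sub_eq_add_neg, inner_neg_right, norm_neg, norm_smul, mul_pow, inner_smul_right,
      Real.norm_of_nonneg (by positivity)] at h1
    have h2 : P.batchGradient B k x ξ = g + e ξ := batchGradient_eq hP hB k x ξ
    rw [h2, ← hg, norm_add_sq_real, inner_add_right, real_inner_self_eq_norm_sq] at h1
    rw [h2]
    refine (sub_le_sub_right h1 _).trans (le_of_eq ?_)
    simp only [U]
    field_simp
    ring
  have hnn : ∀ y, 0 ≤ P.objective y - (P.objective 0 - Δ) := fun y => by linarith [hP.gap y]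
  have hi1 : Integrable (fun ξ => 1 / (4 * L) * inner ℝ g (e ξ)) P.samples :=
    (hei.const_inner g).const_mul _
  have hi2 : Integrable (fun ξ => 1 / (8 * L) * ‖e ξ‖ ^ 2) P.samples :=
    heL.integrable_norm_pow (by norm_num) |>.const_mul _
  have hi0 : Integrable (fun ξ => P.objective x - (P.objective 0 - Δ) -
    3 / (8 * L) * ‖g‖ ^ 2 - 1 / (4 * L) * inner ℝ g (e ξ)) P.samples :=
    (integrable_const _).sub hi1
  have hUi : Integrable U P.samples := hi0.add hi2
  have hUint : ∫ ξ, U ξ ∂P.samples ≤ P.objective x - (P.objective 0 - Δ) -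
      3 / (8 * L) * ‖g‖ ^ 2 + ε / (8 * L) := by
    simp only [U]
    rw [integral_add hi0 hi2, integral_sub (integrable_const _) hi1, integral_const_mul,
      integral_const_mul, integral_inner hei, he0]
    simp only [integral_const, probReal_univ, one_smul, inner_zero_right, mul_zero, sub_zero]
    have : 1 / (8 * L) * ∫ ξ, ‖e ξ‖ ^ 2 ∂P.samples ≤ 1 / (8 * L) * ε := by gcongr
    have h : 1 / (8 * L) * ε = ε / (8 * L) := by ring
    linarith
  have hU0 : ∀ ξ, 0 ≤ U ξ := fun ξ => (hnn _).trans (hpt ξ)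
  calc _ ≤ ∫⁻ ξ, ENNReal.ofReal (U ξ) ∂P.samples + ENNReal.ofReal (3 / (8 * L) * ‖g‖ ^ 2) := by
        gcongr with ξ
        exact hpt ξ
    _ = ENNReal.ofReal (∫ ξ, U ξ ∂P.samples + 3 / (8 * L) * ‖g‖ ^ 2) := by
        rw [← ofReal_integral_eq_lintegral_ofReal hUi (Filter.Eventually.of_forall hU0),
          ENNReal.ofReal_add (integral_nonneg hU0) (by positivity)]
    _ ≤ ENNReal.ofReal (P.objective x - (P.objective 0 - Δ) + ε / (8 * L)) :=
        ENNReal.ofReal_le_ofReal (by linarith)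
    _ = _ := ENNReal.ofReal_add (hnn x) (by positivity)

open Classical in
/-- Expected decrease of the objective from one iterate of Leon SGD to the next one. -/
theorem lintegral_gap_succ_le (hP : P.Heterogeneous L Δ σ) (hL : 0 < L) {ε : ℝ} (hε : 0 < ε)
    (hn : 0 < n) {B : ℕ} (hB : 0 < B) (hBσ : σ ^ 2 / ε ≤ n * B) (k : ℕ) :
    ∫⁻ ξ, ENNReal.ofReal (P.objective (leonIterate P L B ξ (k + 1)) -
        (P.objective 0 - Δ)) ∂P.samples +
      ∫⁻ ξ, ENNReal.ofReal (3 / (8 * L) * ‖gradient P.objective (leonIterate P L B ξ k)‖ ^ 2)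
        ∂P.samples ≤
    ∫⁻ ξ, ENNReal.ofReal (P.objective (leonIterate P L B ξ k) - (P.objective 0 - Δ)) ∂P.samples +
      ENNReal.ofReal (ε / (8 * L)) := by
  have hfm : Measurable P.objective := hP.differentiable.continuous.measurable
  have hgm : Measurable (gradient P.objective) := (hP.continuous_gradient hL.le).measurable
  have hxm : ∀ k, Measurable fun ξ => leonIterate P L B ξ k := fun k =>
    P.measurable_leonIterate B k
  have hm1 : ∀ k, Measurable fun ξ => ENNReal.ofReal (P.objective (leonIterate P L B ξ k) -
      (P.objective 0 - Δ)) := fun k => ((hfm.comp (hxm k)).sub_const _).ennreal_ofReal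
  have hm2 : Measurable fun ξ => ENNReal.ofReal (3 / (8 * L) *
      ‖gradient P.objective (leonIterate P L B ξ k)‖ ^ 2) :=
    (((hgm.comp (hxm k)).norm.pow_const 2).const_mul _).ennreal_ofReal
  -- The samples of iteration `k` are drawn afresh, given the current iterate.
  let S : Set (Fin n × ℕ) := {p | k * B ≤ p.2}
  have hres := measurePreserving_resample (fun p : Fin n × ℕ => P.law p.1) S
  have hstep : ∀ ξ ξ' : Fin n × ℕ → P.Ξ, leonIterate P L B (S.piecewise ξ' ξ) (k + 1) =
      leonIterate P L B ξ k - (1 / (2 * L)) • P.batchGradient B k (leonIterate P L B ξ k) ξ' := by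
    intro ξ ξ'
    have h1 : leonIterate P L B (S.piecewise ξ' ξ) k = leonIterate P L B ξ k :=
      P.leonIterate_congr fun i m hm => Set.piecewise_eq_of_notMem _ _ _ (not_le.2 hm)
    rw [leonIterate_succ, h1, P.batchGradient_congr _ fun i m hm _ =>
      Set.piecewise_eq_of_mem S ξ' ξ hm]
  have e1 : ∫⁻ ξ, ENNReal.ofReal (P.objective (leonIterate P L B ξ (k + 1)) -
        (P.objective 0 - Δ)) ∂P.samples =
      ∫⁻ ξ, ∫⁻ ξ', ENNReal.ofReal (P.objective (leonIterate P L B ξ k -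
        (1 / (2 * L)) • P.batchGradient B k (leonIterate P L B ξ k) ξ') -
        (P.objective 0 - Δ)) ∂P.samples ∂P.samples := by
    unfold samples
    rw [← hres.lintegral_comp (hm1 (k + 1))]
    refine (lintegral_prod _ ((hm1 (k + 1)).comp hres.measurable).aemeasurable).trans ?_
    simp only [Function.comp_apply, hstep]
  rw [e1, ← lintegral_add_right _ hm2]
  refine (lintegral_mono fun ξ => lintegral_gap_step_le hP hL hε hn hB hBσ k _).trans ?_
  rw [lintegral_add_right _ measurable_const, lintegral_const, measure_univ, mul_one]

/-- The expected decreases sum up to at most `Δ`, so after `4 * L * Δ / ε` iterations the average of the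
expected squared gradient norms is at most `ε`. -/
theorem sum_lintegral_gradient_leonIterate_le (hP : P.Heterogeneous L Δ σ) (hL : 0 < L) {ε : ℝ}
    (hε : 0 < ε) (hn : 0 < n) {B : ℕ} (hB : 0 < B) (hBσ : σ ^ 2 / ε ≤ n * B) {K : ℕ}
    (hK : 0 < K) (hKL : 4 * L * Δ / ε ≤ K) :
    (∑ k ∈ Finset.range K, ∫⁻ ξ, ENNReal.ofReal
      (‖gradient P.objective (leonIterate P L B ξ k)‖ ^ 2) ∂P.samples) / K ≤ ENNReal.ofReal ε := by
  have hK' : (0 : ℝ) < K := by exact_mod_cast hK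
  have key : ∀ K : ℕ, ∫⁻ ξ, ENNReal.ofReal (P.objective (leonIterate P L B ξ K) -
        (P.objective 0 - Δ)) ∂P.samples +
      ∑ k ∈ Finset.range K, ∫⁻ ξ, ENNReal.ofReal
        (3 / (8 * L) * ‖gradient P.objective (leonIterate P L B ξ k)‖ ^ 2) ∂P.samples ≤
      ENNReal.ofReal Δ + K * ENNReal.ofReal (ε / (8 * L)) := by
    intro K
    induction K with
    | zero => simp [leonIterate]
    | succ K ih =>
      rw [Finset.sum_range_succ, add_comm (Finset.sum _ _), ← add_assoc]
      refine (add_le_add_left (lintegral_gap_succ_le hP hL hε hn hB hBσ K) _).trans ?_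
      rw [add_right_comm]
      refine (add_le_add_left ih _).trans (le_of_eq ?_)
      push_cast
      ring
  have hΔ : 0 ≤ Δ := by simpa using hP.gap 0
  have h1 := (le_add_self).trans (key K)
  have h3 : 0 < 3 / (8 * L) := by positivity
  have h2 : ∀ k, ∫⁻ ξ, ENNReal.ofReal
      (3 / (8 * L) * ‖gradient P.objective (leonIterate P L B ξ k)‖ ^ 2) ∂P.samples =
      ENNReal.ofReal (3 / (8 * L)) * ∫⁻ ξ, ENNReal.ofReal
        (‖gradient P.objective (leonIterate P L B ξ k)‖ ^ 2) ∂P.samples := by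
    intro k
    rw [← lintegral_const_mul' _ _ ENNReal.ofReal_ne_top]
    simp only [ENNReal.ofReal_mul h3.le]
  simp only [h2] at h1
  rw [← Finset.mul_sum] at h1
  rw [ENNReal.div_le_iff (by simp [hK.ne']) (ENNReal.natCast_ne_top K)]
  refine (ENNReal.mul_le_mul_iff_right (ENNReal.ofReal_pos.2 h3).ne' ENNReal.ofReal_ne_top).1
    (h1.trans ?_)
  rw [← ENNReal.ofReal_natCast, ← ENNReal.ofReal_mul hK'.le,
    ← ENNReal.ofReal_add hΔ (by positivity), ← ENNReal.ofReal_mul hε.le,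
    ← ENNReal.ofReal_mul h3.le]
  refine ENNReal.ofReal_le_ofReal ?_
  rw [div_le_iff₀ hε] at hKL
  have : Δ ≤ K * ε / (4 * L) := by
    rw [le_div_iff₀ (by positivity)]; linarith
  calc Δ + K * (ε / (8 * L)) ≤ K * ε / (4 * L) + K * (ε / (8 * L)) := by gcongr
    _ = _ := by field_simp; norm_num

end Problem

/-! ### Tours and routes in connected graphs -/

namespace SimpleGraph

variable {V : Type*} {G : SimpleGraph V}

/-- The relation `E` consists of the darts of a simple path from `i` to `j`, as far as the
forwarding of messages is concerned: nothing leaves `j`, a vertex has at most one successor, every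
forwarding vertex other than `i` has a predecessor, and `j` is reached. -/
structure IsRoute (G : SimpleGraph V) (i j : V) (E : V → V → Prop) : Prop where
  adj : ∀ u v, E u v → G.Adj u v
  not_leave : ∀ v, ¬ E j v
  unique : ∀ w v v', E w v → E w v' → v = v'
  pred : ∀ w v, w ≠ i → E w v → ∃ u, E u w
  reach : i ≠ j → ∃ u, E u j

theorem Walk.IsPath.isRoute {i j : V} {p : G.Walk i j} (hp : p.IsPath) :
    G.IsRoute i j fun u v => ∃ d ∈ p.darts, d.fst = u ∧ d.snd = v := by
  have hsupp : ∀ {i j : V} (p : G.Walk i j) (u v : V),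
      (∃ d ∈ p.darts, d.fst = u ∧ d.snd = v) → u ∈ p.support := by
    rintro i j p u v ⟨d, hd, rfl, -⟩
    exact p.dart_fst_mem_support_of_mem_darts hd
  induction p with
  | nil => constructor <;> simp
  | @cons a b c h p ih =>
    rw [Walk.cons_isPath_iff] at hp
    have ih := ih hp.1
    have hcons : ∀ u v, (∃ d ∈ (Walk.cons h p).darts, d.fst = u ∧ d.snd = v) ↔
        (a = u ∧ b = v) ∨ ∃ d ∈ p.darts, d.fst = u ∧ d.snd = v := by
      intro u v
      simp [Walk.darts_cons, or_and_right, exists_or]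
    have hnot : ∀ v, ¬ ∃ d ∈ p.darts, d.fst = a ∧ d.snd = v := fun v hv =>
      hp.2 (hsupp p a v hv)
    simp only [hcons]
    refine ⟨?_, ?_, ?_, ?_, ?_⟩
    · rintro u v (⟨rfl, rfl⟩ | hE)
      · exact h
      · exact ih.adj u v hE
    · rintro v (⟨rfl, -⟩ | hE)
      · exact hp.2 p.end_mem_support
      · exact ih.not_leave v hE
    · rintro w v v' (⟨rfl, rfl⟩ | hE) (⟨h1, rfl⟩ | hE')
      · rfl
      · exact absurd hE' (hnot v')
      · subst h1
        exact absurd hE (hnot v)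
      · exact ih.unique w v v' hE hE'
    · rintro w v hw (⟨rfl, rfl⟩ | hE)
      · exact absurd rfl hw
      · by_cases hwb : w = b
        · exact ⟨a, Or.inl ⟨rfl, hwb.symm⟩⟩
        · obtain ⟨u, hu⟩ := ih.pred w v hwb hE
          exact ⟨u, Or.inr hu⟩
    · intro _
      by_cases hbc : b = c
      · exact ⟨a, Or.inl ⟨rfl, hbc⟩⟩
      · obtain ⟨u, hu⟩ := ih.reach hbc
        exact ⟨u, Or.inr hu⟩

open Classical in
/-- Every walk contains a route. -/
theorem Walk.exists_isRoute {i j : V} (p : G.Walk i j) :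
    ∃ E, G.IsRoute i j E ∧ ∀ u v, E u v → ∃ d ∈ p.darts, d.fst = u ∧ d.snd = v :=
  ⟨_, p.bypass_isPath.isRoute, fun _ _ ⟨d, hd, h⟩ => ⟨d, p.darts_bypass_subset_darts hd, h⟩⟩

theorem exists_walk_of_adj {x : ℕ → V} {m : ℕ} (hx : ∀ t < m, G.Adj (x t) (x (t + 1)))
    {a b : ℕ} (hab : a ≤ b) (hb : b ≤ m) :
    ∃ p : G.Walk (x a) (x b), ∀ d ∈ p.darts, ∃ t, a ≤ t ∧ t < b ∧ d.fst = x t ∧ d.snd = x (t + 1) := by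
  induction b, hab using Nat.le_induction with
  | base => exact ⟨Walk.nil, by simp⟩
  | succ b hab ih =>
    obtain ⟨p, hp⟩ := ih (by omega)
    refine ⟨p.concat (hx b (by omega)), fun d hd => ?_⟩
    rw [Walk.darts_concat, List.concat_eq_append, List.mem_append, List.mem_singleton] at hd
    rcases hd with hd | rfl
    · obtain ⟨t, h1, h2, h3⟩ := hp d hd
      exact ⟨t, h1, by omega, h3⟩
    · exact ⟨b, hab, by omega, rfl, rfl⟩

open Classical in
/-- A closed walk in a connected graph that visits every vertex and uses every dart at most once:
as long as some vertex is missing, a detour to a neighbour and back is inserted. -/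
theorem Connected.exists_tour [Fintype V] (hG : G.Connected) :
    ∃ (a : V) (w : G.Walk a a), w.darts.Nodup ∧ ∀ v, v ∈ w.support := by
  obtain ⟨a⟩ := hG.nonempty
  have key : ∀ k ≤ Fintype.card V, ∃ w : G.Walk a a, w.darts.Nodup ∧ k ≤ w.support.toFinset.card := by
    intro k hk
    induction k with
    | zero => exact ⟨Walk.nil, by simp, Nat.zero_le _⟩
    | succ k ih =>
      obtain ⟨w, hw, hkw⟩ := ih (by omega)
      by_cases hlt : k + 1 ≤ w.support.toFinset.card
      · exact ⟨w, hw, hlt⟩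
      obtain ⟨y, hy⟩ : ∃ y, y ∉ w.support := by
        by_contra! hall
        have : w.support.toFinset = Finset.univ := Finset.eq_univ_iff_forall.2 fun v => by
          simpa using hall v
        rw [this, Finset.card_univ] at hlt
        omega
      obtain ⟨p⟩ := hG.preconnected a y
      obtain ⟨d, -, hd1, hd2⟩ := p.exists_boundary_dart {v | v ∈ w.support} w.start_mem_support hy
      have hd1 : d.fst ∈ w.support := hd1
      have hd2 : d.snd ∉ w.support := hd2
      let w' : G.Walk a a := (w.takeUntil _ hd1).append
        (Walk.cons d.adj (Walk.cons d.adj.symm (w.dropUntil _ hd1)))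
      have hdarts : w'.darts.Perm (d :: d.symm :: w.darts) := by
        have h1 : w.darts = (w.takeUntil _ hd1).darts ++ (w.dropUntil _ hd1).darts := by
          rw [← Walk.darts_append, Walk.take_spec]
        rw [h1]
        simp only [w', Walk.darts_append, Walk.darts_cons]
        refine List.perm_middle.trans (List.Perm.cons _ ?_)
        exact List.perm_middle
      have hsupp : ∀ v, v ∈ w'.support ↔ v ∈ w.support ∨ v = d.snd := by
        intro v
        have h1 : v ∈ w.support ↔ v ∈ (w.takeUntil _ hd1).support ∨
            v ∈ (w.dropUntil _ hd1).support := by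
          rw [← Walk.mem_support_append_iff, Walk.take_spec]
        rw [h1]
        simp only [w', Walk.mem_support_append_iff, Walk.support_cons, List.mem_cons]
        have : v = d.fst → v ∈ (w.takeUntil _ hd1).support := by
          rintro rfl; exact Walk.end_mem_support _
        tauto
      refine ⟨w', ?_, ?_⟩
      · rw [hdarts.nodup_iff, List.nodup_cons, List.nodup_cons]
        refine ⟨?_, ?_, hw⟩
        · rw [List.mem_cons, not_or]
          refine ⟨d.symm_ne.symm, fun h => hd2 ?_⟩
          exact w.dart_snd_mem_support_of_mem_darts h
        · exact fun h => hd2 (w.dart_fst_mem_support_of_mem_darts h)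
      · have : w'.support.toFinset = insert d.snd w.support.toFinset := by
          ext v
          simp [hsupp, or_comm]
        rw [this, Finset.card_insert_of_notMem (by simpa using hd2)]
        omega
  obtain ⟨w, hw, hk⟩ := key _ le_rfl
  refine ⟨a, w, hw, fun v => ?_⟩
  have := (Finset.card_eq_iff_eq_univ _).1 (le_antisymm (Finset.card_le_univ w.support.toFinset) hk)
  rw [← List.mem_toFinset, this]
  exact Finset.mem_univ v

/-- In a connected graph the vertices can be ordered such that there are routes between all pairs of
vertices, and the routes over disjoint intervals with the same orientation share no dart. -/
theorem Connected.exists_routes {n : ℕ} {G : SimpleGraph (Fin n)} (hG : G.Connected) :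
    ∃ (rk : Fin n ≃ Fin n) (E : Fin n → Fin n → Fin n → Fin n → Prop),
      (∀ i j, i ≠ j → G.IsRoute i j (E i j)) ∧
      (∀ i j i' j' u v, rk i < rk j → rk j ≤ rk i' → rk i' < rk j' → E i j u v → ¬ E i' j' u v) ∧
      ∀ i j i' j' u v, rk i < rk j → rk j ≤ rk i' → rk i' < rk j' → E j i u v → ¬ E j' i' u v := by
  obtain ⟨a, w, hw, hall⟩ := hG.exists_tour
  have hadj : ∀ t < w.length, G.Adj (w.getVert t) (w.getVert (t + 1)) := fun t ht =>
    w.adj_getVert_succ ht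
  have hinj : ∀ s < w.length, ∀ t < w.length, w.getVert s = w.getVert t →
      w.getVert (s + 1) = w.getVert (t + 1) → s = t := by
    intro s hs t ht h1 h2
    have hs' : s < w.darts.length := by rwa [w.length_darts]
    have ht' : t < w.darts.length := by rwa [w.length_darts]
    refine (hw.getElem_inj_iff (hi := hs') (hj := ht')).1 ?_
    rw [w.darts_getElem_eq_getVert s hs', w.darts_getElem_eq_getVert t ht']
    ext <;> simp [h1, h2]
  choose pos hpos hposl using fun v => Walk.mem_support_iff_exists_getVert.1 (hall v)
  have hpinj : Function.Injective pos := fun u v h => by rw [← hpos u, ← hpos v, h]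
  let rk : Fin n ≃ Fin n := (Tuple.sort pos).symm
  have hrk : ∀ i j, rk i < rk j → pos i < pos j := by
    intro i j h
    have := Tuple.monotone_sort pos h.le
    simp only [Function.comp_apply, rk, Equiv.apply_symm_apply] at this
    refine lt_of_le_of_ne this fun he => h.ne ?_
    rw [hpinj he]
  have hrk' : ∀ i j, rk i ≤ rk j → pos i ≤ pos j := fun i j h => by
    rcases h.lt_or_eq with h | h
    · exact (hrk i j h).le
    · rw [rk.injective h]
  have hroute : ∀ i j, i ≠ j → ∃ E, G.IsRoute i j E ∧
      (rk i < rk j → ∀ u v, E u v → ∃ t, pos i ≤ t ∧ t < pos j ∧ u = w.getVert t ∧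
        v = w.getVert (t + 1)) ∧
      (rk j < rk i → ∀ u v, E u v → ∃ t, pos j ≤ t ∧ t < pos i ∧ v = w.getVert t ∧
        u = w.getVert (t + 1)) := by
    intro i j hij
    rcases lt_or_gt_of_ne fun h => hij (rk.injective h) with h | h
    · obtain ⟨p, hp⟩ := exists_walk_of_adj hadj (hrk i j h).le (hposl j)
      obtain ⟨E, hE, hEp⟩ := p.exists_isRoute
      rw [hpos, hpos] at hE
      refine ⟨E, hE, fun _ u v huv => ?_, fun h' => absurd h' h.asymm⟩
      obtain ⟨d, hd, rfl, rfl⟩ := hEp u v huv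
      exact hp d hd
    · obtain ⟨p, hp⟩ := exists_walk_of_adj hadj (hrk j i h).le (hposl i)
      obtain ⟨E, hE, hEp⟩ := p.reverse.exists_isRoute
      rw [hpos, hpos] at hE
      refine ⟨E, hE, fun h' => absurd h' h.asymm, fun _ u v huv => ?_⟩
      obtain ⟨d, hd, rfl, rfl⟩ := hEp u v huv
      rw [Walk.darts_reverse, List.mem_reverse, List.mem_map] at hd
      obtain ⟨d', hd', rfl⟩ := hd
      exact hp d' hd'
  choose! E hE hE1 hE2 using hroute
  refine ⟨rk, E, hE, fun i j i' j' u v h1 h2 h3 he he' => ?_,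
    fun i j i' j' u v h1 h2 h3 he he' => ?_⟩
  · obtain ⟨s, hs1, hs2, hs3, hs4⟩ := hE1 i j (fun h => h1.ne (h ▸ rfl)) h1 u v he
    obtain ⟨t, ht1, ht2, ht3, ht4⟩ := hE1 i' j' (fun h => h3.ne (h ▸ rfl)) h3 u v he'
    have := hrk' _ _ h2
    have := hposl j
    have := hposl j'
    have := hinj s (by omega) t (by omega) (hs3 ▸ ht3) (hs4 ▸ ht4)
    omega
  · obtain ⟨s, hs1, hs2, hs3, hs4⟩ := hE2 j i (fun h => h1.ne (h ▸ rfl)) h1 u v he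
    obtain ⟨t, ht1, ht2, ht3, ht4⟩ := hE2 j' i' (fun h => h3.ne (h ▸ rfl)) h3 u v he'
    have := hrk' _ _ h2
    have := hposl j
    have := hposl j'
    have := hinj s (by omega) t (by omega) (hs3 ▸ ht3) (hs4 ▸ ht4)
    omega

end SimpleGraph

/-! ### The rounds of an AllReduce -/

/-- An order of the vertices together with routes between all pairs, such that routes over disjoint
intervals with the same orientation share no link. -/
structure Routing {n : ℕ} (G : SimpleGraph (Fin n)) where
  rk : Fin n ≃ Fin n
  route : Fin n → Fin n → Fin n → Fin n → Prop
  isRoute : ∀ i j, i ≠ j → G.IsRoute i j (route i j)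
  disjoint_up : ∀ i j i' j' u v, rk i < rk j → rk j ≤ rk i' → rk i' < rk j' →
    route i j u v → ¬ route i' j' u v
  disjoint_down : ∀ i j i' j' u v, rk i < rk j → rk j ≤ rk i' → rk i' < rk j' →
    route j i u v → ¬ route j' i' u v

theorem SimpleGraph.Connected.nonempty_routing {n : ℕ} {G : SimpleGraph (Fin n)}
    (hG : G.Connected) : Nonempty (Routing G) := by
  obtain ⟨rk, E, h1, h2, h3⟩ := hG.exists_routes
  exact ⟨⟨rk, E, h1, h2, h3⟩⟩

theorem Nat.add_le_of_lt_of_mod_eq_zero {a b m : ℕ} (ha : a % m = 0) (hb : b % m = 0)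
    (h : a < b) : a + m ≤ b := by
  obtain ⟨x, rfl⟩ := Nat.dvd_of_mod_eq_zero ha
  obtain ⟨y, rfl⟩ := Nat.dvd_of_mod_eq_zero hb
  have hxy : x < y := lt_of_mul_lt_mul_left h (Nat.zero_le m)
  calc m * x + m = m * (x + 1) := by ring
    _ ≤ m * y := Nat.mul_le_mul_left _ hxy

theorem Nat.add_two_pow_mod_ne_zero {a r s : ℕ} (ha : a % 2 ^ (r + 1) = 0) (hrs : r < s) :
    (a + 2 ^ r) % 2 ^ s ≠ 0 := by
  intro h
  have h1 : 2 ^ (r + 1) ∣ a + 2 ^ r := (pow_dvd_pow 2 hrs).trans (Nat.dvd_of_mod_eq_zero h)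
  have h2 : 2 ^ (r + 1) ∣ 2 ^ r := (Nat.dvd_add_right (Nat.dvd_of_mod_eq_zero ha)).1 h1
  have := (Nat.pow_dvd_pow_iff_le_right (by norm_num)).1 h2
  omega

namespace Routing

variable {n : ℕ} {G : SimpleGraph (Fin n)} (R : Routing G) (Q : ℕ)

/-- In round `r` of the AllReduce, worker `i` sends a vector to worker `j`. In the rounds `r < Q`
the sums over dyadic blocks of `2 ^ r` ranks are merged in pairs towards rank `0`; in the other
rounds the result is spread along the same tree, backwards. -/
def Link (r : ℕ) (i j : Fin n) : Prop :=
  if r < Q then (R.rk i : ℕ) = R.rk j + 2 ^ r ∧ (R.rk j : ℕ) % 2 ^ (r + 1) = 0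
  else (R.rk j : ℕ) = R.rk i + 2 ^ (2 * Q - 1 - r) ∧ (R.rk i : ℕ) % 2 ^ (2 * Q - 1 - r + 1) = 0

variable {R Q} {r r' : ℕ} {i i' j j' k : Fin n}

theorem eq_of_rk_eq (h : (R.rk i : ℕ) = R.rk j) : i = j := R.rk.injective (Fin.ext h)

theorem Link.right_unique (h : R.Link Q r i j) (h' : R.Link Q r i j') : j = j' := by
  unfold Link at h h'
  split_ifs at h h' <;> exact R.eq_of_rk_eq (by omega)

theorem Link.left_unique (h : R.Link Q r i j) (h' : R.Link Q r i' j) : i = i' := by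
  unfold Link at h h'
  split_ifs at h h' <;> exact R.eq_of_rk_eq (by omega)

theorem Link.ne (h : R.Link Q r i j) : i ≠ j := by
  rintro rfl
  unfold Link at h
  have h1 := Nat.two_pow_pos r
  have h2 := Nat.two_pow_pos (2 * Q - 1 - r)
  split_ifs at h <;> omega

/-- Messages that are sent in the same round use different links of the network. -/
theorem Link.eq_of_route (h : R.Link Q r i j) (h' : R.Link Q r i' j') {u v : Fin n}
    (he : R.route i j u v) (he' : R.route i' j' u v) : i = i' := by
  by_cases hr : r < Q
  · have hw : ∀ {i j i' j' : Fin n}, R.Link Q r i j → R.Link Q r i' j' → R.route i j u v →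
        R.route i' j' u v → ¬ R.rk i < R.rk i' := by
      intro i j i' j' h h' he he' hlt
      rw [Link, if_pos hr] at h h'
      have h1 := Nat.two_pow_pos r
      have h2 := Nat.add_le_of_lt_of_mod_eq_zero h.2 h'.2 (by omega)
      rw [pow_succ] at h2
      exact R.disjoint_down j i j' i' u v (by omega) (by omega) (by omega) he he'
    refine R.eq_of_rk_eq ?_
    have h1 := hw h h' he he'
    have h2 := hw h' h he' he
    omega
  · have hw : ∀ {i j i' j' : Fin n}, R.Link Q r i j → R.Link Q r i' j' → R.route i j u v →
        R.route i' j' u v → ¬ R.rk i < R.rk i' := by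
      intro i j i' j' h h' he he' hlt
      rw [Link, if_neg hr] at h h'
      have h1 := Nat.two_pow_pos (2 * Q - 1 - r)
      have h2 := Nat.add_le_of_lt_of_mod_eq_zero h.2 h'.2 (by omega)
      rw [pow_succ] at h2
      exact R.disjoint_up i j i' j' u v (by omega) (by omega) (by omega) he he'
    refine R.eq_of_rk_eq ?_
    have h1 := hw h h' he he'
    have h2 := hw h' h he' he
    omega

/-- A worker sends its partial sum after it has received all contributions. -/
theorem Link.lt_of_reduce (h : R.Link Q r i j) (hr : r < Q) (h' : R.Link Q r' k i) (hr' : r' < Q) :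
    r' < r := by
  rw [Link, if_pos hr] at h
  rw [Link, if_pos hr'] at h'
  by_contra hlt
  have := Nat.add_two_pow_mod_ne_zero h.2 (show r < r' + 1 by omega)
  rw [← h.1] at this
  exact this h'.2

/-- A worker forwards the result after it has received it. -/
theorem Link.lt_of_broadcast (h : R.Link Q r i j) (hr : Q ≤ r) (h' : R.Link Q r' k i)
    (hr' : Q ≤ r') : r' < r := by
  rw [Link, if_neg (not_lt.2 hr)] at h
  rw [Link, if_neg (not_lt.2 hr')] at h'
  by_contra hlt
  have := Nat.add_two_pow_mod_ne_zero h'.2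
    (show 2 * Q - 1 - r' < 2 * Q - 1 - r + 1 by omega)
  rw [← h'.1] at this
  exact this h.2

/-- Every worker of positive rank receives the result in some round. -/
theorem exists_broadcast (hQ : n ≤ 2 ^ Q) (hi : (R.rk i : ℕ) ≠ 0) :
    ∃ p : ℕ × Fin n, Q ≤ p.1 ∧ p.1 < 2 * Q ∧ R.Link Q p.1 p.2 i := by
  obtain ⟨ρ, m, hm, hρ⟩ := Nat.exists_eq_two_pow_mul_odd hi
  obtain ⟨m, rfl⟩ := hm
  have h0 : (R.rk i : ℕ) = 2 ^ (ρ + 1) * m + 2 ^ ρ := by rw [hρ]; ring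
  have hpos := Nat.two_pow_pos ρ
  have hρQ : ρ < Q := by
    refine (Nat.pow_lt_pow_iff_right (a := 2) (by norm_num)).1 ?_
    have := (R.rk i).isLt
    omega
  have hlt : 2 ^ (ρ + 1) * m < n := by
    have := (R.rk i).isLt
    omega
  refine ⟨(2 * Q - 1 - ρ, R.rk.symm ⟨_, hlt⟩), ?_, ?_, ?_⟩
  · simp only; omega
  · simp only; omega
  · rw [Link, if_neg (by simp only; omega)]
    simp only [Equiv.apply_symm_apply]
    rw [show 2 * Q - 1 - (2 * Q - 1 - ρ) = ρ by omega]
    exact ⟨h0, Nat.mul_mod_right _ _⟩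

/-- The worker whose rank exceeds that of `i` by `2 ^ r` contributes the second half of a block. -/
theorem sum_block_succ {M : Type*} [AddCommMonoid M] [DecidableRel (R.Link Q r)] (hr : r < Q)
    (hi : (R.rk i : ℕ) % 2 ^ (r + 1) = 0) (g : Fin n → M) :
    (∑ l with (R.rk i : ℕ) ≤ R.rk l ∧ (R.rk l : ℕ) < R.rk i + 2 ^ r, g l) +
      (∑ j, if R.Link Q r j i then
        ∑ l with (R.rk j : ℕ) ≤ R.rk l ∧ (R.rk l : ℕ) < R.rk j + 2 ^ r, g l else 0) =
    ∑ l with (R.rk i : ℕ) ≤ R.rk l ∧ (R.rk l : ℕ) < R.rk i + 2 ^ (r + 1), g l := by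
  have hpow : 2 ^ (r + 1) = 2 ^ r + 2 ^ r := by rw [pow_succ]; ring
  have hpos := Nat.two_pow_pos r
  have h1 : (∑ j, if R.Link Q r j i then
        ∑ l with (R.rk j : ℕ) ≤ R.rk l ∧ (R.rk l : ℕ) < R.rk j + 2 ^ r, g l else 0) =
      ∑ l with (R.rk i + 2 ^ r : ℕ) ≤ R.rk l ∧ (R.rk l : ℕ) < R.rk i + 2 ^ (r + 1), g l := by
    by_cases hlt : (R.rk i + 2 ^ r : ℕ) < n
    · have hj : ((R.rk (R.rk.symm ⟨_, hlt⟩) : Fin n) : ℕ) = R.rk i + 2 ^ r := by simp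
      have hl : R.Link Q r (R.rk.symm ⟨_, hlt⟩) i := by
        rw [Link, if_pos hr]
        exact ⟨hj, hi⟩
      rw [Finset.sum_eq_single (R.rk.symm ⟨_, hlt⟩), if_pos hl]
      · refine Finset.sum_congr (Finset.filter_congr fun l _ => ?_) fun _ _ => rfl
        rw [hj, hpow]
        omega
      · intro j _ hne
        exact if_neg fun h => hne (h.left_unique hl)
      · simp
    · rw [Finset.sum_eq_zero, Finset.sum_eq_zero]
      · intro l hl
        have := (R.rk l).isLt
        simp only [Finset.mem_filter] at hl
        omega
      · intro j _
        refine if_neg fun h => hlt ?_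
        rw [Link, if_pos hr] at h
        rw [← h.1]
        exact (R.rk j).isLt
  rw [h1, ← Finset.sum_union]
  · refine Finset.sum_congr ?_ fun _ _ => rfl
    ext l
    simp only [Finset.mem_union, Finset.mem_filter, Finset.mem_univ, true_and]
    omega
  · rw [Finset.disjoint_left]
    intro l hl hl'
    simp only [Finset.mem_filter] at hl hl'
    omega

end Routing

/-! ### Transmission in consecutive windows -/

theorem min_sub_min_mono {s t x y : ℝ} (hst : s ≤ t) (hxy : x ≤ y) :
    min t x - min s x ≤ min t y - min s y := by
  rcases le_total t x with h1 | h1 <;> rcases le_total s x with h2 | h2 <;>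
  rcases le_total t y with h3 | h3 <;> rcases le_total s y with h4 | h4 <;>
  simp only [min_eq_left, min_eq_right, h1, h2, h3, h4] <;> linarith

/-- The time elapsed up to `t` in the window `[l, l + D]`. -/
noncomputable def windowTime (l D t : ℝ) : ℝ := min t (l + D) - min t l

theorem windowTime_mono {l D : ℝ} (hD : 0 ≤ D) : Monotone (windowTime l D) := by
  intro s t hst
  have := min_sub_min_mono hst (show l ≤ l + D by linarith)
  unfold windowTime
  linarith

theorem windowTime_of_le {l D t : ℝ} (hD : 0 ≤ D) (h : t ≤ l) : windowTime l D t = 0 := by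
  rw [windowTime, min_eq_left h, min_eq_left (by linarith), sub_self]

theorem windowTime_of_ge {l D t : ℝ} (hD : 0 ≤ D) (h : l + D ≤ t) : windowTime l D t = D := by
  rw [windowTime, min_eq_right h, min_eq_right (by linarith)]
  ring

theorem windowTime_nonneg {l D : ℝ} (hD : 0 ≤ D) (t : ℝ) : 0 ≤ windowTime l D t := by
  unfold windowTime
  have := min_le_min_left t (show l ≤ l + D by linarith)
  linarith

/-- Windows that follow one another elapse one at a time. -/
theorem sum_windowTime_sub_le {l : ℕ → ℝ} {D : ℝ} (hl : ∀ k, l k + D ≤ l (k + 1)) {s t : ℝ}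
    (hst : s ≤ t) (m : ℕ) :
    ∑ k ∈ Finset.range m, (windowTime (l k) D t - windowTime (l k) D s) ≤ t - s := by
  have key : ∑ k ∈ Finset.range m, (windowTime (l k) D t - windowTime (l k) D s) ≤
      min t (l m) - min s (l m) := by
    induction m with
    | zero =>
      rw [Finset.sum_range_zero]
      have := min_le_min_right (l 0) hst
      linarith
    | succ m ih =>
      rw [Finset.sum_range_succ]
      have := min_sub_min_mono hst (hl m)
      unfold windowTime at ih ⊢
      linarith
  have := min_sub_min_mono hst (le_max_left (l m) t)
  rw [min_eq_left (le_max_right (l m) t), min_eq_left (hst.trans (le_max_right (l m) t))] at this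
  exact key.trans this

namespace Routing

variable {n d : ℕ} {N : Network n} (R : Routing N.graph) (Q B : ℕ) (h b : ℝ)

/-! ### The communication plan of Leon SGD -/

/-- Message `κ = 2 Q k + r` of every worker belongs to round `r` of the AllReduce of iteration `k`.
It is launched when the `k + 1` batches of gradients have been computed and all earlier rounds,
which take `d / b` seconds each, are over. -/
noncomputable def launchTime (d Q B : ℕ) (h b : ℝ) (κ : ℕ) : ℝ :=
  ((κ / (2 * Q) : ℕ) + 1) * (B * h) + κ * (d / b)

theorem launchTime_nonneg {h b : ℝ} (hh : 0 ≤ h) (hb : 0 < b) (κ : ℕ) :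
    0 ≤ launchTime d Q B h b κ := by
  unfold launchTime; positivity

theorem launchTime_add_le {h b : ℝ} (hh : 0 ≤ h) (κ : ℕ) :
    launchTime d Q B h b κ + d / b ≤ launchTime d Q B h b (κ + 1) := by
  unfold launchTime
  have h1 : ((κ / (2 * Q) : ℕ) : ℝ) ≤ ((κ + 1) / (2 * Q) : ℕ) := by
    exact_mod_cast Nat.div_le_div_right (Nat.le_succ κ)
  have h2 : (0 : ℝ) ≤ B * h := by positivity
  have h3 := mul_le_mul_of_nonneg_right h1 h2
  push_cast
  nlinarith

theorem launchTime_mul_add (hQ : 0 < Q) (k r : ℕ) (hr : r < 2 * Q) :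
    launchTime d Q B h b (k * (2 * Q) + r) =
      k * (B * h + 2 * Q * (d / b)) + B * h + r * (d / b) := by
  unfold launchTime
  rw [Nat.add_comm, Nat.add_mul_div_right _ _ (by omega), Nat.div_eq_of_lt hr]
  push_cast
  ring

open Classical in
/-- Receiver of the message of worker `i` in round `r`; workers without a task in this round address
a message to themselves that is never transmitted. -/
noncomputable def receiver (r : ℕ) (i : Fin n) : Fin n :=
  if h : ∃ j, R.Link Q r i j then h.choose else i

theorem receiver_eq {r : ℕ} {i j : Fin n} (h : R.Link Q r i j) : R.receiver Q r i = j := by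
  have h' : ∃ j, R.Link Q r i j := ⟨j, h⟩
  rw [receiver, dif_pos h']
  exact h'.choose_spec.right_unique h

/-- The link from `u` to `v` is used in round `r` by the message of worker `i`. -/
def Uses (r : ℕ) (i u v : Fin n) : Prop := ∃ j, R.Link Q r i j ∧ R.route i j u v

open Classical in
/-- The communication plan of the AllReduce: in every round the messages flow at full bandwidth
along disjoint routes. -/
noncomputable def plan (hh : 0 ≤ h) (hb : 0 < b) (hd : 0 < d)
    (hbw : ∀ u v, N.graph.Adj u v → N.bw u v = b) : Plan N d Unit where
  launch _ κ _ := (launchTime d Q B h b κ).toNNReal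
  dest i κ _ := R.receiver Q (κ % (2 * Q)) i
  size _ _ := d
  size_pos _ _ := hd
  index _ _ _ l := l
  coef _ _ _ _ := 1
  flow i κ _ u v t := if R.Uses Q (κ % (2 * Q)) i u v then
    b * windowTime (launchTime d Q B h b κ) (d / b) t else 0
  flow_mono i κ z u v := by
    split_ifs
    · exact (windowTime_mono (by positivity)).const_mul hb.le
    · exact monotone_const
  flow_launch i κ z u v t ht := by
    rw [Real.coe_toNNReal _ (launchTime_nonneg Q B hh hb κ)] at ht
    rw [windowTime_of_le (by positivity) ht, mul_zero, ite_self]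
  flow_dest i κ z v t := by
    refine if_neg ?_
    rintro ⟨j, hj, hE⟩
    rw [R.receiver_eq Q hj] at hE
    exact (R.isRoute i j hj.ne).not_leave v hE
  flow_relay i κ z w t hw := by
    have hW := mul_nonneg hb.le
      (windowTime_nonneg (l := launchTime d Q B h b κ) (show 0 ≤ (d : ℝ) / b by positivity) t)
    have hnn : ∀ u v, 0 ≤ if R.Uses Q (κ % (2 * Q)) i u v then
        b * windowTime (launchTime d Q B h b κ) (d / b) t else 0 := by
      intro u v
      split_ifs
      exacts [hW, le_rfl]
    by_cases hex : ∃ v, R.Uses Q (κ % (2 * Q)) i w v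
    · obtain ⟨v, j, hj, hE⟩ := hex
      have hroute := R.isRoute i j hj.ne
      obtain ⟨u, hu⟩ := hroute.pred w v hw hE
      rw [Finset.sum_eq_single v]
      · refine le_trans (le_of_eq ?_)
          (Finset.single_le_sum (fun u _ => hnn u w) (Finset.mem_univ u))
        rw [if_pos ⟨j, hj, hE⟩, if_pos ⟨j, hj, hu⟩]
      · rintro v' - hne
        refine if_neg ?_
        rintro ⟨j', hj', hE'⟩
        rw [← hj.right_unique hj'] at hE'
        exact hne (hroute.unique w v' v hE' hE)
      · simp
    · rw [Finset.sum_eq_zero fun v _ => if_neg fun hv => hex ⟨v, hv⟩]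
      exact Finset.sum_nonneg fun u _ => hnn u w
  flow_cap S z u v s t hst := by
    have hD : 0 ≤ (d : ℝ) / b := by positivity
    by_cases hadj : N.graph.Adj u v
    · rw [Network.cap, if_pos hadj, hbw u v hadj]
      set w : ℕ → ℝ := fun κ => b * (windowTime (launchTime d Q B h b κ) (d / b) t -
        windowTime (launchTime d Q B h b κ) (d / b) s) with hwdef
      have hw0 : ∀ κ, 0 ≤ w κ := fun κ =>
        mul_nonneg hb.le (sub_nonneg.2 (windowTime_mono hD hst))
      have hterm : ∀ m : Fin n × ℕ, ((if R.Uses Q (m.2 % (2 * Q)) m.1 u v then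
            b * windowTime (launchTime d Q B h b m.2) (d / b) t else 0) -
          if R.Uses Q (m.2 % (2 * Q)) m.1 u v then
            b * windowTime (launchTime d Q B h b m.2) (d / b) s else 0) =
          if R.Uses Q (m.2 % (2 * Q)) m.1 u v then w m.2 else 0 := by
        intro m
        split_ifs
        · simp only [w, mul_sub]
        · exact sub_self 0
      simp only [hterm]
      -- At most one message of every round uses the link, and the rounds do not overlap.
      set X := S.sup Prod.snd + 1
      have hsub : S ⊆ Finset.univ ×ˢ Finset.range X := by
        intro m hm
        have : m.2 ≤ S.sup Prod.snd := Finset.le_sup (f := Prod.snd) hm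
        simp only [Finset.mem_product, Finset.mem_univ, true_and, Finset.mem_range]
        omega
      calc ∑ m ∈ S, (if R.Uses Q (m.2 % (2 * Q)) m.1 u v then w m.2 else 0)
          ≤ ∑ m ∈ Finset.univ ×ˢ Finset.range X,
            (if R.Uses Q (m.2 % (2 * Q)) m.1 u v then w m.2 else 0) := by
            refine Finset.sum_le_sum_of_subset_of_nonneg hsub fun m _ _ => ?_
            split_ifs
            exacts [hw0 _, le_rfl]
        _ = ∑ κ ∈ Finset.range X, ∑ i : Fin n,
            (if R.Uses Q (κ % (2 * Q)) i u v then w κ else 0) := Finset.sum_product_right _ _ _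
        _ ≤ ∑ κ ∈ Finset.range X, w κ := by
            refine Finset.sum_le_sum fun κ _ => ?_
            rw [← Finset.sum_filter, Finset.sum_const, nsmul_eq_mul]
            refine mul_le_of_le_one_left (hw0 κ) ?_
            have : (Finset.univ.filter fun i => R.Uses Q (κ % (2 * Q)) i u v).card ≤ 1 := by
              refine Finset.card_le_one.2 fun i hi i' hi' => ?_
              obtain ⟨j, hj, hE⟩ := (Finset.mem_filter.1 hi).2
              obtain ⟨j', hj', hE'⟩ := (Finset.mem_filter.1 hi').2
              exact hj.eq_of_route hj' hE hE'
            exact_mod_cast this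
        _ ≤ b * (t - s) := by
            rw [hwdef, ← Finset.mul_sum]
            exact mul_le_mul_of_nonneg_left
              (sum_windowTime_sub_le (launchTime_add_le Q B hh) hst X) hb.le
    · have hno : ∀ m : Fin n × ℕ, ¬ R.Uses Q (m.2 % (2 * Q)) m.1 u v := by
        rintro m ⟨j, hj, hE⟩
        exact hadj ((R.isRoute _ _ hj.ne).adj u v hE)
      simp [hno, Network.cap, hadj]
  measurable_launch _ _ := measurable_const
  measurable_dest _ _ := measurable_const
  measurable_index _ _ := measurable_const
  measurable_coef _ _ := measurable_const
  measurable_flow _ _ _ _ _ := measurable_const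

/-! ### Local computations in Leon SGD -/

open Classical in
/-- The average of the own gradients of iteration `k` plus what worker `i` has received in the first
`r` rounds. -/
noncomputable def accumulate (i : Fin n) (k r : ℕ) (V : View n d) : Vec d :=
  (1 / (B : ℝ)) • ∑ j ∈ Finset.range B, V.2.2.1 (k * B + j) +
    ∑ r' ∈ Finset.range r, ∑ j, if R.Link Q r' j i then V.2.2.2 j (k * (2 * Q) + r') else 0

open Classical in
/-- Round and sender of the message by which worker `i` learns the result of an AllReduce. -/
noncomputable def parent (i : Fin n) : ℕ × Fin n :=
  if h : ∃ p : ℕ × Fin n, Q ≤ p.1 ∧ p.1 < 2 * Q ∧ R.Link Q p.1 p.2 i then h.choose else (0, i)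

theorem parent_spec {Q : ℕ} (hQ : n ≤ 2 ^ Q) {i : Fin n} (hi : (R.rk i : ℕ) ≠ 0) :
    Q ≤ (R.parent Q i).1 ∧ (R.parent Q i).1 < 2 * Q ∧
      R.Link Q (R.parent Q i).1 (R.parent Q i).2 i := by
  have h := exists_broadcast hQ hi
  rw [parent, dif_pos h]
  exact h.choose_spec

/-- The iterate `x^k` as computed by worker `i`: the worker of rank `0` takes the step of Leon SGD,
the other workers receive the result. -/
noncomputable def iterate (L : ℝ) (i : Fin n) (V : View n d) : ℕ → Vec d
  | 0 => 0
  | k + 1 => if (R.rk i : ℕ) = 0 then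
      iterate L i V k - ((1 / (2 * L)) / n) • R.accumulate Q B i k Q V
    else V.2.2.2 (R.parent Q i).2 (k * (2 * Q) + (R.parent Q i).1)

theorem measurable_accumulate (i : Fin n) (k r : ℕ) :
    Measurable (R.accumulate (d := d) Q B i k r) := by
  unfold accumulate
  have h1 : ∀ m, Measurable fun V : View n d => V.2.2.1 m := fun m =>
    (measurable_pi_apply m).comp measurable_snd.snd.fst
  have h2 : ∀ j m, Measurable fun V : View n d => V.2.2.2 j m := fun j m =>
    (measurable_pi_apply m).comp ((measurable_pi_apply j).comp measurable_snd.snd.snd)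
  refine Measurable.add (by fun_prop) (Finset.measurable_fun_sum _ fun r' _ =>
    Finset.measurable_fun_sum _ fun j _ => ?_)
  split_ifs
  exacts [h2 _ _, measurable_const]

theorem measurable_iterate (L : ℝ) (i : Fin n) (k : ℕ) :
    Measurable fun V : View n d => R.iterate Q B L i V k := by
  induction k with
  | zero => exact measurable_const
  | succ k ih =>
    simp only [iterate]
    split_ifs
    · have := R.measurable_accumulate (d := d) Q B i k Q
      fun_prop
    · exact (measurable_pi_apply _).comp ((measurable_pi_apply _).comp measurable_snd.snd.snd)

theorem accumulate_eq_zero {V : View n d} {c : Fin d} (hc : c ∉ View.support V) (i : Fin n)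
    (k r : ℕ) : R.accumulate Q B i k r V c = 0 := by
  simp only [View.support, Set.mem_ofPred_eq, not_or, not_exists, not_not] at hc
  unfold accumulate
  rw [PiLp.add_apply, PiLp.smul_apply, WithLp.ofLp_sum, WithLp.ofLp_sum, Finset.sum_apply,
    Finset.sum_apply, Finset.sum_eq_zero fun j _ => hc.1 _, Finset.sum_eq_zero, smul_zero,
    add_zero]
  intro r' _
  rw [WithLp.ofLp_sum, Finset.sum_apply]
  refine Finset.sum_eq_zero fun j _ => ?_
  split_ifs
  exacts [hc.2 _ _, rfl]

theorem iterate_eq_zero (L : ℝ) {V : View n d} {c : Fin d} (hc : c ∉ View.support V) (i : Fin n)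
    (k : ℕ) : R.iterate Q B L i V k c = 0 := by
  induction k with
  | zero => rfl
  | succ k ih =>
    simp only [iterate]
    split_ifs
    · rw [PiLp.sub_apply, PiLp.smul_apply, ih, R.accumulate_eq_zero Q B hc, smul_zero, sub_zero]
    · simp only [View.support, Set.mem_ofPred_eq, not_or, not_exists, not_not] at hc
      exact hc.2 _ _

/-- Leon SGD with AllReduce along a tree whose edges are routed through the network. -/
noncomputable def leonAlgorithm (L : ℝ) (hh : 0 ≤ h) (hb : 0 < b) (hd : 0 < d)
    (hbw : ∀ u v, N.graph.Adj u v → N.bw u v = b) : Algorithm N d where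
  Z := Unit
  seed := Measure.dirac ()
  plan := R.plan Q B h b hh hb hd hbw
  query i m _ V := R.iterate Q B L i V (m / B)
  wait _ m _ _ := if (m + 1) % B = 0 then (2 * Q * (d / b)).toNNReal else 0
  send i κ _ V := if κ % (2 * Q) < Q then R.accumulate Q B i (κ / (2 * Q)) Q V
    else R.iterate Q B L i V (κ / (2 * Q) + 1)
  measurable_query i m := (R.measurable_iterate Q B L i _).comp measurable_snd
  measurable_wait i m := measurable_const
  measurable_send i κ := by
    split_ifs
    · exact (R.measurable_accumulate Q B i _ Q).comp measurable_snd
    · exact (R.measurable_iterate Q B L i _).comp measurable_snd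
  query_support i m z V c hc := by
    by_contra hn
    exact hc (R.iterate_eq_zero Q B L hn i _)
  send_support i κ z V c hc := by
    by_contra hn
    split_ifs at hc
    · exact hc (R.accumulate_eq_zero Q B hn i _ Q)
    · exact hc (R.iterate_eq_zero Q B L hn i _)

end Routing

/-! ### Executions of Leon SGD -/

/-- The iterate of Leon SGD in terms of the workers' batch averages. -/
theorem leonIterate_succ_eq {n d : ℕ} (P : Problem n d) (L : ℝ) (B k : ℕ) (ξ : Fin n × ℕ → P.Ξ) :
    leonIterate P L B ξ (k + 1) = leonIterate P L B ξ k - ((1 / (2 * L)) / n) • ∑ i,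
      (1 / (B : ℝ)) • ∑ j ∈ Finset.range B,
        P.oracle i (leonIterate P L B ξ k) (ξ (i, k * B + j)) := rfl

namespace Routing

variable {n d Q B : ℕ} {N : Network n} (R : Routing N.graph) {h b L : ℝ}
  (hh : 0 ≤ h) (hb : 0 < b) (hd : 0 < d) (hbw : ∀ u v, N.graph.Adj u v → N.bw u v = b)
  (P : Problem n d) (ω : (R.leonAlgorithm Q B h b L hh hb hd hbw).Outcome P)

/-- Iteration `k` starts at the `k`-th multiple of the time for a batch of gradients and the
`2 Q` rounds of an AllReduce. -/
theorem start_leonAlgorithm (hB : 0 < B) (htime : ∀ i, N.time i = h) (i : Fin n) (k j : ℕ)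
    (hj : j < B) : ((R.leonAlgorithm Q B h b L hh hb hd hbw).run P ω).start i (k * B + j) =
      k * (B * h + 2 * Q * (d / b)) + j * h := by
  have hrun := Algorithm.isRun_run (R.leonAlgorithm Q B h b L hh hb hd hbw) P ω
  set r := (R.leonAlgorithm Q B h b L hh hb hd hbw).run P ω
  have hwait : ∀ m, r.start i (m + 1) = r.start i m + h +
      ((if (m + 1) % B = 0 then (2 * Q * (d / b) : ℝ).toNNReal else 0 : ℝ≥0) : ℝ) := by
    intro m
    rw [hrun.start_succ, htime]
    rfl
  have hin : ∀ k j, j < B → r.start i (k * B + j) = r.start i (k * B) + j * h := by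
    intro k j hj
    induction j with
    | zero => simp
    | succ j ih =>
      rw [← add_assoc, hwait, ih (by omega), if_neg]
      · push_cast; ring
      · rw [add_assoc, Nat.add_comm, Nat.add_mul_mod_self_right, Nat.mod_eq_of_lt hj]
        omega
  rw [hin k j hj]
  congr 1
  clear hj
  induction k with
  | zero => rw [Nat.zero_mul, hrun.start_zero]; simp
  | succ k ih =>
    have e : (k + 1) * B = k * B + (B - 1) + 1 := by
      rw [Nat.add_mul, Nat.one_mul]; omega
    rw [e, hwait, ← e, if_pos (Nat.mul_mod_left _ _), hin k (B - 1) (by omega), ih,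
      Real.coe_toNNReal _ (by positivity), Nat.cast_sub hB]
    push_cast
    ring

theorem view_gradient (hB : 0 < B) (htime : ∀ i, N.time i = h) (i : Fin n) (k j : ℕ) (hj : j < B)
    {t : ℝ} (ht : k * (B * h + 2 * Q * (d / b)) + B * h ≤ t) :
    ((R.leonAlgorithm Q B h b L hh hb hd hbw).view P ω
      ((R.leonAlgorithm Q B h b L hh hb hd hbw).run P ω) i t).2.2.1 (k * B + j) =
    P.oracle i (((R.leonAlgorithm Q B h b L hh hb hd hbw).run P ω).point i (k * B + j))
      (ω.2 (i, k * B + j)) := by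
  refine if_pos ?_
  rw [R.start_leonAlgorithm hh hb hd hbw P ω hB htime i k j hj, htime]
  have : ((j + 1 : ℕ) : ℝ) ≤ B := by exact_mod_cast hj
  push_cast at this
  nlinarith

theorem decode_id (i : Fin n) (κ : ℕ) (s : Vec d) :
    (R.plan Q B h b hh hb hd hbw).decode () i κ s = s := by
  change ∑ l, EuclideanSpace.single l (1 * s l) = s
  ext c
  rw [WithLp.ofLp_sum, Finset.sum_apply, Finset.sum_eq_single c]
  · simp
  · intro l _ hne
    simp [hne.symm]
  · simp

open Classical in
/-- A message is available to its receiver `d / b` seconds after its launch. -/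
theorem view_message {i j : Fin n} {κ : ℕ} (hl : R.Link Q (κ % (2 * Q)) i j)
    {t : ℝ} (ht : launchTime d Q B h b κ + d / b ≤ t) :
    ((R.leonAlgorithm Q B h b L hh hb hd hbw).view P ω
      ((R.leonAlgorithm Q B h b L hh hb hd hbw).run P ω) j t).2.2.2 i κ =
    ((R.leonAlgorithm Q B h b L hh hb hd hbw).run P ω).sent i κ := by
  have hD : 0 ≤ (d : ℝ) / b := by positivity
  have hdel : (R.plan Q B h b hh hb hd hbw).Delivered () i κ j t := by
    refine ⟨R.receiver_eq Q hl, ?_⟩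
    obtain ⟨u, hu⟩ := (R.isRoute i j hl.ne).reach hl.ne
    have h1 : (d : ℝ) = (R.plan Q B h b hh hb hd hbw).flow i κ () u j t := by
      change _ = if R.Uses Q (κ % (2 * Q)) i u j then _ else _
      rw [if_pos ⟨j, hl, hu⟩, windowTime_of_ge hD ht]
      field_simp
    change (d : ℝ) ≤ _
    refine h1.le.trans (Finset.single_le_sum
      (f := fun u => (R.plan Q B h b hh hb hd hbw).flow i κ () u j t) (fun v _ => ?_)
      (Finset.mem_univ u))
    change 0 ≤ if R.Uses Q (κ % (2 * Q)) i v j then _ else _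
    split_ifs
    · exact mul_nonneg hb.le (windowTime_nonneg hD t)
    · exact le_rfl
  refine (if_pos hdel).trans ?_
  exact R.decode_id hh hb hd hbw i κ _

theorem sent_leonAlgorithm (hQ : 0 < Q) (i : Fin n) (k r : ℕ) (hr : r < 2 * Q) :
    ((R.leonAlgorithm Q B h b L hh hb hd hbw).run P ω).sent i (k * (2 * Q) + r) =
    if r < Q then R.accumulate Q B i k Q ((R.leonAlgorithm Q B h b L hh hb hd hbw).view P ω
      ((R.leonAlgorithm Q B h b L hh hb hd hbw).run P ω) i
      (k * (B * h + 2 * Q * (d / b)) + B * h + r * (d / b)))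
    else R.iterate Q B L i ((R.leonAlgorithm Q B h b L hh hb hd hbw).view P ω
      ((R.leonAlgorithm Q B h b L hh hb hd hbw).run P ω) i
      (k * (B * h + 2 * Q * (d / b)) + B * h + r * (d / b))) (k + 1) := by
  have hrun := Algorithm.isRun_run (R.leonAlgorithm Q B h b L hh hb hd hbw) P ω
  have hdiv : (k * (2 * Q) + r) / (2 * Q) = k := by
    rw [Nat.add_comm, Nat.add_mul_div_right _ _ (by omega), Nat.div_eq_of_lt hr, Nat.zero_add]
  have hmod : (k * (2 * Q) + r) % (2 * Q) = r := by
    rw [Nat.add_comm, Nat.add_mul_mod_self_right, Nat.mod_eq_of_lt hr]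
  have hl : (((launchTime d Q B h b (k * (2 * Q) + r)).toNNReal : ℝ≥0) : ℝ) =
      k * (B * h + 2 * Q * (d / b)) + B * h + r * (d / b) := by
    rw [Real.coe_toNNReal _ (launchTime_nonneg Q B hh hb _), launchTime_mul_add Q B h b hQ k r hr]
  rw [hrun.sent_eq]
  change (if (k * (2 * Q) + r) % (2 * Q) < Q then _ else _) = _
  rw [hdiv, hmod]
  change (if r < Q then R.accumulate Q B i k Q ((R.leonAlgorithm Q B h b L hh hb hd hbw).view P ω _ i
    (((launchTime d Q B h b (k * (2 * Q) + r)).toNNReal : ℝ≥0) : ℝ)) else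
    R.iterate Q B L i ((R.leonAlgorithm Q B h b L hh hb hd hbw).view P ω _ i
    (((launchTime d Q B h b (k * (2 * Q) + r)).toNNReal : ℝ≥0) : ℝ)) (k + 1)) = _
  rw [hl]

open Classical in
/-- All workers know `x^k` when iteration `k` starts. By induction on `r`, after round `r` of the first
half of the AllReduce the workers whose rank is divisible by `2 ^ (r + 1)` hold the sum over a block
of `2 ^ (r + 1)` ranks; the worker of rank `0` takes the step, and by induction on the round the
result reaches the other workers. -/
theorem iterate_view (hB : 0 < B) (hQ : 0 < Q) (hnQ : n ≤ 2 ^ Q) (htime : ∀ i, N.time i = h)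
    (k : ℕ) (i : Fin n) {t : ℝ} (ht : k * (B * h + 2 * Q * (d / b)) ≤ t) :
    R.iterate Q B L i ((R.leonAlgorithm Q B h b L hh hb hd hbw).view P ω
      ((R.leonAlgorithm Q B h b L hh hb hd hbw).run P ω) i t) k = leonIterate P L B ω.2 k := by
  have hpt := (Algorithm.isRun_run (R.leonAlgorithm Q B h b L hh hb hd hbw) P ω).point_eq
  have hsent := R.sent_leonAlgorithm (B := B) (L := L) hh hb hd hbw P ω hQ
  have hmsg := fun {i j : Fin n} {κ : ℕ} (hl : R.Link Q (κ % (2 * Q)) i j) {t : ℝ} ht =>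
    R.view_message (B := B) (L := L) hh hb hd hbw P ω hl (t := t) ht
  have hgrad := R.view_gradient (Q := Q) (L := L) hh hb hd hbw P ω hB htime
  have hstart := R.start_leonAlgorithm (Q := Q) (L := L) hh hb hd hbw P ω hB htime
  set run := (R.leonAlgorithm Q B h b L hh hb hd hbw).run P ω
  obtain ⟨view, hview⟩ : ∃ view : Fin n → ℝ → View n d, ∀ i t,
    (R.leonAlgorithm Q B h b L hh hb hd hbw).view P ω run i t = view i t := ⟨_, fun _ _ => rfl⟩
  simp only [hview] at hpt hsent hmsg hgrad ⊢
  have hD : 0 ≤ (d : ℝ) / b := by positivity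
  have hBh : 0 ≤ B * h := by positivity
  induction k generalizing i t with
  | zero => rfl
  | succ k ih =>
    set X := leonIterate P L B ω.2 k with hX
    set τ : ℝ := k * (B * h + 2 * Q * (d / b)) + B * h with hτ
    have hmod : ∀ r < 2 * Q, (k * (2 * Q) + r) % (2 * Q) = r := fun r hr => by
      rw [Nat.add_comm, Nat.add_mul_mod_self_right, Nat.mod_eq_of_lt hr]
    have hmsg' : ∀ {i j : Fin n} {r : ℕ}, R.Link Q r i j → r < 2 * Q → ∀ {t : ℝ},
        τ + (r + 1 : ℕ) * (d / b) ≤ t →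
        (view j t).2.2.2 i (k * (2 * Q) + r) = run.sent i (k * (2 * Q) + r) := by
      intro i j r hl hr t ht
      refine hmsg (by rwa [hmod r hr]) ?_
      rw [launchTime_mul_add Q B h b hQ k r hr, ← hτ]
      push_cast at ht
      linarith
    have hpoint : ∀ i j, j < B → run.point i (k * B + j) = X := by
      intro i j hj
      rw [hpt]
      change R.iterate Q B L i _ ((k * B + j) / B) = _
      have hdiv : (k * B + j) / B = k := by
        rw [Nat.add_comm, Nat.add_mul_div_right _ _ hB, Nat.div_eq_of_lt hj, Nat.zero_add]
      rw [hdiv]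
      refine ih i ?_
      rw [hstart i k j hj]
      have : 0 ≤ j * h := by positivity
      linarith
    let g : Fin n → Vec d := fun i =>
      (1 / (B : ℝ)) • ∑ j ∈ Finset.range B, P.oracle i X (ω.2 (i, k * B + j))
    -- A worker that sends in round `r` has received everything in the rounds before.
    have htrunc : ∀ {i j : Fin n} {r : ℕ}, R.Link Q r i j → r < Q → ∀ V : View n d,
        R.accumulate Q B i k Q V = R.accumulate Q B i k r V := by
      intro i j r hl hr V
      unfold accumulate
      congr 1
      symm
      refine Finset.sum_subset (Finset.range_mono hr.le) fun r' hr' hr'' => ?_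
      rw [Finset.mem_range] at hr' hr''
      refine Finset.sum_eq_zero fun j' _ => if_neg fun hl' => hr'' ?_
      exact hl.lt_of_reduce hr hl' hr'
    have hacc : ∀ r ≤ Q, ∀ (i : Fin n), (R.rk i : ℕ) % 2 ^ r = 0 → ∀ t : ℝ,
        τ + r * (d / b) ≤ t → R.accumulate Q B i k r (view i t) =
        ∑ l with (R.rk i : ℕ) ≤ R.rk l ∧ (R.rk l : ℕ) < R.rk i + 2 ^ r, g l := by
      intro r
      induction r with
      | zero =>
        intro _ i _ t ht
        have hfil : (Finset.univ.filter fun l =>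
            (R.rk i : ℕ) ≤ R.rk l ∧ (R.rk l : ℕ) < R.rk i + 2 ^ 0) = {i} := by
          ext l
          simp only [Finset.mem_filter, Finset.mem_univ, true_and, Finset.mem_singleton]
          constructor
          · rintro ⟨h1, h2⟩
            exact R.eq_of_rk_eq (by omega)
          · rintro rfl
            simp
        rw [hfil, Finset.sum_singleton, accumulate, Finset.sum_range_zero, add_zero]
        refine congrArg _ (Finset.sum_congr rfl fun j hj => ?_)
        rw [Finset.mem_range] at hj
        rw [hgrad i k j hj (by rw [← hτ]; simpa using ht), hpoint i j hj]
      | succ r ihr =>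
        intro hr i hi t ht
        have hr0 : (R.rk i : ℕ) % 2 ^ r = 0 :=
          Nat.mod_eq_zero_of_dvd ((pow_dvd_pow 2 r.le_succ).trans (Nat.dvd_of_mod_eq_zero hi))
        have ht' : τ + r * (d / b) ≤ t := by
          push_cast at ht
          linarith
        have e1 : R.accumulate Q B i k (r + 1) (view i t) =
            R.accumulate Q B i k r (view i t) + ∑ j, if R.Link Q r j i then
              (view i t).2.2.2 j (k * (2 * Q) + r) else 0 := by
          simp only [accumulate]
          rw [Finset.sum_range_succ, add_assoc]
        rw [e1, ihr (by omega) i hr0 t ht', ← R.sum_block_succ (Q := Q) (by omega) hi]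
        congr 1
        refine Finset.sum_congr rfl fun j _ => ?_
        split_ifs with hl
        · have hj : (R.rk j : ℕ) % 2 ^ r = 0 := by
            rw [Link, if_pos (by omega)] at hl
            rw [hl.1, Nat.add_mod_right]
            exact hr0
          rw [hmsg' hl (by omega) ht, hsent j k r (by omega), if_pos (by omega),
            htrunc hl (by omega)]
          exact ihr (by omega) j hj _ (by rw [hτ])
        · rfl
    have hroot : ∀ i, (R.rk i : ℕ) = 0 → ∀ t : ℝ, τ + Q * (d / b) ≤ t →
        R.iterate Q B L i (view i t) (k + 1) = leonIterate P L B ω.2 (k + 1) := by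
      intro i hi t ht
      have ht' : k * (B * h + 2 * Q * (d / b)) ≤ t := by
        have : 0 ≤ Q * (d / b) := by positivity
        linarith
      have hall : (Finset.univ.filter fun l =>
          (R.rk i : ℕ) ≤ R.rk l ∧ (R.rk l : ℕ) < R.rk i + 2 ^ Q) = Finset.univ := by
        refine Finset.filter_true_of_mem fun l _ => ?_
        have := (R.rk l).isLt
        omega
      rw [iterate, if_pos hi, ih i ht', hacc Q le_rfl i (by rw [hi, Nat.zero_mod]) t ht, hall,
        leonIterate_succ_eq]
    have hinf : ∀ r ≤ 2 * Q, ∀ i : Fin n, Q ≤ r → ((R.rk i : ℕ) ≠ 0 → (R.parent Q i).1 < r) →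
        ∀ t : ℝ, τ + r * (d / b) ≤ t →
        R.iterate Q B L i (view i t) (k + 1) = leonIterate P L B ω.2 (k + 1) := by
      intro r
      induction r using Nat.strong_induction_on with
      | _ r ihr =>
        intro hr i hQr hpar t ht
        by_cases hi : (R.rk i : ℕ) = 0
        · refine hroot i hi t ?_
          have : (Q : ℝ) * (d / b) ≤ r * (d / b) := by gcongr
          linarith
        · obtain ⟨h1, h2, h3⟩ := R.parent_spec hnQ hi
          have hlt := hpar hi
          have ht' : τ + ((R.parent Q i).1 + 1 : ℕ) * (d / b) ≤ t := by
            have : (((R.parent Q i).1 + 1 : ℕ) : ℝ) * (d / b) ≤ r * (d / b) := by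
              gcongr
              exact_mod_cast hlt
            linarith
          rw [iterate, if_neg hi, hmsg' h3 h2 ht', hsent _ k _ h2, if_neg (by omega)]
          refine ihr _ hlt (by omega) _ h1 (fun hne => ?_) _ (by rw [hτ])
          obtain ⟨h4, -, h5⟩ := R.parent_spec hnQ hne
          exact h3.lt_of_broadcast h1 h5 h4
    refine hinf (2 * Q) le_rfl i (by omega) (fun hne => (R.parent_spec hnQ hne).2.1) t ?_
    rw [hτ]
    push_cast at ht ⊢
    linarith

theorem point_leonAlgorithm (hB : 0 < B) (hQ : 0 < Q) (hnQ : n ≤ 2 ^ Q)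
    (htime : ∀ i, N.time i = h) (i : Fin n) (k j : ℕ) (hj : j < B) :
    ((R.leonAlgorithm Q B h b L hh hb hd hbw).run P ω).point i (k * B + j) =
      leonIterate P L B ω.2 k := by
  have hrun := Algorithm.isRun_run (R.leonAlgorithm Q B h b L hh hb hd hbw) P ω
  have hdiv : (k * B + j) / B = k := by
    rw [Nat.add_comm, Nat.add_mul_div_right _ _ hB, Nat.div_eq_of_lt hj, Nat.zero_add]
  rw [hrun.point_eq]
  change R.iterate Q B L i _ ((k * B + j) / B) = _
  rw [hdiv]
  refine R.iterate_view hh hb hd hbw P ω hB hQ hnQ htime k i ?_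
  rw [R.start_leonAlgorithm hh hb hd hbw P ω hB htime i k j hj]
  have : 0 ≤ j * h := by positivity
  linarith

end Routing

/-! ### The time of Leon SGD -/

/-- For equal computation times the batch condition is a lower bound for the common batch size. -/
theorem leonBatch_set_eq {n : ℕ} (hn : 0 < n) (σ ε : ℝ) :
    {B : ℕ | 1 ≤ B ∧ max (⌈σ ^ 2 / ε⌉₊ : ℝ) n / n ≤ ((1 / (n : ℝ)) * ∑ _i : Fin n, 1 / (B : ℝ))⁻¹} =
      {B : ℕ | 1 ≤ B ∧ max (⌈σ ^ 2 / ε⌉₊ : ℝ) n / n ≤ B} := by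
  have hn' : (n : ℝ) ≠ 0 := by exact_mod_cast hn.ne'
  ext B
  rw [Set.mem_ofPred_eq, Set.mem_ofPred_eq, Finset.sum_const, Finset.card_univ, Fintype.card_fin,
    nsmul_eq_mul, ← mul_assoc, one_div_mul_cancel hn', one_mul, one_div, inv_inv]

theorem leonBatch_spec {n : ℕ} (hn : 0 < n) (σ ε : ℝ) :
    0 < leonBatch n σ ε ∧ σ ^ 2 / ε ≤ n * leonBatch n σ ε := by
  have hn' : (0 : ℝ) < n := by exact_mod_cast hn
  have hne : {B : ℕ | 1 ≤ B ∧ max (⌈σ ^ 2 / ε⌉₊ : ℝ) n / n ≤ B}.Nonempty :=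
    ⟨⌈max (⌈σ ^ 2 / ε⌉₊ : ℝ) n / n⌉₊ + 1, by omega, (Nat.le_ceil _).trans (by push_cast; linarith)⟩
  have h := Nat.sInf_mem hne
  rw [← leonBatch_set_eq hn] at h
  have h' : leonBatch n σ ε ∈ {B : ℕ | 1 ≤ B ∧ max (⌈σ ^ 2 / ε⌉₊ : ℝ) n / n ≤ B} := by
    rw [← leonBatch_set_eq hn]; exact h
  refine ⟨h'.1, ?_⟩
  have h2 := h'.2
  rw [div_le_iff₀ hn'] at h2
  have h3 := le_max_left (⌈σ ^ 2 / ε⌉₊ : ℝ) n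
  have h4 := Nat.le_ceil (σ ^ 2 / ε)
  linarith

theorem leonBatch_le {n : ℕ} (hn : 0 < n) (σ : ℝ) {ε : ℝ} (hε : 0 < ε) :
    (leonBatch n σ ε : ℝ) ≤ σ ^ 2 / (n * ε) + 3 := by
  have hn' : (1 : ℝ) ≤ n := by exact_mod_cast hn
  have h0 : 0 ≤ σ ^ 2 / ε := by positivity
  set y := max (⌈σ ^ 2 / ε⌉₊ : ℝ) n / n with hy
  have hy0 : 1 ≤ y := by
    rw [hy, le_div_iff₀ (by linarith), one_mul]
    exact le_max_right _ _
  have h1 : leonBatch n σ ε ≤ ⌈y⌉₊ := by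
    unfold leonBatch
    rw [leonBatch_set_eq hn]
    exact Nat.sInf_le ⟨Nat.one_le_ceil_iff.2 (by linarith), Nat.le_ceil _⟩
  have h2 := (Nat.ceil_lt_add_one (show 0 ≤ y by linarith)).le
  have h3 : y ≤ σ ^ 2 / (n * ε) + 2 := by
    rw [hy, div_le_iff₀ (by linarith)]
    have h4 := (Nat.ceil_lt_add_one h0).le
    have e : (σ ^ 2 / (n * ε) + 2) * n = σ ^ 2 / ε + 2 * n := by
      field_simp
    rw [e]
    exact max_le (by linarith) (by linarith)
  have h5 : (leonBatch n σ ε : ℝ) ≤ ⌈y⌉₊ := by exact_mod_cast h1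
  linarith

namespace Algorithm

variable {n d : ℕ} {N : Network n} {A : Algorithm N d} {P : Problem n d} {L σ ε T : ℝ}

/-- The best iterate is at least as good as a random one. -/
theorem timeTo_le_of_leonFindsBy (hn : 0 < n) (hA : A.IsLeonSGD L σ ε)
    (hT : A.LeonFindsBy P L (leonBatch n σ ε) ε T) : A.timeTo P ε ≤ ENNReal.ofReal T := by
  obtain ⟨K, hK, hstart, havg⟩ := hT
  obtain ⟨hB, -⟩ := leonBatch_spec hn σ ε
  refine iInf₂_le_of_le T.toNNReal (le_trans ?_ havg) le_rfl
  have hK0 : (K : ℝ≥0∞) ≠ 0 := by simpa using hK.ne'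
  have hT' : T ≤ (T.toNNReal : ℝ) := Real.le_coe_toNNReal T
  have hmem : ∀ ω : A.Outcome P, ∀ k < K,
      leonIterate P L (leonBatch n σ ε) ω.2 k ∈ A.reachable P ω T.toNNReal := by
    intro ω k hk
    have hrun := A.isRun_run P ω
    have hpt := hA P ω ⟨0, hn⟩ k 0 hB
    rw [add_zero] at hpt
    refine ⟨⟨0, hn⟩, fun c hc => ?_⟩
    rw [← hpt] at hc
    exact support_view_mono ((hstart ω ⟨0, hn⟩ k hk).trans hT') (hrun.point_support hc)
  rw [ENNReal.le_div_iff_mul_le (Or.inl hK0) (Or.inl (ENNReal.natCast_ne_top K)), mul_comm,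
    ← nsmul_eq_mul]
  have hle : ∀ k ∈ Finset.range K, A.expectedBest P T.toNNReal ≤ ∫⁻ ω, ENNReal.ofReal
      (‖gradient P.objective (leonIterate P L (leonBatch n σ ε) ω.2 k)‖ ^ 2) ∂(A.prob P) :=
    fun k hk => lintegral_mono fun ω => iInf₂_le _ (hmem ω k (Finset.mem_range.1 hk))
  simpa using Finset.card_nsmul_le_sum _ _ _ hle

/-- It remains to bound the starting times of the iterations. -/
theorem leonFindsBy_of_start_le {Δ : ℝ} (hn : 0 < n) (hP : P.Heterogeneous L Δ σ) (hL : 0 < L)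
    (hΔ : 0 < Δ) (hε : 0 < ε)
    (hstart : ∀ (ω : A.Outcome P) (i : Fin n) (k : ℕ), (k : ℝ) ≤ 4 * L * Δ / ε →
      (A.run P ω).start i (k * leonBatch n σ ε) ≤ T) :
    A.LeonFindsBy P L (leonBatch n σ ε) ε T := by
  obtain ⟨hB, hBσ⟩ := leonBatch_spec hn σ ε
  have hK : 0 < ⌈4 * L * Δ / ε⌉₊ := Nat.ceil_pos.2 (by positivity)
  refine ⟨⌈4 * L * Δ / ε⌉₊, hK, fun ω i k hk => hstart ω i k (Nat.lt_ceil.1 hk).le, ?_⟩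
  refine le_trans (le_of_eq ?_)
    (Problem.sum_lintegral_gradient_leonIterate_le hP hL hε hn hB hBσ hK (Nat.le_ceil _))
  congr 1
  refine Finset.sum_congr rfl fun k _ => ?_
  have hmp : MeasurePreserving Prod.snd (A.prob P) P.samples := measurePreserving_snd
  have hm : Measurable fun ξ => ENNReal.ofReal
      (‖gradient P.objective (leonIterate P L (leonBatch n σ ε) ξ k)‖ ^ 2) :=
    (((hP.continuous_gradient hL.le).measurable.comp
      (P.measurable_leonIterate _ k)).norm.pow_const 2).ennreal_ofReal
  exact hmp.lintegral_comp hm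

end Algorithm

theorem natLog_add_one_le {n : ℕ} (hn : 0 < n) :
    ((Nat.log 2 n + 1 : ℕ) : ℝ) ≤ 3 * Real.log (n + 1) := by
  have hlam := log_two_le_log_add_one hn
  have h1 : ((2 : ℝ) ^ Nat.log 2 n) ≤ n + 1 := by
    have : 2 ^ Nat.log 2 n ≤ n := Nat.pow_log_le_self 2 hn.ne'
    have : ((2 ^ Nat.log 2 n : ℕ) : ℝ) ≤ n := by exact_mod_cast this
    push_cast at this
    linarith
  have h2 := Real.log_le_log (by positivity) h1
  rw [Real.log_pow] at h2
  have h3 := Real.log_two_gt_d9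
  have h4 : (Nat.log 2 n : ℝ) * 0.69 ≤ Nat.log 2 n * Real.log 2 :=
    mul_le_mul_of_nonneg_left (by linarith) (Nat.cast_nonneg _)
  push_cast
  linarith

/-- The time of `4 L Δ / ε` iterations of Leon SGD. -/
theorem iterations_mul_le_sparseRate {n d : ℕ} {h b L Δ σ ε k : ℝ} (hn : 0 < n) (hh : 0 < h)
    (hb : 0 < b) (hL : 0 < L) (hΔ : 0 < Δ) (hε : 0 < ε) (hk : k ≤ 4 * L * Δ / ε) :
    k * (leonBatch n σ ε * h + 2 * (Nat.log 2 n + 1 : ℕ) * (d / b)) ≤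
      200 * Real.log (n + 1) ^ 5 * sparseRate n d h b L Δ σ ε := by
  have hlam := log_two_le_log_add_one hn
  have hQ := natLog_add_one_le hn
  have hB := leonBatch_le hn σ hε
  have hn' : (0 : ℝ) < n := by exact_mod_cast hn
  rw [sparseRate_eq hb hε]
  set lam := Real.log (n + 1)
  have hX : 0 < L * Δ / ε := by positivity
  have hkX : k ≤ 4 * (L * Δ / ε) := hk.trans_eq (by ring)
  set X := L * Δ / ε
  have h5 : (0.15 : ℝ) ≤ lam ^ 5 := le_trans (by norm_num) (pow_le_pow_left₀ (by norm_num) hlam 5)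
  have h4 : (0.2 : ℝ) ≤ lam ^ 4 := le_trans (by norm_num) (pow_le_pow_left₀ (by norm_num) hlam 4)
  have hD : 0 ≤ (d : ℝ) / b * X := by positivity
  have hS : 0 ≤ h * σ ^ 2 / (n * ε) * X := by positivity
  have hH : 0 ≤ h * X := by positivity
  have hlD : 0 ≤ lam * ((d : ℝ) / b * X) := by positivity
  have e1 := mul_le_mul_of_nonneg_right h4 hlD
  have e2 := mul_le_mul_of_nonneg_right h5 hS
  have e3 := mul_le_mul_of_nonneg_right h5 hH
  calc k * (leonBatch n σ ε * h + 2 * (Nat.log 2 n + 1 : ℕ) * (d / b))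
      ≤ 4 * X * ((σ ^ 2 / (n * ε) + 3) * h + 2 * (3 * lam) * (d / b)) := by gcongr
    _ = 4 * (h * σ ^ 2 / (n * ε) * X) + 12 * (h * X) + 24 * (lam * (d / b * X)) := by ring
    _ ≤ 200 * (lam ^ 5 * (h * σ ^ 2 / (n * ε) * X)) + 200 * (lam ^ 5 * (h * X)) +
        200 * (lam ^ 4 * (lam * (d / b * X))) := by linarith
    _ = _ := by ring

theorem mainTheorem7 :
    ∃ (q : ℕ) (c₁ c₃ : ℝ), 0 < c₁ ∧ 0 < c₃ ∧
    ∀ (p : ℕ) (c₀ : ℝ), 0 < c₀ → ∃ c C : ℝ, 0 < c ∧ 0 < C ∧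
    ∀ (n d : ℕ) (N : Network n) (h b L Δ σ ε : ℝ),
      0 < h → 0 < b → 0 < L → 0 < Δ → 0 ≤ σ → 0 < ε →
      (∀ i, N.time i = h) →
      (∀ v, (N.graph.neighborSet v).ncard ≤ p) →
      (∀ u v, N.graph.Adj u v → N.bw u v = b) →
      c₀ * (d / (b * h)) ≤ σ ^ 2 / ε →
      c₁ * Real.log (n + 1) ^ 10 ≤ L * Δ / ε →
      c₃ * (L * Δ) / (Real.log (n + 1) ^ 3 * ε) ≤ d →
      (∀ s : Setting,
        ENNReal.ofReal (c / Real.log (n + 1) ^ q * sparseRate n d h b L Δ σ ε) ≤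
            optimalTime N (problemClass (d := d) L Δ σ s) ε ∧
        optimalTime N (problemClass (d := d) L Δ σ s) ε ≤
            ENNReal.ofReal (C * Real.log (n + 1) ^ q * sparseRate n d h b L Δ σ ε)) ∧
      ∃ A : Algorithm N d, A.IsLeonSGD L σ ε ∧
        ∀ s : Setting, ∀ P ∈ problemClass (d := d) L Δ σ s,
          A.LeonFindsBy P L (leonBatch n σ ε) ε
            (C * Real.log (n + 1) ^ q * sparseRate n d h b L Δ σ ε) := by
  -- The exponent `5` is due to the lower bound: four factors for the number of blocks and one for the
  -- length of the windows.
  refine ⟨5, 8000000, 1, by norm_num, one_pos, fun p c₀ hc₀ =>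
    ⟨min (lowerConst p c₀ / 800000) (1 / 38400000) / 3, 200, ?_, by norm_num, ?_⟩⟩
  · have := lowerConst_pos p hc₀
    positivity
  intro n d N h b L Δ σ ε hh hb hL hΔ hσ hε htime hdeg hbw hcd hX hd
  have hn := N.card_pos
  have hlam := log_two_le_log_add_one hn
  have hd0 : 0 < d := by
    have : (0 : ℝ) < 1 * (L * Δ) / (Real.log (n + 1) ^ 3 * ε) := by positivity
    exact_mod_cast this.trans_le hd
  obtain ⟨R⟩ := N.connected.nonempty_routing
  obtain ⟨hB, -⟩ := leonBatch_spec hn σ ε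
  set A := R.leonAlgorithm (Nat.log 2 n + 1) (leonBatch n σ ε) h b L hh.le hb hd0 hbw
  have hA : A.IsLeonSGD L σ ε := fun P ω i k j hj =>
    R.point_leonAlgorithm hh.le hb hd0 hbw P ω hB (Nat.succ_pos _)
      (Nat.lt_pow_succ_log_self (by norm_num) n).le htime i k j hj
  have hfind : ∀ s : Setting, ∀ P ∈ problemClass (d := d) L Δ σ s,
      A.LeonFindsBy P L (leonBatch n σ ε) ε
        (200 * Real.log (n + 1) ^ 5 * sparseRate n d h b L Δ σ ε) := by
    intro s P hP
    have hP' : P.Heterogeneous L Δ σ := by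
      cases s
      · exact hP.toHeterogeneous
      · exact hP
    refine Algorithm.leonFindsBy_of_start_le hn hP' hL hΔ hε fun ω i k hk => ?_
    have := R.start_leonAlgorithm (L := L) hh.le hb hd0 hbw P ω hB htime i k 0 hB
    rw [add_zero] at this
    rw [this, Nat.cast_zero, zero_mul, add_zero]
    exact iterations_mul_le_sparseRate hn hh hb hL hΔ hε hk
  refine ⟨fun s => ⟨ofReal_sparseRate_le_optimalTime hc₀ hh hb hL hσ hε htime hdeg hbw hcd hX hd s,
    iInf_le_of_le A (iSup₂_le fun P hP => ?_)⟩, A, hA, hfind⟩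
  exact Algorithm.timeTo_le_of_leonFindsBy hn hA (hfind s P hP)
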